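/- **Notation.** Words are binary. $D_2(x)$ is the set of words obtained from $x$ by deleting exactly two symbols, and a code $\mathcal C$ corrects two deletions if $D_2(x)\cap D_2(x')=\emptyset$ for all distinct $x,x'\in\mathcal C$. For a nonempty word $w$, $N_w(x)$ is the number of (possibly overlapping) occurrences of $w$ in $x$ as a substring. The pieces of $x$ with respect to $w$ are the words before the first, between consecutive, and after the last occurrence of $w$ (empty between adjacent or overlapping occurrences; the only piece is $x$ if $w$ does not occur), and $L(x,w)$ is the largest length of a piece. For a function $h$ on words, $F_h(x,w)$ is the sequence of the values of $h$ on these pieces. $\tau(x)$ is the length of the longest run of $x$, $\tau_1(x)$ the sequence of the lengths of the runs of ones, $\tau_{\ge2}(x)$ its subsequence of entries $\ge 2$. Let $$\mathcal C_{T2}(n,s)=\{x\in\{0,1\}^n: L(x,0000),L(x,1111),L(x,110011),L(x,11011),\tau(x)\le s\}.$$ **Ingredients**, for given $n,s\ge0$ and a constant $C$: * A hash: for every $m$ a function $h$ on $\{0,1\}^m$, with at most $Cm^4$ values if $m\ge1$, such that $u$ is determined by its length, $h(u)$ and any word obtained from $u$ by at most two deletions. Put $h_s(u)=(|u|,h(u))$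 for $|u|\le s$. Let $q_1$ be the smallest odd prime greater than the size of the image of $h_s$, regard the values of $h_s$ as elements of $\mathbb F_{q_1}$ through any injection, and let $N_1$ be the smallest positive integer with $q_1^{N_1-1}>n$. * A parity-check matrix $H\in\mathbb F_{q_1}^{r_1\times q_1^{N_1-1}}$ of a linear code of minimum distance at least $5$, with $r_1\le 2N_1+\lceil (N_1-1)/3\rceil$; $\mathcal C_2(n,q_1,a)=\{v:Hv=a\}$. * With $Q$ the smallest prime greater than $s$, a parity-check matrix $H_{R1}\in\mathbb F_Q^{2\times s}$ of a code of minimum distance at least $3$; $h_s^{(R)}(u)=H_{R1}\cdot\tau_{\ge2}(u)$ for $|u|\le s$ (with $\tau_{\ge2}(u)$ filled up with zeros). Let $q_2$ be the smallest prime greater than the size of the image of $h^{(R)}_s$, regard its values as elements of $\mathbb F_{q_2}$ through any injection, let $N_2$ be the smallest positive integer with $q_2^{N_2}-1>n$, and $r_2=1+N_2$. * An element $\alpha\in\mathbb F_{q_2^{N_2}}$ of order $q_2^{N_2}-1$; for $a\in\mathbb F_{q_2}\times\mathbb F_{q_2^{N_2}}\cong\mathbb F_{q_2}^{r_2}$,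 $\mathcal C_1(n,q_2,a)$ is the coset with syndrome $a$ of the primitive BCH code over $\mathbb F_{q_2}$ of length $q_2^{N_2}-1$ with roots $1,\alpha$. For $c\in\mathbb F_7^6$, $b\in\mathbb Z_{s+1}$ and $a_{0000},a_{1111},a_{110011}\in\mathbb F_{q_1}^{r_1}$, $a_{11011}\in\mathbb F_{q_2}^{r_2}$, the code $\mathcal C^{(2)}$ consists of all $x\in\mathcal C_{T2}(n,s)$ such that $N_0,N_1,N_{0000},N_{1111},N_{110011},N_{11011}$ of $x$ are congruent modulo $7$ to $c_1,\dots,c_6$, $F_{h_s}(x,w)\in\mathcal C_2(n,q_1,a_w)$ for $w=0000,1111,110011$, $F_{h_s^{(R)}}(x,11011)\in\mathcal C_1(n,q_2,a_{11011})$ (sequences are filled up with zeros), and $\sum_{i\text{ odd}}\tau_1(x)_i\equiv b \pmod{s+1}$. **Theorem.** 1. The $2\times s$ matrix with rows $(1,\dots,1)$ and $(1,2,\dots,s)$ over $\mathbb F_Q$ is a parity-check matrix of a code of minimum distance at least $3$. If $H_{R1}$ is this matrix, then for all $n,s,C$, all other ingredients and all parameters, $\mathcal C^{(2)}$ corrects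 two deletions. 2. For all $n,s,C$ and all ingredients (with any $H_{R1}$) there are parameters with $$|\mathcal C^{(2)}|\ \ge\ \frac{|\mathcal C_{T2}(n,s)|}{7^6\,q_1^{3r_1}\,q_2^{r_2}\,(s+1)}.$$ 3. For every $C$ there is a constant $K$ such that for all $n\ge4$, with $s=\lceil1065\log_2 n\rceil$, and all ingredients (with any $H_{R1}$) some choice of parameters gives a nonempty code with $$\log_2|\mathcal C^{(2)}|\ \ge\ \log_2|\mathcal C_{T2}(n,s)|-8\log_2 n-K\log_2\log_2 n.$$ 4. There is a constant $K$ such that for all $n\ge2$ and all integers $s\ge1065\log_2 n$ the set $\mathcal C_{T2}(n,s)$ is nonempty and $\log_2|\mathcal C_{T2}(n,s)|\ge n-K$. 5. There are constants $C,K$ such that for all $n\ge4$, with $s=\lceil 1065\log_2n\rceil$, there are ingredients, with $H_{R1}$ as in 1, and parameters for which $\mathcal C^{(2)}$ is nonempty, corrects two deletions, and $$\log_2|\mathcal C^{(2)}|\ \ge\ n-8\log_2 n-K\log_2\log_2 n.$$ -/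

import Mathlib

/-! Binary words are lists of booleans (`true` is the symbol 1, `false` the symbol 0). -/

namespace TwoDel

/-! ### Deletions -/

/-- `deletionBall x` is the set of words obtained from `x` by deleting exactly two symbols. -/
def deletionBall (x : List Bool) : Set (List Bool) :=
  {y | y.Sublist x ∧ y.length + 2 = x.length}

/-- A code corrects two deletions if a codeword is determined by any word obtained from it by two
deletions. -/
def CorrectsTwoDeletions (C : Set (List Bool)) : Prop :=
  ∀ x ∈ C, ∀ x' ∈ C, ∀ y, y ∈ deletionBall x → y ∈ deletionBall x' → x = x'

/-! ### Occurrences of a substring, and the pieces they cut out -/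

def w0000 : List Bool := [false, false, false, false]
def w1111 : List Bool := [true, true, true, true]
def w110011 : List Bool := [true, true, false, false, true, true]
def w11011 : List Bool := [true, true, false, true, true]

/-- The (0-based) positions, in increasing order, at which the nonempty word `w` occurs in `x` as a
substring of consecutive symbols; occurrences may overlap. -/
def occurrences (w x : List Bool) : List ℕ :=
  (List.range x.length).filter fun i => w.isPrefixOf (x.drop i)

/-- `N_w(x)`, the number of occurrences of `w` in `x`. -/
def numOcc (w x : List Bool) : ℕ := (occurrences w x).length

/-- The words before the first, between consecutive, and after the last occurrence of `w` in `x`.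
The word between two adjacent or overlapping occurrences is empty (the truncated difference
`p.2 - p.1` is then `0`); if `w` does not occur, the only piece is `x`. -/
def pieces (w x : List Bool) : List (List Bool) :=
  (List.zip (0 :: (occurrences w x).map (· + w.length)) (occurrences w x ++ [x.length])).map
    fun p => (x.drop p.1).take (p.2 - p.1)

/-- `L(x, w)`: the largest number of symbols between occurrences of `w` in `x`, where the parts
before the first and after the last occurrence count as well. -/
def maxGap (w x : List Bool) : ℕ := ((pieces w x).map List.length).foldr max 0

/-! ### Runs -/

/-- The maximal runs of equal symbols of `x`, from left to right. -/
def runs (x : List Bool) : List (List Bool) := x.splitBy (· == ·)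

/-- `τ(x)`: the length of the longest run of `x`. -/
def maxRun (x : List Bool) : ℕ := ((runs x).map List.length).foldr max 0

/-- `τ₁(x)`: the lengths of the runs of ones of `x`, from left to right. -/
def oneRuns (x : List Bool) : List ℕ :=
  ((runs x).filter fun r => r.contains true).map List.length

/-- `τ_{≥2}(x)`: the lengths of the runs of at least two ones of `x`, from left to right. -/
def longOneRuns (x : List Bool) : List ℕ := (oneRuns x).filter fun k => 2 ≤ k

/-- The sum of the entries of `τ₁(x)` with odd index, indices starting at 1. -/
def oddRunSum (x : List Bool) : ℕ :=
  ∑ i ∈ Finset.range (oneRuns x).length, if Even i then (oneRuns x).getD i 0 else 0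

/-- The constrained set `C_T2(n, s)`. -/
def CT2 (n s : ℕ) : Set (List Bool) :=
  {x | x.length = n ∧ maxGap w0000 x ≤ s ∧ maxGap w1111 x ≤ s ∧ maxGap w110011 x ≤ s ∧
    maxGap w11011 x ≤ s ∧ maxRun x ≤ s}

/-! ### Primes, linear codes -/

/-- The smallest prime greater than `m`. -/
noncomputable def nextPrime (m : ℕ) : ℕ := sInf {p | p.Prime ∧ m < p}

/-- The smallest odd prime greater than `m`. -/
noncomputable def nextOddPrime (m : ℕ) : ℕ := sInf {p | p.Prime ∧ Odd p ∧ m < p}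

theorem nextPrime_prime (m : ℕ) : (nextPrime m).Prime := by
  have h : {p : ℕ | p.Prime ∧ m < p}.Nonempty := by
    obtain ⟨p, hp, hp'⟩ := Nat.exists_infinite_primes (m + 1)
    exact ⟨p, hp', hp⟩
  exact (Nat.sInf_mem h).1

theorem nextOddPrime_prime (m : ℕ) : (nextOddPrime m).Prime := by
  have h : {p : ℕ | p.Prime ∧ Odd p ∧ m < p}.Nonempty := by
    obtain ⟨p, hp, hp'⟩ := Nat.exists_infinite_primes (m + 3)
    exact ⟨p, hp', hp'.odd_of_ne_two (by omega), by omega⟩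
  exact (Nat.sInf_mem h).1

instance nextPrime_fact (m : ℕ) : Fact (nextPrime m).Prime := ⟨nextPrime_prime m⟩

instance nextOddPrime_fact (m : ℕ) : Fact (nextOddPrime m).Prime := ⟨nextOddPrime_prime m⟩

/-- `H` is a parity-check matrix of a linear code with minimum Hamming distance at least `d`. -/
def IsParityCheck {q r m : ℕ} (d : ℕ) (H : Matrix (Fin r) (Fin m) (ZMod q)) : Prop :=
  ∀ v : Fin m → ZMod q, H.mulVec v = 0 → v ≠ 0 → d ≤ hammingNorm v

/-- A sequence of symbols as a vector of length `m`, filled up with zeros at the end. -/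
def padded {q : ℕ} (m : ℕ) (l : List (ZMod q)) : Fin m → ZMod q := fun i => l.getD i 0

/-! ### The hash function `h_s` -/

/-- `h` hashes, for every `m`, the words of length `m` with at most `C * m ^ 4` values
(that is, with `4 log₂ m + O(1)` bits), in such a way that a word `u` of known length can be
recovered from `h u` and any word obtained from `u` by at most two deletions. -/
def IsTwoDeletionHash (C : ℕ) (h : List Bool → ℕ) : Prop :=
  (∀ u v y : List Bool, u.length = v.length → y.Sublist u → y.Sublist v →
    u.length ≤ y.length + 2 → h u = h v → u = v) ∧
  ∀ m : ℕ, 1 ≤ m → (h '' {u | u.length = m}).ncard ≤ C * m ^ 4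

/-- `h_s` on words of length at most `s`: the hash together with the length of the word. -/
def pieceHash (h : List Bool → ℕ) (u : List Bool) : ℕ × ℕ := (u.length, h u)

/-- The image of `h_s`. -/
def hashImage (h : List Bool → ℕ) (s : ℕ) : Set (ℕ × ℕ) := pieceHash h '' {u | u.length ≤ s}

/-- `q₁`: the smallest odd prime greater than the size of the image of `h_s`. -/
noncomputable abbrev q₁ (h : List Bool → ℕ) (s : ℕ) : ℕ := nextOddPrime (hashImage h s).ncard

/-- `N₁`: the smallest positive integer with `q₁ ^ (N₁ - 1) > n`. -/
noncomputable abbrev N₁ (n : ℕ) (h : List Bool → ℕ) (s : ℕ) : ℕ :=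
  sInf {N | 0 < N ∧ n < q₁ h s ^ (N - 1)}

/-! ### The run hash `h_s^(R)` -/

/-- `h_s^(R)(u) = H · τ_{≥2}(u)`, where `τ_{≥2}(u)` is filled up with zeros to length `s`. -/
noncomputable def runHash {s : ℕ} (H : Matrix (Fin 2) (Fin s) (ZMod (nextPrime s)))
    (u : List Bool) : Fin 2 → ZMod (nextPrime s) :=
  H.mulVec (padded s ((longOneRuns u).map fun k => (k : ZMod (nextPrime s))))

/-- The image of `h_s^(R)` on words of length at most `s`. -/
def runImage {s : ℕ} (H : Matrix (Fin 2) (Fin s) (ZMod (nextPrime s))) :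
    Set (Fin 2 → ZMod (nextPrime s)) := runHash H '' {u | u.length ≤ s}

/-- `q₂`: the smallest prime greater than the size of the image of `h_s^(R)`. -/
noncomputable abbrev q₂ {s : ℕ} (H : Matrix (Fin 2) (Fin s) (ZMod (nextPrime s))) : ℕ :=
  nextPrime (runImage H).ncard

/-- `N₂`: the smallest positive integer with `q₂ ^ N₂ - 1 > n`. -/
noncomputable abbrev N₂ (n : ℕ) {s : ℕ} (H : Matrix (Fin 2) (Fin s) (ZMod (nextPrime s))) : ℕ :=
  sInf {N | 0 < N ∧ n < q₂ H ^ N - 1}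

/-- The `2 × s` matrix with rows `(1, …, 1)` and `(1, 2, …, s)`. -/
noncomputable def runMatrix (s : ℕ) : Matrix (Fin 2) (Fin s) (ZMod (nextPrime s)) :=
  Matrix.of ![fun _ => 1, fun j => ((j : ℕ) : ZMod (nextPrime s)) + 1]

/-! ### The code -/

/-- The ingredients from which the code of length `n` is built. -/
structure Ingredients (n s C : ℕ) where
  /-- the hash function -/
  h : List Bool → ℕ
  h_hash : IsTwoDeletionHash C h
  /-- identification of the hash values with elements of the field with `q₁` elements -/
  e₁ : ℕ × ℕ → ZMod (q₁ h s)
  e₁_inj : Set.InjOn e₁ (hashImage h s)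
  /-- redundancy and parity-check matrix of the double-error-correcting code -/
  r₁ : ℕ
  r₁_le : r₁ ≤ 2 * N₁ n h s + ⌈((N₁ n h s : ℚ) - 1) / 3⌉₊
  H₁ : Matrix (Fin r₁) (Fin (q₁ h s ^ (N₁ n h s - 1))) (ZMod (q₁ h s))
  H₁_dist : IsParityCheck 5 H₁
  /-- the matrix `H_R1` of the run hash -/
  HR : Matrix (Fin 2) (Fin s) (ZMod (nextPrime s))
  HR_dist : IsParityCheck 3 HR
  /-- identification of the values of the run hash with elements of the field with `q₂` elements -/
  e₂ : (Fin 2 → ZMod (nextPrime s)) → ZMod (q₂ HR)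
  e₂_inj : Set.InjOn e₂ (runImage HR)
  /-- the primitive element that defines the BCH code -/
  α : GaloisField (q₂ HR) (N₂ n HR)
  α_order : orderOf α = q₂ HR ^ N₂ n HR - 1

namespace Ingredients

variable {n s C : ℕ} (D : Ingredients n s C)

/-- `F_{h_s}(x, w)`: the sequence of hashes of the pieces of `x`. -/
def F (x w : List Bool) : List (ZMod (q₁ D.h s)) :=
  (pieces w x).map fun u => D.e₁ (pieceHash D.h u)

/-- `F_{h_s^(R)}(x, w)`: the sequence of run hashes of the pieces of `x`. -/
noncomputable def FR (x w : List Bool) : List (ZMod (q₂ D.HR)) :=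
  (pieces w x).map fun u => D.e₂ (runHash D.HR u)

/-- `C₂(n, q₁, a)`: the coset with syndrome `a` of the double-error-correcting code. -/
def C₂ (a : Fin D.r₁ → ZMod (q₁ D.h s)) :
    Set (Fin (q₁ D.h s ^ (N₁ n D.h s - 1)) → ZMod (q₁ D.h s)) :=
  {v | D.H₁.mulVec v = a}

/-- The syndromes of the primitive BCH code with roots `1` and `α`: the pairs of an element of
`F_{q₂}` and an element of `F_{q₂ ^ N₂}`, which is a space of dimension `r₂ = 1 + N₂`. -/
abbrev BCHSyndrome : Type := ZMod (q₂ D.HR) × GaloisField (q₂ D.HR) (N₂ n D.HR)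

/-- `C₁(n, q₂, a)`: the coset with syndrome `a` of the primitive BCH code of length `q₂ ^ N₂ - 1`
with roots `1` and `α`; the coefficient vector `v` stands for the polynomial `∑ vᵢ Xⁱ`. -/
def C₁ (a : D.BCHSyndrome) : Set (Fin (q₂ D.HR ^ N₂ n D.HR - 1) → ZMod (q₂ D.HR)) :=
  {v | ∑ i, v i = a.1 ∧
    ∑ i, algebraMap (ZMod (q₂ D.HR)) (GaloisField (q₂ D.HR) (N₂ n D.HR)) (v i) * D.α ^ (i : ℕ)
      = a.2}

/-- The parameters of the code. -/
structure Params where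
  a0000 : Fin D.r₁ → ZMod (q₁ D.h s)
  a1111 : Fin D.r₁ → ZMod (q₁ D.h s)
  a110011 : Fin D.r₁ → ZMod (q₁ D.h s)
  a11011 : D.BCHSyndrome
  c : Fin 6 → ZMod 7
  b : ZMod (s + 1)

/-- The code `C^(2)(n, a0000, a1111, a110011, a11011, c, b, s)`. -/
def code (p : D.Params) : Set (List Bool) :=
  {x | x ∈ CT2 n s ∧
    (numOcc [false] x : ZMod 7) = p.c 0 ∧
    (numOcc [true] x : ZMod 7) = p.c 1 ∧
    (numOcc w0000 x : ZMod 7) = p.c 2 ∧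
    (numOcc w1111 x : ZMod 7) = p.c 3 ∧
    (numOcc w110011 x : ZMod 7) = p.c 4 ∧
    (numOcc w11011 x : ZMod 7) = p.c 5 ∧
    padded _ (D.F x w0000) ∈ D.C₂ p.a0000 ∧
    padded _ (D.F x w1111) ∈ D.C₂ p.a1111 ∧
    padded _ (D.F x w110011) ∈ D.C₂ p.a110011 ∧
    padded _ (D.FR x w11011) ∈ D.C₁ p.a11011 ∧
    (oddRunSum x : ZMod (s + 1)) = p.b}

end Ingredients

/-- The run bound `s = ⌈1065 log₂ n⌉`. -/
noncomputable def sOf (n : ℕ) : ℕ := ⌈1065 * Real.logb 2 n⌉₊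

end TwoDel

/-! Correction of two deletions. Let codewords `x`, `x'` have a common word `y` after two deletions
each. The count of ones modulo 7 shows that the same symbols are deleted from both. Deleting a
symbol `b` either destroys at most one occurrence of `bbbb` or creates at most three of the
complementary word, never both, so the counts modulo 7 force equal net changes in `x` and `x'`.

A deletion is good for `w` if it meets no occurrence of `w` and creates none; it then removes one
symbol of one piece. If two good deletions lead from each codeword to `y`, the hash sequences differ
in at most four places, hence agree by distance 5, and every piece is recovered from its hash and
the corresponding piece of `y` (`Agree.eq_of_good`). This is used with `0000` and `1111` if one of
these words is undisturbed. Otherwise, for a suitable order of the deletions, a deletion among zeros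
is typically followed by one among ones. The former is mild: invisible to `1111`, to `110011` and to
the long runs of ones between occurrences of `11011`. The latter shortens a run of at least four
ones or merges two runs (`eq_of_longRunDeletion`, `eq_of_mergingDeletion`; the mixed comparison is
`eq_of_mild_of_merging`).

For the latter, `110011` serves as `w`. It fails only if a run `1111` between `1100` and `0011` is
shortened (a junction), or if the deleted zero split off a single one next to `00`. If both
codewords touch the same run of `y`, the pieces between `1111` decide. If they touch different runs,
the long runs between `11011` differ by one unit of length moved from one run to another. The run
hash, which is the sum and the first moment modulo a prime greater than `s`, detects this
(`two_runs_of_sameRunHash`), unless both runs lose two ones to neighbouring occurrences of `11011`.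
This exception is impossible for junctions, and for splits it contradicts the piece lengths
contained in the hash for `1111`.

Size. The codes with all possible parameters cover `CT2`, so one has at least the average size. A
word outside `CT2` has a window of length `s` that avoids a word of length at most 6; a union bound
leaves half of all words. Since `s = O(log n)`, the primes are polylogarithmic, and `3 r₁ ≤ 7 N₁ +
1` and `r₂ = 1 + N₂` give `7 + 1 = 8` times `log₂ n` bits.

Ingredients. A greedy colouring of the confusability graph yields the hash. The distance-5 code has
as columns a point of `F ^ m` together with a constant, its square in an extension of odd degree,
and cubic forms without common zero: the square puts four dependent points on a line, where the
cubic forms separate them (`exists_isParityCheck_five`). -/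

namespace TwoDel

/-! ### Cutting a word at the occurrences of `w` -/

/-- The number of occurrences of `w` in `r.reverse ++ v` that straddle the cut. -/
def straddle (w r v : List Bool) : ℕ :=
  (List.range w.length).countP fun k =>
    decide (0 < k) && ((w.take k).reverse.isPrefixOf r && (w.drop k).isPrefixOf v)

theorem numOcc_nil (w : List Bool) : numOcc w [] = 0 := rfl

theorem numOcc_cons (w : List Bool) (a : Bool) (x : List Bool) :
    numOcc w (a :: x) = (if w.isPrefixOf (a :: x) then 1 else 0) + numOcc w x := by
  unfold numOcc occurrences
  rw [List.length_cons, List.range_succ_eq_map, List.filter_cons]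
  have h : (List.filter (fun i => w.isPrefixOf (List.drop i (a :: x)))
      (List.map Nat.succ (List.range x.length))).length =
      (List.filter (fun i => w.isPrefixOf (List.drop i x)) (List.range x.length)).length := by
    rw [List.filter_map, List.length_map]
    rfl
  by_cases hp : w.isPrefixOf (a :: x)
  · simp [hp, h]; omega
  · simp [hp, h]

/-- Join two sequences of words by concatenating the last word of the first with the first word of
the second. -/
def glue {α : Type*} : List (List α) → List (List α) → List (List α)
  | [], Q => Q
  | p :: P, Q =>
    match P, Q with
    | [], [] => [p]
    | [], q :: Q => (p ++ q) :: Q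
    | P, Q => p :: glue P Q

theorem glue_cons_cons {α : Type*} (p p' : List α) (P Q : List (List α)) :
    glue (p :: p' :: P) Q = p :: glue (p' :: P) Q := by
  cases Q <;> rfl

theorem glue_append {α : Type*} (S : List (List α)) (c d : List α) (T : List (List α)) :
    glue (S ++ [c]) (d :: T) = S ++ (c ++ d) :: T := by
  induction S with
  | nil => rfl
  | cons p S ih =>
    cases S with
    | nil => simp only [List.cons_append, List.nil_append, glue_cons_cons]; rfl
    | cons q S =>
      simp only [List.cons_append, glue_cons_cons] at ih ⊢
      rw [ih]

/-- Prepend a symbol to the first word of a sequence. -/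
def consHead (a : Bool) : List (List Bool) → List (List Bool)
  | [] => [[a]]
  | p :: P => (a :: p) :: P

/-- The word `x`, cut in front of every occurrence of `w`. -/
def chunks (w : List Bool) : List Bool → List (List Bool)
  | [] => [[]]
  | a :: x => if w.isPrefixOf (a :: x) then [] :: consHead a (chunks w x) else consHead a (chunks w x)

theorem consHead_ne_nil (a : Bool) (P : List (List Bool)) : consHead a P ≠ [] := by
  cases P <;> simp [consHead]

theorem chunks_ne_nil (w x : List Bool) : chunks w x ≠ [] := by
  cases x with
  | nil => simp [chunks]
  | cons a x =>
    unfold chunks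
    split
    · simp
    · exact consHead_ne_nil _ _

theorem flatten_chunks (w x : List Bool) : (chunks w x).flatten = x := by
  induction x with
  | nil => rfl
  | cons a x ih =>
    have h : (consHead a (chunks w x)).flatten = a :: x := by
      cases hc : chunks w x with
      | nil => exact absurd hc (chunks_ne_nil w x)
      | cons p P => rw [hc] at ih; simp only [consHead, List.flatten_cons, List.cons_append] at ih ⊢; rw [ih]
    unfold chunks
    split
    · simpa using h
    · exact h

theorem length_consHead_chunks (w x : List Bool) (a : Bool) :
    (consHead a (chunks w x)).length = (chunks w x).length := by
  cases hc : chunks w x with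
  | nil => exact absurd hc (chunks_ne_nil w x)
  | cons p P => rfl

theorem length_chunks (w x : List Bool) : (chunks w x).length = numOcc w x + 1 := by
  induction x with
  | nil => rfl
  | cons a x ih =>
    rw [numOcc_cons, chunks]
    split
    · rw [List.length_cons, length_consHead_chunks, ih]; omega
    · rw [length_consHead_chunks, ih]; omega

theorem isPrefixOf_append_iff {w : List Bool} (a : Bool) (u v : List Bool) :
    w.isPrefixOf (a :: u ++ v) = true ↔ w.isPrefixOf (a :: u) = true ∨
      (u.length + 1 < w.length ∧ w.take (u.length + 1) = a :: u ∧ w.drop (u.length + 1) <+: v) := by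
  rw [List.isPrefixOf_iff_prefix, List.isPrefixOf_iff_prefix]
  constructor
  · intro h
    by_cases hl : w.length ≤ u.length + 1
    · left
      exact List.prefix_of_prefix_length_le h (List.prefix_append _ _) (by simpa using hl)
    · right
      obtain ⟨t, ht⟩ := h
      have h1 : w.take (u.length + 1) = a :: u := by
        have := congrArg (List.take (u.length + 1)) ht
        rw [List.take_append_of_le_length (by omega)] at this
        rw [this]
        exact List.take_left' (by simp)
      have h2 := congrArg (List.drop (u.length + 1)) ht
      rw [List.drop_append_of_le_length (by omega)] at h2
      have h3 : List.drop (u.length + 1) (a :: u ++ v) = v := List.drop_left' (by simp)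
      refine ⟨by omega, h1, t, ?_⟩
      rw [h2, h3]
  · rintro (h | ⟨_, h1, t, h2⟩)
    · exact h.trans (List.prefix_append _ _)
    · refine ⟨t, ?_⟩
      rw [← h1, ← h2, ← List.append_assoc, List.take_append_drop]

theorem straddle_nil (w v : List Bool) : straddle w [] v = 0 := by
  unfold straddle
  rw [List.countP_eq_zero]
  intro k hk
  rw [List.mem_range] at hk
  simp only [Bool.and_eq_true, decide_eq_true_eq, not_and]
  intro h0 h1
  rw [List.isPrefixOf_iff_prefix, List.prefix_nil] at h1
  simp at h1
  rcases h1 with h1 | h1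
  · omega
  · simp [h1] at hk

/-- The new symbol `a` is the first one of the left part, so the only additional crossing occurrence
is one that starts at `a`. -/
theorem straddle_concat (w u v : List Bool) (a : Bool) :
    straddle w (u.reverse ++ [a]) v = straddle w u.reverse v +
      if u.length + 1 < w.length ∧ w.take (u.length + 1) = a :: u ∧ w.drop (u.length + 1) <+: v
      then 1 else 0 := by
  unfold straddle
  have key : ∀ k ∈ List.range w.length,
      ((decide (0 < k) && ((w.take k).reverse.isPrefixOf (u.reverse ++ [a]) &&
        (w.drop k).isPrefixOf v)) = true ↔
      ((decide (0 < k) && ((w.take k).reverse.isPrefixOf u.reverse &&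
        (w.drop k).isPrefixOf v)) = true ∨
        (decide (k = u.length + 1) && decide (w.take (u.length + 1) = a :: u ∧
          w.drop (u.length + 1) <+: v)) = true)) := by
    intro k hk
    rw [List.mem_range] at hk
    have e1 : (w.take k).reverse.isPrefixOf (u.reverse ++ [a]) = true ↔ w.take k <:+ a :: u := by
      rw [List.isPrefixOf_iff_prefix, show u.reverse ++ [a] = (a :: u).reverse by simp,
        List.reverse_prefix]
    have e2 : (w.take k).reverse.isPrefixOf u.reverse = true ↔ w.take k <:+ u := by
      rw [List.isPrefixOf_iff_prefix, List.reverse_prefix]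
    simp only [Bool.and_eq_true, decide_eq_true_eq, e1, e2, List.suffix_cons_iff,
      List.isPrefixOf_iff_prefix]
    constructor
    · rintro ⟨h0, h1 | h1, h2⟩
      · right
        have : k = u.length + 1 := by
          have := congrArg List.length h1
          rw [List.length_take, List.length_cons] at this
          omega
        subst this
        exact ⟨rfl, h1, h2⟩
      · left; exact ⟨h0, h1, h2⟩
    · rintro (⟨h0, h1, h2⟩ | ⟨h0, h1, h2⟩)
      · exact ⟨h0, Or.inr h1, h2⟩
      · subst h0; exact ⟨by omega, Or.inl h1, h2⟩
  have hex : ∀ k ∈ List.range w.length,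
      ¬ ((decide (0 < k) && ((w.take k).reverse.isPrefixOf u.reverse &&
        (w.drop k).isPrefixOf v)) = true ∧
        (decide (k = u.length + 1) && decide (w.take (u.length + 1) = a :: u ∧
          w.drop (u.length + 1) <+: v)) = true) := by
    intro k hk
    rw [List.mem_range] at hk
    have e2 : (w.take k).reverse.isPrefixOf u.reverse = true ↔ w.take k <:+ u := by
      rw [List.isPrefixOf_iff_prefix, List.reverse_prefix]
    simp only [Bool.and_eq_true, decide_eq_true_eq, e2]
    rintro ⟨⟨_, h1, _⟩, h2, _⟩
    have := h1.length_le
    rw [List.length_take] at this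
    omega
  have cadd : ∀ (l : List ℕ) (p q r : ℕ → Bool), (∀ k ∈ l, (p k = true ↔ q k = true ∨ r k = true)) →
      (∀ k ∈ l, ¬ (q k = true ∧ r k = true)) → l.countP p = l.countP q + l.countP r := by
    intro l p q r
    induction l with
    | nil => simp
    | cons b l ih =>
      intro h1 h2
      simp only [List.mem_cons, forall_eq_or_imp] at h1 h2
      simp only [List.countP_cons]
      rw [ih h1.2 h2.2]
      have h3 := h1.1
      have h4 := h2.1
      cases hp : p b <;> cases hq : q b <;> cases hr : r b <;> simp_all <;> omega
  rw [cadd _ _ _ _ key hex]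
  congr 1
  split
  · rename_i h
    have : (fun k => decide (k = u.length + 1) && decide (w.take (u.length + 1) = a :: u ∧
          w.drop (u.length + 1) <+: v)) = fun k => k == (u.length + 1) := by
      funext k
      rw [decide_eq_true (p := w.take (u.length + 1) = a :: u ∧
          w.drop (u.length + 1) <+: v) h.2, Bool.and_true]
      rfl
    rw [this]
    change List.count _ _ = 1
    exact List.count_eq_one_of_mem List.nodup_range (List.mem_range.2 h.1)
  · rename_i h
    rw [List.countP_eq_zero]
    intro k hk
    rw [List.mem_range] at hk
    simp only [Bool.and_eq_true, decide_eq_true_eq, not_and]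
    rintro rfl h1 h2
    exact h ⟨hk, h1, h2⟩

theorem numOcc_append (w u v : List Bool) :
    numOcc w (u ++ v) = numOcc w u + numOcc w v + straddle w u.reverse v := by
  induction u with
  | nil => simp [numOcc_nil, straddle_nil]
  | cons a u ih =>
    rw [List.reverse_cons, straddle_concat, List.cons_append, numOcc_cons, numOcc_cons, ih]
    have h := isPrefixOf_append_iff (w := w) a u v
    rw [List.cons_append] at h
    by_cases h1 : w.isPrefixOf (a :: u) = true
    · have h2 : ¬ (u.length + 1 < w.length ∧ w.take (u.length + 1) = a :: u ∧
          w.drop (u.length + 1) <+: v) := by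
        rw [List.isPrefixOf_iff_prefix] at h1
        have := h1.length_le
        simp only [List.length_cons] at this
        omega
      rw [if_pos (h.2 (Or.inl h1)), if_pos h1, if_neg h2]; omega
    · by_cases h2 : (u.length + 1 < w.length ∧ w.take (u.length + 1) = a :: u ∧
          w.drop (u.length + 1) <+: v)
      · rw [if_pos (h.2 (Or.inr h2)), if_neg h1, if_pos h2]; omega
      · rw [if_neg (fun h3 => (h.1 h3).elim h1 h2), if_neg h1, if_neg h2]; omega

theorem consHead_glue (a : Bool) {P Q : List (List Bool)} (hP : P ≠ []) (hQ : Q ≠ []) :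
    consHead a (glue P Q) = glue (consHead a P) Q := by
  obtain ⟨q, Q, rfl⟩ := List.exists_cons_of_ne_nil hQ
  match P, hP with
  | [p], _ => rfl
  | p :: p' :: P, _ => simp only [consHead, glue_cons_cons]

theorem glue_nil_singleton {α : Type*} {P : List (List α)} (h : P ≠ []) : glue [[]] P = P := by
  obtain ⟨q, Q, rfl⟩ := List.exists_cons_of_ne_nil h
  rfl

/-- This is the advantage of cutting in front of the occurrences: if none crosses the border, then
`u` alone decides at which positions in `u` an occurrence starts. -/
theorem chunks_append {w u v : List Bool} (h : straddle w u.reverse v = 0) :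
    chunks w (u ++ v) = glue (chunks w u) (chunks w v) := by
  induction u with
  | nil => exact (glue_nil_singleton (chunks_ne_nil w v)).symm
  | cons a u ih =>
    rw [List.reverse_cons, straddle_concat, Nat.add_eq_zero_iff] at h
    have hp := isPrefixOf_append_iff (w := w) a u v
    have h2 : ¬ (u.length + 1 < w.length ∧ w.take (u.length + 1) = a :: u ∧
          w.drop (u.length + 1) <+: v) := by
      intro h3
      rw [if_pos h3] at h
      exact one_ne_zero h.2
    have hp' : (w.isPrefixOf (a :: (u ++ v)) = true ↔ w.isPrefixOf (a :: u) = true) := by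
      rw [← List.cons_append, hp]; tauto
    rw [List.cons_append, chunks, ih h.1, chunks, consHead_glue a (chunks_ne_nil w u) (chunks_ne_nil w v)]
    by_cases h1 : w.isPrefixOf (a :: u) = true
    · rw [if_pos (hp'.2 h1), if_pos h1]
      obtain ⟨p, P, hP⟩ := List.exists_cons_of_ne_nil (consHead_ne_nil a (chunks w u))
      rw [hP, glue_cons_cons]
    · rw [if_neg (fun h3 => h1 (hp'.1 h3)), if_neg h1]

/-- The pieces, from the chunks. -/
def dropHeads (k : ℕ) : List (List Bool) → List (List Bool)
  | [] => []
  | p :: P => p :: P.map (List.drop k)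

theorem occurrences_cons (w : List Bool) (a : Bool) (x : List Bool) :
    occurrences w (a :: x) =
      (if w.isPrefixOf (a :: x) then [0] else []) ++ (occurrences w x).map (· + 1) := by
  unfold occurrences
  rw [List.length_cons, List.range_succ_eq_map, List.filter_cons, List.filter_map]
  simp only [List.drop_zero]
  split <;> rfl

/-- A later chunk is an occurrence of `w` followed by a piece, or only a beginning of `w` if the
next occurrence overlaps. In the second case `List.drop` returns the empty word, like the truncated
difference in `pieces`. -/
theorem pieces_eq_dropHeads (w : List Bool) (x : List Bool) (hw : w ≠ []) :
    pieces w x = dropHeads w.length (chunks w x) := by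
  induction x with
  | nil => rfl
  | cons a x ih =>
    -- the first piece, and the remaining ones
    have hshift : ∀ (l : List (ℕ × ℕ)), (l.map fun p => (p.1 + 1, p.2 + 1)).map
        (fun p : ℕ × ℕ => ((a :: x).drop p.1).take (p.2 - p.1)) =
        l.map fun p => (x.drop p.1).take (p.2 - p.1) := by
      intro l
      rw [List.map_map]
      refine List.map_congr_left fun p _ => ?_
      simp
    have hzip : ∀ l l' : List ℕ, List.zip (l.map (· + 1)) (l'.map (· + 1)) =
        (List.zip l l').map fun p => (p.1 + 1, p.2 + 1) := by
      intro l l'; rw [List.zip_map]; rfl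
    have hwl : 0 < w.length := List.length_pos_iff.2 hw
    set o := occurrences w x with ho
    -- decompose the pieces of `x`
    obtain ⟨e, E, hE⟩ : ∃ e E, o ++ [x.length] = e :: E := by
      cases o with
      | nil => exact ⟨_, _, rfl⟩
      | cons e E => exact ⟨_, _, rfl⟩
    have hx : pieces w x = (x.take e) ::
        (List.zip (o.map (· + w.length)) E).map (fun p => (x.drop p.1).take (p.2 - p.1)) := by
      unfold pieces
      rw [← ho, hE, List.zip_cons_cons, List.map_cons]
      simp
    have hE' : o.map (· + 1) ++ [(a :: x).length] = (e + 1) :: E.map (· + 1) := by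
      rw [← List.map_cons (f := (· + 1)), ← hE]; simp
    have hmap : (o.map (· + 1)).map (· + w.length) = (o.map (· + w.length)).map (· + 1) := by
      rw [List.map_map, List.map_map]
      refine List.map_congr_left fun p _ => ?_
      simp only [Function.comp]; omega
    obtain ⟨p, P, hP⟩ := List.exists_cons_of_ne_nil (chunks_ne_nil w x)
    rw [hP, hx] at ih
    simp only [dropHeads, List.cons.injEq] at ih
    rw [chunks, hP]
    unfold pieces
    rw [occurrences_cons, ← ho]
    split
    · rw [List.singleton_append, List.map_cons, hmap, List.cons_append, hE', List.zip_cons_cons,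
        List.zip_cons_cons, hzip, List.map_cons, List.map_cons, hshift, ih.2]
      simp only [consHead, dropHeads, List.map_cons, List.cons.injEq, and_true]
      refine ⟨by simp, ?_⟩
      obtain ⟨k, hk⟩ : ∃ k, w.length = k + 1 := ⟨w.length - 1, by omega⟩
      rw [hk, ← ih.1]
      simp only [Nat.zero_add, List.drop_succ_cons]
      rw [List.drop_take]
      congr 1
      omega
    · rw [List.nil_append, hmap, hE', List.zip_cons_cons, hzip, List.map_cons, hshift, ih.2]
      simp [consHead, dropHeads, ← ih.1]

theorem length_pieces (w x : List Bool) (hw : w ≠ []) : (pieces w x).length = numOcc w x + 1 := by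
  rw [pieces_eq_dropHeads w x hw, ← length_chunks]
  cases chunks w x <;> simp [dropHeads]

/-- The last chunk is the first one, or it starts with `w`. -/
theorem chunks_last (w x : List Bool) :
    ∃ S c, chunks w x = S ++ [c] ∧ (S ≠ [] → w <+: c) := by
  induction x with
  | nil => exact ⟨[], [], rfl, by simp⟩
  | cons a x ih =>
    obtain ⟨S, c, h, hS⟩ := ih
    rw [chunks, h]
    cases S with
    | nil =>
      rw [List.nil_append] at h
      have hx := flatten_chunks w x
      rw [h] at hx
      simp only [List.flatten_cons, List.flatten_nil, List.append_nil] at hx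
      split
      · rename_i hp
        refine ⟨[[]], a :: c, rfl, fun _ => ?_⟩
        rw [hx]; exact List.isPrefixOf_iff_prefix.1 hp
      · exact ⟨[], a :: c, rfl, by simp⟩
    | cons s S =>
      split
      · exact ⟨[] :: (a :: s) :: S, c, rfl, fun _ => hS (by simp)⟩
      · exact ⟨(a :: s) :: S, c, rfl, fun _ => hS (by simp)⟩

/-- The length bound is needed because a shorter `c` would let the dropping after the gluing reach
into `d`. -/
theorem dropHeads_glue {k : ℕ} {S T : List (List Bool)} {c d : List Bool}
    (h : S ≠ [] → k ≤ c.length) :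
    dropHeads k (glue (S ++ [c]) (d :: T)) = glue (dropHeads k (S ++ [c])) (dropHeads k (d :: T)) := by
  rw [glue_append]
  cases S with
  | nil => rfl
  | cons s S =>
    simp only [dropHeads, List.cons_append, List.map_append, List.map_cons, List.map_nil]
    have := glue_append (s :: S.map (List.drop k)) (c.drop k) d (T.map (List.drop k))
    rw [List.drop_append_of_le_length (h (by simp))]
    exact this.symm

theorem pieces_append {w u v : List Bool} (hw : w ≠ []) (h : straddle w u.reverse v = 0) :
    pieces w (u ++ v) = glue (pieces w u) (pieces w v) := by
  rw [pieces_eq_dropHeads _ _ hw, pieces_eq_dropHeads _ _ hw, pieces_eq_dropHeads _ _ hw,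
    chunks_append h]
  obtain ⟨S, c, hS, hc⟩ := chunks_last w u
  obtain ⟨d, T, hT⟩ := List.exists_cons_of_ne_nil (chunks_ne_nil w v)
  rw [hS, hT]
  exact dropHeads_glue fun h => (hc h).length_le

theorem pieces_ne_nil (w x : List Bool) (hw : w ≠ []) : pieces w x ≠ [] := by
  rw [← List.length_pos_iff, length_pieces _ _ hw]; omega

/-! ### Run lengths of concatenations -/

theorem oneRuns_append {p q : List Bool} (h : ∀ x ∈ p.getLast?, ∀ y ∈ q.head?, (x == y) = false) :
    oneRuns (p ++ q) = oneRuns p ++ oneRuns q := by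
  unfold oneRuns runs
  rw [List.splitBy_append h, List.filter_append, List.map_append]

theorem runs_replicate (j : ℕ) (c : Bool) :
    runs (List.replicate (j + 1) c) = [List.replicate (j + 1) c] := by
  unfold runs
  apply List.splitBy_of_isChain (by simp)
  exact List.isChain_replicate_of_rel _ (by simp)

theorem oneRuns_replicate_true (j : ℕ) : oneRuns (List.replicate (j + 1) true) = [j + 1] := by
  unfold oneRuns
  rw [runs_replicate]
  simp [List.replicate_succ]

theorem oneRuns_replicate_false (j : ℕ) : oneRuns (List.replicate j false) = [] := by
  cases j with
  | zero => rfl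
  | succ j =>
    unfold oneRuns
    rw [runs_replicate]
    simp

theorem exists_replicate_append (c : Bool) (v : List Bool) :
    ∃ j v', v = List.replicate j c ++ v' ∧ ¬ [c] <+: v' := by
  induction v with
  | nil => exact ⟨0, [], by simp, by simp⟩
  | cons a v ih =>
    obtain ⟨j, v', h, h'⟩ := ih
    by_cases hac : a = c
    · exact ⟨j + 1, v', by rw [hac, h, List.replicate_succ, List.cons_append], h'⟩
    · exact ⟨0, a :: v, by simp, by simpa [eq_comm] using hac⟩

theorem exists_append_replicate (c : Bool) (u : List Bool) :
    ∃ j u', u = u' ++ List.replicate j c ∧ ¬ [c] <:+ u' := by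
  obtain ⟨j, v', h, h'⟩ := exists_replicate_append c u.reverse
  refine ⟨j, v'.reverse, ?_, ?_⟩
  · rw [← List.reverse_inj, h]; simp
  · rw [← List.reverse_prefix]; simpa using h'

/-- All zeros around the cut are collected in one block; at both ends of this block unequal symbols
meet, and there `splitBy` cuts. -/
theorem oneRuns_append_false_cons (p q : List Bool) :
    oneRuns (p ++ false :: q) = oneRuns p ++ oneRuns q := by
  obtain ⟨i, p', rfl, hp⟩ := exists_append_replicate false p
  obtain ⟨j, q', rfl, hq⟩ := exists_replicate_append false q
  have hp' : ∀ k, oneRuns (p' ++ List.replicate k false) = oneRuns p' := by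
    intro k
    rw [oneRuns_append, oneRuns_replicate_false, List.append_nil]
    intro x hx y hy
    cases k with
    | zero => simp at hy
    | succ k =>
      simp [List.replicate_succ] at hy
      subst hy
      rcases List.eq_nil_or_concat p' with rfl | ⟨p'', a, rfl⟩
      · simp at hx
      · simp at hx hp ⊢
        rw [← hx]; simpa using hp
  have hq' : ∀ k, oneRuns (List.replicate k false ++ q') = oneRuns q' := by
    intro k
    rw [oneRuns_append, oneRuns_replicate_false, List.nil_append]
    intro x hx y hy
    cases k with
    | zero => simp at hx
    | succ k =>
      have hx : x = false := by
        simpa [List.getLast?_replicate, eq_comm] using hx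
      cases q' with
      | nil => simp at hy
      | cons b q' =>
        simp at hy hq ⊢
        rw [hx, ← hy]; simpa [eq_comm] using hq
  rw [hp', hq', show p' ++ List.replicate i false ++ false :: (List.replicate j false ++ q') =
    (p' ++ List.replicate (i + 1 + j) false) ++ q' by
      rw [List.append_assoc, List.append_assoc, List.replicate_add, List.replicate_succ']
      simp]
  obtain ⟨k, hk⟩ : ∃ k, i + 1 + j = k + 1 := ⟨i + j, by omega⟩
  rw [oneRuns_append, hp']
  intro x hx y hy
  rw [hk, List.replicate_succ'] at hx
  cases q' with
  | nil => simp at hy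
  | cons b q' =>
    simp at hx hy hq ⊢
    subst hx hy
    simpa [eq_comm] using hq

/-- No run of ones extends across the border of `p` and `q`. -/
def RunBorder (p q : List Bool) : Prop :=
  p = [] ∨ [false] <:+ p ∨ q = [] ∨ [false] <+: q

theorem longOneRuns_append {p q : List Bool} (h : RunBorder p q) :
    longOneRuns (p ++ q) = longOneRuns p ++ longOneRuns q := by
  unfold longOneRuns
  rw [← List.filter_append]
  congr 1
  have h0 : ∀ q, oneRuns (false :: q) = oneRuns q := fun q => oneRuns_append_false_cons [] q
  rcases h with rfl | ⟨p', rfl⟩ | rfl | ⟨q', rfl⟩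
  · rfl
  · rw [List.append_assoc, List.singleton_append, oneRuns_append_false_cons, oneRuns_append_false_cons]
    simp [oneRuns, runs]
  · simp [oneRuns, runs]
  · rw [List.singleton_append, oneRuns_append_false_cons, h0]

theorem longOneRuns_replicate (a : ℕ) :
    longOneRuns (List.replicate a true) = if 2 ≤ a then [a] else [] := by
  cases a with
  | zero => rfl
  | succ a => unfold longOneRuns; rw [oneRuns_replicate_true]; simp [List.filter_cons]

theorem flatten_runs (x : List Bool) : (runs x).flatten = x := List.flatten_splitBy _ _

theorem sum_filter_le (l : List ℕ) (p : ℕ → Bool) : (l.filter p).sum ≤ l.sum :=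
  (List.filter_sublist).sum_le_sum (fun _ _ => Nat.zero_le _)

theorem sum_longOneRuns_le (x : List Bool) : (longOneRuns x).sum ≤ x.length := by
  have h : (((runs x).filter fun r => r.contains true).map List.length).sum ≤ x.length := by
    conv_rhs => rw [← flatten_runs x, List.length_flatten]
    exact ((List.filter_sublist).map _).sum_le_sum (fun _ _ => Nat.zero_le _)
  exact (sum_filter_le _ _).trans h

theorem two_le_of_mem_longOneRuns {x : List Bool} {k : ℕ} (h : k ∈ longOneRuns x) : 2 ≤ k := by
  simpa using (List.mem_filter.1 h).2

theorem length_longOneRuns_le (x : List Bool) : (longOneRuns x).length ≤ x.length := by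
  refine le_trans ?_ (sum_longOneRuns_le x)
  have h : ∀ l : List ℕ, (∀ k ∈ l, 2 ≤ k) → l.length ≤ l.sum := by
    intro l
    induction l with
    | nil => simp
    | cons a l ih =>
      intro h
      simp only [List.mem_cons, forall_eq_or_imp] at h
      have := ih h.2
      simp only [List.length_cons, List.sum_cons]
      omega
  exact h _ fun k hk => two_le_of_mem_longOneRuns hk

/-! ### Occurrences around a cut -/

theorem straddle_w4 (c : Bool) (r v : List Bool) : straddle [c, c, c, c] r v =
    (if [c] <+: r ∧ [c, c, c] <+: v then 1 else 0) + (if [c, c] <+: r ∧ [c, c] <+: v then 1 else 0)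
      + (if [c, c, c] <+: r ∧ [c] <+: v then 1 else 0) := by
  simp [straddle, List.range_succ, List.countP_cons]
  omega

theorem straddle_w110011_eq_zero (r v : List Bool) : straddle w110011 r v = 0 ↔
    ¬ ([true] <+: r ∧ [true, false, false, true, true] <+: v) ∧
    ¬ ([true, true] <+: r ∧ [false, false, true, true] <+: v) ∧
    ¬ ([false, true, true] <+: r ∧ [false, true, true] <+: v) ∧
    ¬ ([false, false, true, true] <+: r ∧ [true, true] <+: v) ∧
    ¬ ([true, false, false, true, true] <+: r ∧ [true] <+: v) := by
  simp [straddle, w110011, List.range_succ, List.countP_cons]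
  tauto

theorem straddle_w11011_eq_zero (r v : List Bool) : straddle w11011 r v = 0 ↔
    ¬ ([true] <+: r ∧ [true, false, true, true] <+: v) ∧
    ¬ ([true, true] <+: r ∧ [false, true, true] <+: v) ∧
    ¬ ([false, true, true] <+: r ∧ [true, true] <+: v) ∧
    ¬ ([true, false, true, true] <+: r ∧ [true] <+: v) := by
  simp [straddle, w11011, List.range_succ, List.countP_cons]
  tauto

theorem straddle_le (w r v : List Bool) (hw : w ≠ []) : straddle w r v ≤ w.length - 1 := by
  unfold straddle
  obtain ⟨k, hk⟩ : ∃ k, w.length = k + 1 :=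
    ⟨w.length - 1, by have := List.length_pos_iff.2 hw; omega⟩
  rw [hk, List.range_succ_eq_map, List.countP_cons]
  simp only [lt_self_iff_false, decide_false, Bool.false_and, Bool.false_eq_true, if_false]
  refine (List.countP_le_length).trans ?_
  simp

/-- No occurrence of `w` meets the symbol `b` of `r.reverse ++ b :: v`, and deleting it creates no
occurrence. -/
def Good (w r : List Bool) (b : Bool) (v : List Bool) : Prop :=
  straddle w r (b :: v) = 0 ∧ straddle w (b :: r) v = 0 ∧ straddle w r v = 0

theorem straddle_singleton_le (w r : List Bool) (b : Bool) (v : List Bool) :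
    straddle w r [b] ≤ straddle w r (b :: v) := by
  unfold straddle
  apply List.countP_mono_left
  intro k _
  simp only [Bool.and_eq_true, List.isPrefixOf_iff_prefix]
  rintro ⟨h0, h1, h2⟩
  exact ⟨h0, h1, h2.trans ⟨v, rfl⟩⟩

/-- An occurrence that contains `b` ends with it or crosses the cut behind it, and `[b]` alone
contains none because `w` has at least two symbols. -/
theorem numOcc_delete {w : List Bool} (hw : 2 ≤ w.length) (r : List Bool) (b : Bool) (v : List Bool) :
    numOcc w (r.reverse ++ v) + (straddle w (b :: r) v + straddle w r [b]) =
      numOcc w (r.reverse ++ b :: v) + straddle w r v := by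
  have h1 : numOcc w [b] = 0 := by
    rw [numOcc_cons, numOcc_nil, if_neg]
    rw [List.isPrefixOf_iff_prefix]
    intro h
    have := h.length_le
    simp at this
    omega
  have h2 : r.reverse ++ b :: v = (r.reverse ++ [b]) ++ v := by simp
  rw [h2, numOcc_append w (r.reverse ++ [b]) v, numOcc_append w r.reverse [b],
    numOcc_append w r.reverse v, h1]
  simp
  omega

theorem numOcc_delete_of_avoid {w : List Bool} (hw : 2 ≤ w.length) {r v : List Bool} {b : Bool}
    (h1 : straddle w r (b :: v) = 0) (h2 : straddle w (b :: r) v = 0) :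
    numOcc w (r.reverse ++ v) = numOcc w (r.reverse ++ b :: v) + straddle w r v := by
  have h3 := numOcc_delete hw r b v
  have h4 := straddle_singleton_le w r b v
  omega

theorem pieces_of_length_lt {w x : List Bool} (h : x.length < w.length) : pieces w x = [x] := by
  have h0 : occurrences w x = [] := by
    unfold occurrences
    rw [List.filter_eq_nil_iff]
    intro i _ hi
    rw [List.isPrefixOf_iff_prefix] at hi
    have := hi.length_le
    rw [List.length_drop] at this
    omega
  unfold pieces
  simp [h0]

theorem w_ne_nil {w : List Bool} (hw : 2 ≤ w.length) : w ≠ [] := by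
  rintro rfl; simp at hw

theorem Good.pieces_left {w r v : List Bool} {b : Bool} (hw : 2 ≤ w.length) (h : Good w r b v) :
    pieces w (r.reverse ++ b :: v) = glue (glue (pieces w r.reverse) [[b]]) (pieces w v) := by
  have h4 := straddle_singleton_le w r b v
  have h2 : r.reverse ++ b :: v = (r.reverse ++ [b]) ++ v := by simp
  have hb : pieces w [b] = [[b]] := pieces_of_length_lt (by simp; omega)
  rw [h2, pieces_append (w_ne_nil hw) (by simpa using h.2.1),
    pieces_append (w_ne_nil hw) (by simpa using Nat.le_zero.1 (h4.trans_eq h.1)), hb]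

theorem Good.pieces_right {w r v : List Bool} {b : Bool} (hw : 2 ≤ w.length) (h : Good w r b v) :
    pieces w (r.reverse ++ v) = glue (pieces w r.reverse) (pieces w v) :=
  pieces_append (w_ne_nil hw) (by simpa using h.2.2)

/-! ### Single deletions and occurrences of four equal symbols -/

/-- Deleting the symbol `c` between `r.reverse` and `v` destroys an occurrence of `cccc`. -/
def Destroys (c : Bool) (r v : List Bool) : Prop :=
  0 < straddle [c, c, c, c] (c :: r) v + straddle [c, c, c, c] r [c]

theorem straddle_w4_le (c : Bool) (r v : List Bool) : straddle [c, c, c, c] r v ≤ 3 :=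
  straddle_le _ _ _ (by simp)

theorem straddle_w4_ne {b c : Bool} (h : b ≠ c) (r v : List Bool) :
    straddle [c, c, c, c] r (b :: v) = 0 ∧ straddle [c, c, c, c] (b :: r) v = 0 := by
  rw [straddle_w4, straddle_w4]
  simp [List.cons_prefix_cons, h.symm]

theorem numOcc_w4_ne {b c : Bool} (h : b ≠ c) (r v : List Bool) :
    numOcc [c, c, c, c] (r.reverse ++ v) =
      numOcc [c, c, c, c] (r.reverse ++ b :: v) + straddle [c, c, c, c] r v :=
  numOcc_delete_of_avoid (by simp) (straddle_w4_ne h r v).1 (straddle_w4_ne h r v).2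

theorem good_w4_ne {b c : Bool} (h : b ≠ c) {r v : List Bool}
    (h0 : straddle [c, c, c, c] r v = 0) : Good [c, c, c, c] r b v :=
  ⟨(straddle_w4_ne h r v).1, (straddle_w4_ne h r v).2, h0⟩

/-- Only the run through the deleted symbol matters: a run of at least four symbols loses exactly
one occurrence, a shorter one has none to lose. Its extent up to three symbols on either side
distinguishes all cases. -/
theorem numOcc_w4_eq (c : Bool) (r v : List Bool) :
    (numOcc [c, c, c, c] (r.reverse ++ v) = numOcc [c, c, c, c] (r.reverse ++ c :: v) ∧
      Good [c, c, c, c] r c v) ∨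
    (numOcc [c, c, c, c] (r.reverse ++ v) + 1 = numOcc [c, c, c, c] (r.reverse ++ c :: v) ∧
      Destroys c r v) := by
  have h := numOcc_delete (w := [c, c, c, c]) (by simp) r c v
  unfold Good Destroys
  rw [straddle_w4 c r v, straddle_w4 c (c :: r) v, straddle_w4 c r [c]] at *
  rw [straddle_w4 c r (c :: v)]
  simp only [List.cons_prefix_cons, true_and, List.prefix_nil, and_false, if_false,
    List.nil_prefix, and_true, reduceCtorEq] at *
  have p12 : ∀ {l : List Bool}, [c, c] <+: l → [c] <+: l := fun h => List.IsPrefix.trans ⟨[c], rfl⟩ h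
  have p23 : ∀ {l : List Bool}, [c, c, c] <+: l → [c, c] <+: l := fun h =>
    List.IsPrefix.trans ⟨[c], rfl⟩ h
  have tri : ∀ l : List Bool, (¬ [c] <+: l ∧ ¬ [c, c] <+: l ∧ ¬ [c, c, c] <+: l) ∨
      ([c] <+: l ∧ ¬ [c, c] <+: l ∧ ¬ [c, c, c] <+: l) ∨
      ([c] <+: l ∧ [c, c] <+: l ∧ ¬ [c, c, c] <+: l) ∨
      ([c] <+: l ∧ [c, c] <+: l ∧ [c, c, c] <+: l) := by
    intro l
    have := @p12 l
    have := @p23 l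
    tauto
  rcases tri r with ⟨a1, a2, a3⟩ | ⟨a1, a2, a3⟩ | ⟨a1, a2, a3⟩ | ⟨a1, a2, a3⟩ <;>
  rcases tri v with ⟨b1, b2, b3⟩ | ⟨b1, b2, b3⟩ | ⟨b1, b2, b3⟩ | ⟨b1, b2, b3⟩ <;>
  simp only [a1, a2, a3, b1, b2, b3, and_true, and_false, if_true, if_false,
    and_self] at h ⊢ <;> omega

theorem created_cases {c : Bool} {r v : List Bool} (h : straddle [c, c, c, c] r v ≠ 0) :
    (∃ r' v', r = c :: r' ∧ v = c :: c :: c :: v') ∨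
    (∃ r' v', r = c :: c :: r' ∧ v = c :: c :: v') ∨
    (∃ r' v', r = c :: c :: c :: r' ∧ v = c :: v') := by
  rw [straddle_w4] at h
  by_cases h1 : [c] <+: r ∧ [c, c, c] <+: v
  · obtain ⟨⟨r', rfl⟩, v', rfl⟩ := h1
    exact Or.inl ⟨r', v', rfl, rfl⟩
  by_cases h2 : [c, c] <+: r ∧ [c, c] <+: v
  · obtain ⟨⟨r', rfl⟩, v', rfl⟩ := h2
    exact Or.inr (Or.inl ⟨r', v', rfl, rfl⟩)
  by_cases h3 : [c, c, c] <+: r ∧ [c] <+: v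
  · obtain ⟨⟨r', rfl⟩, v', rfl⟩ := h3
    exact Or.inr (Or.inr ⟨r', v', rfl, rfl⟩)
  simp [h1, h2, h3] at h

theorem destroys_cases {c : Bool} {r v : List Bool} (h : Destroys c r v) :
    (∃ v', v = c :: c :: c :: v') ∨
    (∃ r' v', r = c :: r' ∧ v = c :: c :: v') ∨
    (∃ r' v', r = c :: c :: r' ∧ v = c :: v') ∨
    (∃ r', r = c :: c :: c :: r') := by
  unfold Destroys at h
  rw [straddle_w4, straddle_w4] at h
  simp only [List.cons_prefix_cons, true_and, List.prefix_nil, and_false, if_false,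
    List.nil_prefix, and_true, reduceCtorEq] at h
  by_cases h1 : [c, c, c] <+: v
  · obtain ⟨v', rfl⟩ := h1
    exact Or.inl ⟨v', rfl⟩
  by_cases h2 : [c] <+: r ∧ [c, c] <+: v
  · obtain ⟨⟨r', rfl⟩, v', rfl⟩ := h2
    exact Or.inr (Or.inl ⟨r', v', rfl, rfl⟩)
  by_cases h3 : [c, c] <+: r ∧ [c] <+: v
  · obtain ⟨⟨r', rfl⟩, v', rfl⟩ := h3
    exact Or.inr (Or.inr (Or.inl ⟨r', v', rfl, rfl⟩))
  by_cases h4 : [c, c, c] <+: r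
  · obtain ⟨r', rfl⟩ := h4
    exact Or.inr (Or.inr (Or.inr ⟨r', rfl⟩))
  simp [h1, h2, h3, h4] at h

/-- Deleting a symbol does not both create `cccc` and destroy `bbbb`. -/
theorem not_destroys_of_created {b c : Bool} (hbc : b ≠ c) {r v : List Bool}
    (h : straddle [c, c, c, c] r v ≠ 0) : ¬ Destroys b r v := by
  intro hd
  rcases created_cases h with ⟨r', v', rfl, rfl⟩ | ⟨r', v', rfl, rfl⟩ | ⟨r', v', rfl, rfl⟩ <;>
  rcases destroys_cases hd with ⟨v1, e⟩ | ⟨r1, v1, e, e'⟩ | ⟨r1, v1, e, e'⟩ | ⟨r1, e⟩ <;>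
  simp_all

/-! ### Long runs between occurrences of `11011`, and mild deletions -/

/-- The run lengths of the pieces of `x` between occurrences of `11011`. -/
def pieceRuns (x : List Bool) : List (List ℕ) := (pieces w11011 x).map longOneRuns

theorem chunks_self (w : List Bool) (hw : w ≠ []) :
    ∀ v, ∃ d D, chunks w (w ++ v) = [] :: d :: D := by
  intro v
  obtain ⟨a, w', rfl⟩ := List.exists_cons_of_ne_nil hw
  rw [List.cons_append, chunks, if_pos (by rw [List.isPrefixOf_iff_prefix]; exact ⟨v, rfl⟩)]
  obtain ⟨p, P, hP⟩ := List.exists_cons_of_ne_nil (consHead_ne_nil a (chunks (a :: w') (w' ++ v)))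
  exact ⟨p, P, by rw [hP]⟩

theorem chunks_of_length_lt {w x : List Bool} (h : x.length < w.length) : chunks w x = [x] := by
  induction x with
  | nil => rfl
  | cons a x ih =>
    rw [chunks, ih (by simp at h; omega), if_neg]
    · rfl
    · rw [List.isPrefixOf_iff_prefix]
      intro h'
      have := h'.length_le
      omega

/-- The chunks of a word with a given end, in terms of those of the end. -/
theorem chunks_append_of_common {w z z' : List Bool} (n : ℕ) (hn : w.length ≤ n + 1)
    (hz : z.take n = z'.take n) {h : List Bool} {R R' : List (List Bool)}
    (hc : chunks w z = h :: R) (hc' : chunks w z' = h :: R') (A : List Bool) :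
    ∃ p P, chunks w (A ++ z) = p :: P ++ R ∧ chunks w (A ++ z') = p :: P ++ R' := by
  induction A with
  | nil => exact ⟨h, [], hc, hc'⟩
  | cons a A ih =>
    obtain ⟨p, P, h1, h2⟩ := ih
    have hp : w.isPrefixOf (a :: (A ++ z)) = w.isPrefixOf (a :: (A ++ z')) := by
      have key : ∀ t : List Bool, w <+: a :: (A ++ t) ↔ w <+: a :: (A ++ t.take n) := by
        intro t
        constructor
        · intro h3
          have h4 : a :: (A ++ t) = (a :: (A ++ t.take n)) ++ t.drop n := by simp
          rw [h4] at h3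
          by_cases ht : n ≤ t.length
          · exact List.prefix_of_prefix_length_le h3 (List.prefix_append _ _)
              (by simp; omega)
          · rw [List.drop_eq_nil_of_le (by omega), List.append_nil] at h3
            exact h3
        · intro h3
          refine h3.trans ?_
          rw [List.cons_prefix_cons, List.prefix_append_right_inj]
          exact ⟨rfl, List.take_prefix _ _⟩
      rw [Bool.eq_iff_iff, List.isPrefixOf_iff_prefix, List.isPrefixOf_iff_prefix, key z, hz,
        ← key z']
    rw [List.cons_append, List.cons_append, chunks, chunks, ← hp, h1, h2]
    split
    · exact ⟨[], (a :: p) :: P, rfl, rfl⟩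
    · exact ⟨a :: p, P, rfl, rfl⟩

theorem chunks_append_self (w A : List Bool) (hw : w ≠ []) :
    ∃ p P, chunks w (A ++ w) = p :: P ++ [w] := by
  obtain ⟨a, w', rfl⟩ := List.exists_cons_of_ne_nil hw
  have h : chunks (a :: w') (a :: w') = [] :: [a :: w'] := by
    rw [chunks, if_pos (by rw [List.isPrefixOf_iff_prefix]), chunks_of_length_lt (by simp)]
    rfl
  obtain ⟨p, P, h1, -⟩ := chunks_append_of_common _ (Nat.le_succ _) rfl h h A
  exact ⟨p, P, h1⟩

theorem pieces_last (w u : List Bool) (hw : w ≠ []) :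
    ∃ S p, pieces w u = S ++ [p] ∧ p <:+ u ∧ ((∃ u', u = u' ++ w) → p = []) := by
  rw [pieces_eq_dropHeads w u hw]
  obtain ⟨S, c, h, -⟩ := chunks_last w u
  have hf := flatten_chunks w u
  rw [h, List.flatten_append] at hf
  simp only [List.flatten_cons, List.flatten_nil, List.append_nil] at hf
  rw [h]
  cases S with
  | nil =>
    refine ⟨[], c, rfl, ⟨_, hf⟩, ?_⟩
    rintro ⟨u', rfl⟩
    obtain ⟨p, P, h1⟩ := chunks_append_self w u' hw
    rw [h1] at h
    simpa using congrArg List.length h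
  | cons s S =>
    refine ⟨s :: S.map (List.drop w.length), c.drop w.length, by simp [dropHeads],
      (List.drop_suffix _ _).trans ⟨_, hf⟩, ?_⟩
    rintro ⟨u', rfl⟩
    obtain ⟨p, P, h1⟩ := chunks_append_self w u' hw
    rw [h1] at h
    have := (List.append_inj' h rfl).2
    simp only [List.cons.injEq, and_true] at this
    rw [← this]; simp

theorem pieces_first (w v : List Bool) (hw : w ≠ []) :
    ∃ q T, pieces w v = q :: T ∧ q <+: v ∧ ((∃ v', v = w ++ v') → q = []) := by
  rw [pieces_eq_dropHeads w v hw]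
  obtain ⟨d, T, h⟩ := List.exists_cons_of_ne_nil (chunks_ne_nil w v)
  have hf := flatten_chunks w v
  rw [h, List.flatten_cons] at hf
  rw [h]
  refine ⟨d, _, rfl, ⟨_, hf⟩, ?_⟩
  rintro ⟨v', rfl⟩
  obtain ⟨d', D, h1⟩ := chunks_self w hw v'
  rw [h1] at h
  simp only [List.cons.injEq] at h
  exact h.1.symm

theorem map_glue {α β : Type*} (f : List α → List β) {S : List (List α)} {p q : List α}
    {T : List (List α)} (h : f (p ++ q) = f p ++ f q) :
    (glue (S ++ [p]) (q :: T)).map f = glue ((S ++ [p]).map f) ((q :: T).map f) := by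
  rw [glue_append]
  simp only [List.map_append, List.map_cons, List.map_nil]
  rw [glue_append, h]

/-- The last piece of the left word is joined to the first piece of the right word, and their long
runs are simply listed one after the other if no run of ones crosses the border. Besides a zero or
an empty word at the border, an occurrence of `11011` that ends or starts there suffices, since then
one of the two pieces is empty. -/
theorem pieceRuns_append {r v : List Bool} (h0 : straddle w11011 r v = 0)
    (h : r = [] ∨ [false] <+: r ∨ v = [] ∨ [false] <+: v ∨
      [true, true, false, true, true] <+: r ∨ [true, true, false, true, true] <+: v) :
    pieceRuns (r.reverse ++ v) = glue (pieceRuns r.reverse) (pieceRuns v) := by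
  unfold pieceRuns
  have hw : w11011 ≠ [] := by simp [w11011]
  rw [pieces_append hw (by simpa using h0)]
  obtain ⟨S, p, hS, hp, hp'⟩ := pieces_last w11011 r.reverse hw
  obtain ⟨q, T, hT, hq, hq'⟩ := pieces_first w11011 v hw
  rw [hS, hT]
  apply map_glue
  apply longOneRuns_append
  rcases h with rfl | ⟨r', rfl⟩ | rfl | ⟨v', rfl⟩ | ⟨r', rfl⟩ | ⟨v', rfl⟩
  · left; simpa using hp
  · rw [List.reverse_append, List.reverse_singleton] at hp
    rcases List.suffix_concat_iff.1 hp with h | ⟨t, h, _⟩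
    · left; exact h
    · right; left; exact ⟨t, h.symm⟩
  · right; right; left; simpa using hq
  · rcases List.prefix_cons_iff.1 hq with h | ⟨t, h, _⟩
    · right; right; left; exact h
    · right; right; right; exact ⟨t, h.symm⟩
  · left; exact hp' ⟨r'.reverse, by simp [w11011]⟩
  · right; right; left; exact hq' ⟨v', rfl⟩

theorem glue_singleton_nil {α : Type*} {P : List (List α)} (h : P ≠ []) : glue P [[]] = P := by
  rcases List.eq_nil_or_concat P with rfl | ⟨S, c, rfl⟩
  · exact absurd rfl h
  · rw [List.concat_eq_append, glue_append, List.append_nil]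

theorem glue_ne_nil {α : Type*} {P Q : List (List α)} (h : P ≠ []) (hQ : Q ≠ []) : glue P Q ≠ [] := by
  obtain ⟨q, Q, rfl⟩ := List.exists_cons_of_ne_nil hQ
  rcases List.eq_nil_or_concat P with rfl | ⟨S, c, rfl⟩
  · exact absurd rfl h
  · rw [List.concat_eq_append, glue_append]; simp

theorem glue_assoc {α : Type*} {P Q R : List (List α)} (hP : P ≠ []) (hQ : Q ≠ []) (hR : R ≠ []) :
    glue (glue P Q) R = glue P (glue Q R) := by
  obtain ⟨r, R, rfl⟩ := List.exists_cons_of_ne_nil hR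
  rcases List.eq_nil_or_concat P with rfl | ⟨S, c, rfl⟩
  · exact absurd rfl hP
  simp only [List.concat_eq_append]
  rcases List.eq_nil_or_concat Q with rfl | ⟨S', d, rfl⟩
  · exact absurd rfl hQ
  simp only [List.concat_eq_append]
  cases S' with
  | nil =>
    have h1 : glue [d] (r :: R) = (d ++ r) :: R := rfl
    rw [List.nil_append, h1, glue_append, glue_append, glue_append, List.append_assoc]
  | cons s S' =>
    rw [glue_append, List.cons_append, glue_append, List.cons_append, glue_append]
    have := glue_append (S ++ (c ++ s) :: S') d r R
    simpa using this

theorem pieceRuns_ne_nil (x : List Bool) : pieceRuns x ≠ [] := by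
  unfold pieceRuns
  simp [pieces_ne_nil w11011 x (by simp [w11011])]

theorem pieceRuns_singleton (b : Bool) : pieceRuns [b] = [[]] := by
  unfold pieceRuns
  rw [pieces_of_length_lt (by simp [w11011])]
  cases b <;> rfl

/-- A deletion that is invisible between occurrences of `1111` and `110011` and for the long runs
of ones between occurrences of `11011`. -/
def MildDeletion (x y : List Bool) : Prop :=
  ∃ r b v, x = r.reverse ++ b :: v ∧ y = r.reverse ++ v ∧ Good w1111 r b v ∧ Good w110011 r b v ∧
    pieceRuns x = pieceRuns y

/-- The deleted symbol is split off as a word without long runs. The three hypotheses provide a zero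
at each of the cuts before it, behind it, and the one left by its deletion. -/
theorem pieceRuns_delete {r v : List Bool} {b : Bool} (hg : Good w11011 r b v)
    (h1 : [false] <+: r ∨ b = false) (h2 : [false] <+: v ∨ b = false)
    (h3 : [false] <+: r ∨ [false] <+: v) :
    pieceRuns (r.reverse ++ b :: v) = pieceRuns (r.reverse ++ v) := by
  have e1 : r.reverse ++ b :: v = (b :: r).reverse ++ v := by simp
  have e2 : (b :: r).reverse = r.reverse ++ [b] := by simp
  have h0 := straddle_singleton_le w11011 r b v
  rw [e1, pieceRuns_append hg.2.1 (by rcases h2 with h2 | rfl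
                                      · tauto
                                      · right; left; exact ⟨r, rfl⟩), e2,
    pieceRuns_append (Nat.le_zero.1 (h0.trans_eq hg.1)) (by rcases h1 with h1 | rfl <;> simp [*]),
    pieceRuns_append hg.2.2 (by tauto), pieceRuns_singleton,
    glue_singleton_nil (pieceRuns_ne_nil _)]

/-- A one isolated between zeros lies in no occurrence of the three words, and after its deletion
none of them can cross the block of at least four zeros. -/
theorem mildDeletion_of_created {r v : List Bool} (h : straddle w0000 r v ≠ 0) :
    MildDeletion (r.reverse ++ true :: v) (r.reverse ++ v) := by
  have hr : [false] <+: r ∧ [false] <+: v := by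
    rcases created_cases h with ⟨r', v', rfl, rfl⟩ | ⟨r', v', rfl, rfl⟩ | ⟨r', v', rfl, rfl⟩ <;> simp
  refine ⟨r, true, v, rfl, rfl, ?_, ?_, pieceRuns_delete ?_ (Or.inl hr.1) (Or.inl hr.2) (Or.inl hr.1)⟩
  · unfold Good w1111
    rw [straddle_w4, straddle_w4, straddle_w4]
    rcases created_cases h with ⟨r', v', rfl, rfl⟩ | ⟨r', v', rfl, rfl⟩ | ⟨r', v', rfl, rfl⟩ <;> simp
  · unfold Good
    rw [straddle_w110011_eq_zero, straddle_w110011_eq_zero, straddle_w110011_eq_zero]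
    rcases created_cases h with ⟨r', v', rfl, rfl⟩ | ⟨r', v', rfl, rfl⟩ | ⟨r', v', rfl, rfl⟩ <;> simp
  · unfold Good
    rw [straddle_w11011_eq_zero, straddle_w11011_eq_zero, straddle_w11011_eq_zero]
    rcases created_cases h with ⟨r', v', rfl, rfl⟩ | ⟨r', v', rfl, rfl⟩ | ⟨r', v', rfl, rfl⟩ <;> simp

/-- The deleted zero lies in a run of at least four zeros, of which at least three remain, and none
of the three words contains three consecutive zeros. -/
theorem mildDeletion_of_destroys {r v : List Bool} (h : Destroys false r v) :
    MildDeletion (r.reverse ++ false :: v) (r.reverse ++ v) := by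
  refine ⟨r, false, v, rfl, rfl, ?_, ?_, pieceRuns_delete ?_ (Or.inr rfl) (Or.inr rfl) ?_⟩
  · unfold Good w1111
    rw [straddle_w4, straddle_w4, straddle_w4]
    rcases destroys_cases h with ⟨v', rfl⟩ | ⟨r', v', rfl, rfl⟩ | ⟨r', v', rfl, rfl⟩ | ⟨r', rfl⟩ <;> simp
  · unfold Good
    rw [straddle_w110011_eq_zero, straddle_w110011_eq_zero, straddle_w110011_eq_zero]
    rcases destroys_cases h with ⟨v', rfl⟩ | ⟨r', v', rfl, rfl⟩ | ⟨r', v', rfl, rfl⟩ | ⟨r', rfl⟩ <;> simp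
  · unfold Good
    rw [straddle_w11011_eq_zero, straddle_w11011_eq_zero, straddle_w11011_eq_zero]
    rcases destroys_cases h with ⟨v', rfl⟩ | ⟨r', v', rfl, rfl⟩ | ⟨r', v', rfl, rfl⟩ | ⟨r', rfl⟩ <;> simp
  · rcases destroys_cases h with ⟨v', rfl⟩ | ⟨r', v', rfl, rfl⟩ | ⟨r', v', rfl, rfl⟩ | ⟨r', rfl⟩ <;> simp

/-! ### Deletions among ones that occurrences of `110011` do not resolve -/

/-- `x` arises from `y` by lengthening a run `111` within `110011100111` to `1111`. -/
def JunctionDeletion (x y : List Bool) : Prop :=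
  ∃ U V, [false, false, true, true] <+: U ∧ [false, false, true, true] <+: V ∧
    x = U.reverse ++ (List.replicate 4 true ++ V) ∧ y = U.reverse ++ (List.replicate 3 true ++ V)

theorem replicate_succ_append_comm (n : ℕ) (c : Bool) (l : List Bool) :
    List.replicate n c ++ c :: l = c :: (List.replicate n c ++ l) := by
  rw [← List.cons_append, ← List.replicate_succ, List.replicate_succ']; simp

theorem exists_run {r v : List Bool} :
    ∃ i j U V, r = List.replicate i true ++ U ∧ v = List.replicate j true ++ V ∧
      ¬ [true] <+: U ∧ ¬ [true] <+: V ∧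
      r.reverse ++ v = U.reverse ++ (List.replicate (i + j) true ++ V) ∧
      r.reverse ++ true :: v = U.reverse ++ (List.replicate (i + j + 1) true ++ V) := by
  obtain ⟨i, U, rfl, hU⟩ := exists_replicate_append true r
  obtain ⟨j, V, rfl, hV⟩ := exists_replicate_append true v
  refine ⟨i, j, U, V, rfl, rfl, hU, hV, ?_, ?_⟩
  · rw [List.replicate_add, List.reverse_append, List.reverse_replicate, List.append_assoc,
      List.append_assoc]
  · rw [show i + j + 1 = i + (j + 1) by omega, List.replicate_add, List.reverse_append,
      List.reverse_replicate, List.append_assoc, List.append_assoc, List.replicate_succ,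
      List.cons_append]

theorem le_of_destroys {i j : ℕ} {U V : List Bool} (hU : ¬ [true] <+: U) (hV : ¬ [true] <+: V)
    (h : Destroys true (List.replicate i true ++ U) (List.replicate j true ++ V)) : 3 ≤ i + j := by
  by_contra hlt
  have hi : i < 3 := by omega
  have hj : j < 3 := by omega
  interval_cases i <;> interval_cases j <;> try omega
  all_goals
    rcases destroys_cases h with ⟨v1, e⟩ | ⟨r1, v1, e, e'⟩ | ⟨r1, v1, e, e'⟩ | ⟨r1, e⟩ <;>
    simp [List.replicate_succ] at * <;> simp_all

/-- Every one of the run gives the same result, so the deleted one may be chosen: at an end that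
does not border on `1100` or `0011` respectively, or in the middle if at least four ones remain.
Only `1111` between `1100` and `0011` leaves no good choice. -/
theorem destroys_true_cases {r v : List Bool} (h : Destroys true r v) :
    (∃ r' v', r'.reverse ++ true :: v' = r.reverse ++ true :: v ∧ r'.reverse ++ v' = r.reverse ++ v ∧
      Good w110011 r' true v') ∨
    JunctionDeletion (r.reverse ++ true :: v) (r.reverse ++ v) := by
  obtain ⟨i, j, U, V, rfl, rfl, hU, hV, h1, h2⟩ := exists_run (r := r) (v := v)
  have hij := le_of_destroys hU hV h
  obtain ⟨c, hc⟩ : ∃ c, i + j = c + 3 := ⟨i + j - 3, by omega⟩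
  rw [h1, h2, hc]
  by_cases hUl : [false, false, true, true] <+: U
  · by_cases hVr : [false, false, true, true] <+: V
    · cases c with
      | zero => exact Or.inr ⟨U, V, hUl, hVr, rfl, rfl⟩
      | succ c =>
        left
        refine ⟨true :: true :: U, true :: true :: (List.replicate c true ++ V), ?_, ?_, ?_⟩
        · simp [List.replicate_succ]
        · simp [List.replicate_succ]
        · unfold Good
          rw [straddle_w110011_eq_zero, straddle_w110011_eq_zero, straddle_w110011_eq_zero]
          simp
    · left
      refine ⟨List.replicate (c + 3) true ++ U, V, ?_, ?_, ?_⟩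
      · simp [List.replicate_succ, replicate_succ_append_comm]
      · simp
      · unfold Good
        rw [straddle_w110011_eq_zero, straddle_w110011_eq_zero, straddle_w110011_eq_zero]
        cases V with
        | nil => simp [List.replicate_succ]
        | cons b V =>
          cases b
          · simp [List.replicate_succ] at hVr ⊢; tauto
          · simp at hV
  · left
    refine ⟨U, List.replicate (c + 3) true ++ V, ?_, ?_, ?_⟩
    · simp [List.replicate_succ]
    · simp
    · unfold Good
      rw [straddle_w110011_eq_zero, straddle_w110011_eq_zero, straddle_w110011_eq_zero]
      cases U with
      | nil => simp [List.replicate_succ]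
      | cons b U =>
        cases b
        · simp [List.replicate_succ] at hUl ⊢; tauto
        · simp at hU

/-- `x` arises from `y` by splitting off a one from a long run of ones, next to `00`. -/
def SplitDeletion (x y : List Bool) : Prop :=
  ∃ U V c, 3 ≤ c ∧ ¬ [true] <+: U ∧ ¬ [true] <+: V ∧
    y = U.reverse ++ (List.replicate (c + 1) true ++ V) ∧
    (([false, false] <+: U ∧ x = U.reverse ++ (true :: false :: List.replicate c true ++ V)) ∨
     ([false, false] <+: V ∧ x = U.reverse ++ (List.replicate c true ++ false :: true :: V)))

theorem avoid_of_created {r v : List Bool} (h : straddle w1111 r v ≠ 0) :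
    straddle w110011 r (false :: v) = 0 ∧ straddle w110011 (false :: r) v = 0 := by
  rw [straddle_w110011_eq_zero, straddle_w110011_eq_zero]
  rcases created_cases h with ⟨r', v', rfl, rfl⟩ | ⟨r', v', rfl, rfl⟩ | ⟨r', v', rfl, rfl⟩ <;> simp

/-- At least four ones meet at the cut, so an occurrence of `110011` across it has a single symbol
on one side. Hence the zero separated a single one, adjacent to `00`, from the rest of the run. -/
theorem splitDeletion_of_created {r v : List Bool} (h : straddle w1111 r v ≠ 0)
    (h' : straddle w110011 r v ≠ 0) : SplitDeletion (r.reverse ++ false :: v) (r.reverse ++ v) := by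
  rw [Ne, straddle_w110011_eq_zero] at h'
  by_cases hk : [true] <+: r ∧ [true, false, false, true, true] <+: v
  · obtain ⟨-, v', rfl⟩ := hk
    rcases created_cases h with ⟨r', v', rfl, e⟩ | ⟨r', v', rfl, e⟩ | ⟨r', v'', rfl, e⟩
    · simp at e
    · simp at e
    · obtain ⟨i, U, rfl, hU⟩ := exists_replicate_append true r'
      refine ⟨U, [false, false, true, true] ++ v', i + 3, by omega, hU, by simp, ?_,
        Or.inr ⟨by simp, ?_⟩⟩
      · simp [List.replicate_add]
      · simp [List.replicate_add]
  by_cases hk' : [true, false, false, true, true] <+: r ∧ [true] <+: v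
  · obtain ⟨⟨r', rfl⟩, -⟩ := hk'
    rcases created_cases h with ⟨r'', v', e, rfl⟩ | ⟨r'', v', e, rfl⟩ | ⟨r'', v', e, rfl⟩
    · obtain ⟨i, V, rfl, hV⟩ := exists_replicate_append true v'
      refine ⟨[false, false, true, true] ++ r', V, i + 3, by omega, by simp, hV, ?_,
        Or.inl ⟨by simp, ?_⟩⟩
      · simp [List.replicate_succ]
      · simp [List.replicate_succ]
    · simp at e
    · simp at e
  · exfalso
    rcases created_cases h with ⟨r', v', rfl, rfl⟩ | ⟨r', v', rfl, rfl⟩ | ⟨r', v', rfl, rfl⟩ <;>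
    simp at h' hk hk' <;> tauto

theorem replicate_append_inj {c c' : ℕ} {V V' : List Bool} (hV : ¬ [true] <+: V)
    (hV' : ¬ [true] <+: V') (h : List.replicate c true ++ V = List.replicate c' true ++ V') :
    c = c' ∧ V = V' := by
  induction c generalizing c' with
  | zero =>
    cases c' with
    | zero => simpa using h
    | succ c' =>
      simp [List.replicate_succ] at h
      subst h
      simp at hV
  | succ c ih =>
    cases c' with
    | zero =>
      simp [List.replicate_succ] at h
      subst h
      simp at hV'
    | succ c' =>
      simp [List.replicate_succ] at h
      have := ih h
      exact ⟨by omega, this.2⟩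

theorem runs_compare_aux {c c' : ℕ} {U V U' V' a : List Bool} (hc : 1 ≤ c)
    (hV : ¬ [true] <+: V) (hU' : ¬ [true] <+: U') (hV' : ¬ [true] <+: V')
    (h1 : U'.reverse = U.reverse ++ a)
    (h2 : List.replicate c true ++ V = a ++ (List.replicate c' true ++ V')) :
    (U = U' ∧ c = c' ∧ V = V') ∨
    (∃ M, V = M ++ (List.replicate c' true ++ V') ∧ U' = M.reverse ++ (List.replicate c true ++ U) ∧
      [false] <+: M ∧ [false] <+: M.reverse) := by
  have h1' : U' = a.reverse ++ U := by
    have := congrArg List.reverse h1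
    simpa using this
  rcases List.append_eq_append_iff.1 h2 with ⟨M, rfl, h3⟩ | ⟨b, h3, h4⟩
  · right
    have hM : M ≠ [] := by
      rintro rfl
      apply hU'
      obtain ⟨k, rfl⟩ : ∃ k, c = k + 1 := ⟨c - 1, by omega⟩
      rw [h1']
      simp [List.replicate_succ']
    refine ⟨M, h3, by rw [h1']; simp, ?_, ?_⟩
    · obtain ⟨m, M, rfl⟩ := List.exists_cons_of_ne_nil hM
      cases m
      · simp
      · simp [h3] at hV
    · obtain ⟨m, M', hMr⟩ := List.exists_cons_of_ne_nil (l := M.reverse) (by simpa using hM)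
      rw [List.reverse_append, hMr] at h1'
      rw [hMr]
      cases m
      · simp
      · simp [h1'] at hU'
  · left
    have ha : a = [] := by
      by_contra ha
      obtain ⟨m, M', hMr⟩ := List.exists_cons_of_ne_nil (l := a.reverse) (by simpa using ha)
      have hm : m ∈ List.replicate c true := by
        rw [h3, List.mem_append]; left
        rw [← List.mem_reverse, hMr]; simp
      have := List.eq_of_mem_replicate hm
      subst this
      rw [hMr] at h1'
      simp [h1'] at hU'
    subst ha
    simp at h1' h2
    have := replicate_append_inj hV hV' h2
    exact ⟨h1'.symm, this⟩

/-- The runs are maximal because no border word starts with a one, and maximal runs coincide or are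
disjoint. In the latter case `M` is the word between them, with zeros at both ends. -/
theorem runs_compare {c c' : ℕ} {U V U' V' : List Bool} (hc : 1 ≤ c) (hc' : 1 ≤ c')
    (hU : ¬ [true] <+: U) (hV : ¬ [true] <+: V) (hU' : ¬ [true] <+: U') (hV' : ¬ [true] <+: V')
    (h : U.reverse ++ (List.replicate c true ++ V) = U'.reverse ++ (List.replicate c' true ++ V')) :
    (U = U' ∧ c = c' ∧ V = V') ∨
    (∃ M, V = M ++ (List.replicate c' true ++ V') ∧ U' = M.reverse ++ (List.replicate c true ++ U) ∧
      [false] <+: M ∧ [false] <+: M.reverse) ∨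
    (∃ M, V' = M ++ (List.replicate c true ++ V) ∧ U = M.reverse ++ (List.replicate c' true ++ U') ∧
      [false] <+: M ∧ [false] <+: M.reverse) := by
  rcases List.append_eq_append_iff.1 h with ⟨a, h1, h2⟩ | ⟨a, h1, h2⟩
  · rcases runs_compare_aux hc hV hU' hV' h1 h2 with h | h
    · exact Or.inl h
    · exact Or.inr (Or.inl h)
  · rcases runs_compare_aux hc' hV' hU hV h1 h2 with h | h
    · exact Or.inl ⟨h.1.symm, h.2.1.symm, h.2.2.symm⟩
    · exact Or.inr (Or.inr h)

/-! ### The run lengths between occurrences of `11011`, around a run of ones -/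

theorem pieces_of_not_infix {w x : List Bool} (h : ¬ w <:+: x) : pieces w x = [x] := by
  have h0 : occurrences w x = [] := by
    unfold occurrences
    rw [List.filter_eq_nil_iff]
    intro i _ hi
    rw [List.isPrefixOf_iff_prefix] at hi
    exact h (hi.isInfix.trans (List.drop_suffix i x).isInfix)
  unfold pieces
  simp [h0]

/-- The contribution of a run of `k` ones to the list of long runs. -/
def runEntry (k : ℕ) : List ℕ := if 2 ≤ k then [k] else []

theorem pieceRuns_replicate (a : ℕ) : pieceRuns (List.replicate a true) = [runEntry a] := by
  unfold pieceRuns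
  rw [pieces_of_not_infix, List.map_singleton, longOneRuns_replicate]
  · rfl
  · intro h
    have : false ∈ List.replicate a true := h.subset (by simp [w11011])
    simpa using List.eq_of_mem_replicate this

/-- Complete a neighbouring occurrence of `11011` that overlaps the border of a run of ones. -/
def completed (V : List Bool) : List Bool :=
  if [false, true, true] <+: V then true :: true :: V else V

/-- The part of a run of ones that belongs to neighbouring occurrences of `11011`. -/
def overlapLoss (U V : List Bool) : ℕ :=
  if [false, true, true] <+: U ∨ [false, true, true] <+: V then 2 else 0

theorem overlapLoss_le (U V : List Bool) : overlapLoss U V ≤ 2 := by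
  unfold overlapLoss; split <;> omega

/-- An occurrence of `11011` on one side takes two ones from the run; as `a ≥ 3`, at least one is
left, so that `completed` closes the occurrence without touching the other side. Everything except
the one entry is independent of `a`. -/
theorem pieceRuns_run {U V : List Bool} (hU : ¬ [true] <+: U) (hV : ¬ [true] <+: V)
    (h : ¬ ([false, true, true] <+: U ∧ [false, true, true] <+: V)) :
    ∀ a, 3 ≤ a → pieceRuns (U.reverse ++ (List.replicate a true ++ V)) =
      glue (pieceRuns (completed U).reverse)
        (glue [runEntry (a - overlapLoss U V)] (pieceRuns (completed V))) := by
  have bU : U = [] ∨ [false] <+: U := by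
    cases U with
    | nil => simp
    | cons b U => cases b <;> simp at hU ⊢
  have bV : V = [] ∨ [false] <+: V := by
    cases V with
    | nil => simp
    | cons b V => cases b <;> simp at hV ⊢
  by_cases h1 : [false, true, true] <+: U
  · have h2 : ¬ [false, true, true] <+: V := fun h2 => h ⟨h1, h2⟩
    intro a ha
    have hl : overlapLoss U V = 2 := by simp [overlapLoss, *]
    rw [hl]
    obtain ⟨k, rfl⟩ : ∃ k, a = k + 3 := ⟨a - 3, by omega⟩
    unfold completed
    rw [if_pos h1, if_neg h2, show k + 3 - 2 = k + 1 by omega, ← pieceRuns_replicate]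
    have e : U.reverse ++ (List.replicate (k + 3) true ++ V) =
        (true :: true :: U).reverse ++ (List.replicate (k + 1) true ++ V) := by
      simp [List.replicate_succ]
    have e3 : List.replicate (k + 1) true ++ V = (List.replicate (k + 1) true).reverse ++ V := by simp
    rw [e, pieceRuns_append, e3, pieceRuns_append, List.reverse_replicate]
    · rw [straddle_w11011_eq_zero]
      cases V with
      | nil => simp
      | cons b V => cases b <;> simp [List.replicate_succ] at hV h2 ⊢; tauto
    · tauto
    · rw [straddle_w11011_eq_zero]
      cases V with
      | nil => cases k <;> simp [List.replicate_succ]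
      | cons b V =>
        cases b
        · cases k <;> simp [List.replicate_succ] at h2 ⊢; tauto
        · simp at hV
    · obtain ⟨U', rfl⟩ := h1
      right; right; right; right; left
      simp
  · by_cases h2 : [false, true, true] <+: V
    · intro a ha
      have hl : overlapLoss U V = 2 := by simp [overlapLoss, *]
      rw [hl]
      obtain ⟨k, rfl⟩ : ∃ k, a = k + 3 := ⟨a - 3, by omega⟩
      unfold completed
      rw [if_neg h1, if_pos h2, show k + 3 - 2 = k + 1 by omega, ← pieceRuns_replicate]
      have e3 : List.replicate (k + 3) true ++ V = (List.replicate (k + 1) true).reverse ++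
          (true :: true :: V) := by
        rw [show k + 3 = k + 1 + 2 by omega, List.replicate_add, List.reverse_replicate,
            List.append_assoc]; rfl
      have e4 : List.replicate (k + 3) true ++ V =
        List.replicate (k + 1) true ++ (true :: true :: V) := by rw [e3, List.reverse_replicate]
      rw [pieceRuns_append, e3, pieceRuns_append, List.reverse_replicate]
      · rw [straddle_w11011_eq_zero]
        obtain ⟨V', rfl⟩ := h2
        cases k <;> simp [List.replicate_succ]
      · obtain ⟨V', rfl⟩ := h2
        simp
      · rw [straddle_w11011_eq_zero]
        cases U with
        | nil => simp
        | cons b U => cases b <;> simp [List.replicate_succ] at hU h1 ⊢; tauto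
      · tauto
    · intro a ha
      have hl : overlapLoss U V = 0 := by simp [overlapLoss, *]
      rw [hl]
      obtain ⟨k, rfl⟩ : ∃ k, a = k + 3 := ⟨a - 3, by omega⟩
      unfold completed
      rw [if_neg h1, if_neg h2, Nat.sub_zero, ← pieceRuns_replicate]
      have e3 : List.replicate (k + 3) true ++ V = (List.replicate (k + 3) true).reverse ++ V := by simp
      rw [pieceRuns_append, e3, pieceRuns_append, List.reverse_replicate]
      · rw [straddle_w11011_eq_zero]
        cases V with
        | nil => simp
        | cons b V => cases b <;> simp [List.replicate_succ] at hV h2 ⊢; tauto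
      · tauto
      · rw [straddle_w11011_eq_zero]
        cases U with
        | nil => simp
        | cons b U => cases b <;> simp [List.replicate_succ] at hU h1 ⊢; tauto
      · tauto

/-- Three ones already decide, which makes the decomposition around two runs independent of the
length of the second run. -/
theorem prefix_append_run_iff (M V : List Bool) {b : ℕ} (hb : 3 ≤ b) :
    [false, true, true] <+: M ++ (List.replicate b true ++ V) ↔
      [false, true, true] <+: M ++ [true, true, true] := by
  obtain ⟨k, rfl⟩ : ∃ k, b = k + 3 := ⟨b - 3, by omega⟩
  have e : M ++ (List.replicate (k + 3) true ++ V) =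
      (M ++ [true, true, true]) ++ (List.replicate k true ++ V) := by
    rw [show k + 3 = 3 + k by omega, List.replicate_add]; simp [List.replicate_succ]
  rw [e]
  constructor
  · intro h
    exact List.prefix_of_prefix_length_le h (List.prefix_append _ _) (by simp)
  · intro h
    exact h.trans (List.prefix_append _ _)

theorem two_zeros_not_prefix {V : List Bool} (h : [false, false] <+: V) :
    ¬ [false, true, true] <+: V := by
  obtain ⟨V, rfl⟩ := h
  simp

/-- The run lengths between occurrences of `11011`, around two runs of ones. -/
theorem pieceRuns_two_runs {U M V : List Bool} (hU : ¬ [true] <+: U) (hV : ¬ [true] <+: V)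
    (hM : [false] <+: M) (hM' : [false] <+: M.reverse)
    (h1 : [false, false] <+: U ∨ [false, false] <+: M)
    (h2 : [false, false] <+: M.reverse ∨ [false, false] <+: V) :
    ∃ P M₁ Q, ∃ δ ≤ 2, ∃ ε ≤ 2, P ≠ [] ∧ Q ≠ [] ∧ M <:+: M₁ ∧
      ([false, false] <+: U → [false, false] <+: M → δ = 0) ∧ ∀ a b, 3 ≤ a → 3 ≤ b →
      pieceRuns (U.reverse ++ (List.replicate a true ++ (M ++ (List.replicate b true ++ V)))) =
        glue P (glue [runEntry (a - δ)] (glue (pieceRuns M₁) (glue [runEntry (b - ε)] Q))) := by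
  -- If `M` followed by ones starts with `011`, two ones of the left run complete an occurrence of
  -- `11011` and are attached to `M`. The choice is the same for all `b ≥ 3`.
  obtain ⟨M₀, hM₀, hM₁, hM₂⟩ : ∃ M₀, M <:+: M₀ ∧ M.reverse <+: M₀.reverse ∧ ∀ b, 3 ≤ b →
      completed (M ++ (List.replicate b true ++ V)) = M₀ ++ (List.replicate b true ++ V) := by
    unfold completed
    by_cases h : [false, true, true] <+: M ++ [true, true, true]
    · refine ⟨true :: true :: M, ⟨[true, true], [], by simp⟩, by simp, fun b hb => ?_⟩
      rw [if_pos ((prefix_append_run_iff M V hb).2 h)]; rfl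
    · refine ⟨M, List.infix_rfl, List.prefix_rfl, fun b hb => ?_⟩
      rw [if_neg fun h' => h ((prefix_append_run_iff M V hb).1 h')]
  have hM₀f : ¬ [true] <+: M₀.reverse := by
    obtain ⟨t, ht⟩ := hM'.trans hM₁
    rw [← ht]; simp
  have hMf : ∀ b, ¬ [true] <+: M ++ (List.replicate b true ++ V) := by
    intro b
    obtain ⟨t, rfl⟩ := hM
    simp
  have hd2 : ¬ ([false, true, true] <+: M₀.reverse ∧ [false, true, true] <+: V) := by
    rintro ⟨h3, h4⟩
    rcases h2 with h2 | h2
    · exact two_zeros_not_prefix (h2.trans hM₁) h3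
    · exact two_zeros_not_prefix h2 h4
  have hd1 : ∀ b, ¬ ([false, true, true] <+: U ∧
      [false, true, true] <+: M ++ (List.replicate b true ++ V)) := by
    rintro b ⟨h3, h4⟩
    rcases h1 with h1 | h1
    · exact two_zeros_not_prefix h1 h3
    · exact two_zeros_not_prefix (h1.trans (List.prefix_append _ _)) h4
  have hloss : ∀ b, 3 ≤ b → overlapLoss U (M ++ (List.replicate b true ++ V)) =
      overlapLoss U (M ++ [true, true, true]) := by
    intro b hb
    unfold overlapLoss
    simp only [prefix_append_run_iff M V hb]
  refine ⟨pieceRuns (completed U).reverse, (completed M₀.reverse).reverse, pieceRuns (completed V),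
    overlapLoss U (M ++ [true, true, true]), overlapLoss_le _ _, overlapLoss M₀.reverse V,
    overlapLoss_le _ _, pieceRuns_ne_nil _, pieceRuns_ne_nil _, ?_, fun h3 h4 => ?_,
    fun a b ha hb => ?_⟩
  · refine hM₀.trans ?_
    unfold completed
    split
    · exact ⟨[], [true, true], by simp⟩
    · simp
  · unfold overlapLoss
    rw [if_neg]
    rintro (h | h)
    · exact two_zeros_not_prefix h3 h
    · exact two_zeros_not_prefix (h4.trans (List.prefix_append _ _)) h
  · rw [pieceRuns_run hU (hMf b) (hd1 b) a ha, hM₂ b hb, hloss b hb]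
    have := pieceRuns_run hM₀f hV hd2 b hb
    rw [List.reverse_reverse] at this
    rw [this]

/-- The split-off one stands between `00` and `0`: it lies in no occurrence of `11011` and is too
short to be listed. -/
theorem pieceRuns_split_left {U V : List Bool} {c : ℕ} (hU : [false, false] <+: U) :
    pieceRuns (U.reverse ++ (true :: false :: List.replicate c true ++ V)) =
      pieceRuns (U.reverse ++ (List.replicate c true ++ V)) := by
  obtain ⟨U, rfl⟩ := hU
  have key : ∀ v, pieceRuns (([false, false] ++ U).reverse ++ (true :: false :: v)) =
      pieceRuns (([false, false] ++ U).reverse ++ v) := by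
    intro v
    have e1 : ([false, false] ++ U).reverse ++ (true :: false :: v) =
        (true :: ([false, false] ++ U)).reverse ++ (false :: v) := by simp
    have e2 : (true :: ([false, false] ++ U)).reverse = ([false, false] ++ U).reverse ++ [true] := by
      simp
    have e3 : (false :: v) = [false].reverse ++ v := rfl
    rw [e1, pieceRuns_append (by rw [straddle_w11011_eq_zero]; simp) (by simp), e2,
      pieceRuns_append (by rw [straddle_w11011_eq_zero]; simp) (by simp), pieceRuns_singleton,
      glue_singleton_nil (pieceRuns_ne_nil _), e3,
      pieceRuns_append (r := [false]) (by rw [straddle_w11011_eq_zero]; simp) (by simp),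
      List.reverse_singleton, pieceRuns_singleton, glue_nil_singleton (pieceRuns_ne_nil _),
      pieceRuns_append (by rw [straddle_w11011_eq_zero]; simp) (by simp)]
  exact key _

theorem pieceRuns_split_right {U V : List Bool} {c : ℕ} (hV : [false, false] <+: V) :
    pieceRuns (U.reverse ++ (List.replicate c true ++ false :: true :: V)) =
      pieceRuns (U.reverse ++ (List.replicate c true ++ V)) := by
  obtain ⟨V, rfl⟩ := hV
  have key : ∀ r : List Bool, pieceRuns (r.reverse ++ (false :: true :: ([false, false] ++ V))) =
      pieceRuns (r.reverse ++ ([false, false] ++ V)) := by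
    intro r
    have e1 : r.reverse ++ (false :: true :: ([false, false] ++ V)) =
        (false :: r).reverse ++ (true :: ([false, false] ++ V)) := by simp
    have e2 : (false :: r).reverse = r.reverse ++ [false] := by
      simp
    have e3 : (true :: ([false, false] ++ V)) = [true].reverse ++ ([false, false] ++ V) := rfl
    rw [e1, pieceRuns_append (by rw [straddle_w11011_eq_zero]; simp) (by simp), e2,
      pieceRuns_append (by rw [straddle_w11011_eq_zero]; simp) (by simp), pieceRuns_singleton,
      glue_singleton_nil (pieceRuns_ne_nil _), e3,
      pieceRuns_append (r := [true]) (by rw [straddle_w11011_eq_zero]; simp) (by simp),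
      List.reverse_singleton, pieceRuns_singleton, glue_nil_singleton (pieceRuns_ne_nil _),
      pieceRuns_append (by rw [straddle_w11011_eq_zero]; simp) (by simp)]
  have := key (List.replicate c true ++ U)
  simpa using this

/-! ### Good deletions change one piece -/

/-- `Q` arises from `P` by deleting one symbol of one word. -/
def OneDeletion (P Q : List (List Bool)) : Prop :=
  ∃ S p b q T, P = S ++ (p ++ b :: q) :: T ∧ Q = S ++ (p ++ q) :: T

/-- The parts of the occurrences of `w` in `x` before the next occurrence. -/
def heads (w x : List Bool) : List (List Bool) := (chunks w x).tail.map (List.take w.length)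

theorem Good.oneDeletion {w r v : List Bool} {b : Bool} (hw : 2 ≤ w.length) (h : Good w r b v) :
    OneDeletion (pieces w (r.reverse ++ b :: v)) (pieces w (r.reverse ++ v)) := by
  rw [h.pieces_left hw, h.pieces_right hw]
  obtain ⟨S, p, hS, -⟩ := pieces_last w r.reverse (w_ne_nil hw)
  obtain ⟨q, T, hT, -⟩ := pieces_first w v (w_ne_nil hw)
  rw [hS, hT, glue_append]
  refine ⟨S, p, b, q, T, ?_, glue_append _ _ _ _⟩
  rw [glue_append]; simp

theorem Good.heads_eq {w r v : List Bool} {b : Bool} (hw : 2 ≤ w.length) (h : Good w r b v) :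
    heads w (r.reverse ++ b :: v) = heads w (r.reverse ++ v) := by
  have h0 := straddle_singleton_le w r b v
  have h2 : r.reverse ++ b :: v = (r.reverse ++ [b]) ++ v := by simp
  unfold heads
  rw [h2, chunks_append (by simpa using h.2.1),
    chunks_append (by simpa using Nat.le_zero.1 (h0.trans_eq h.1)),
    chunks_append (by simpa using h.2.2), chunks_of_length_lt (x := [b]) (by simp; omega)]
  obtain ⟨S, c, hS, hc⟩ := chunks_last w r.reverse
  obtain ⟨d, T, hT⟩ := List.exists_cons_of_ne_nil (chunks_ne_nil w v)
  rw [hS, hT, glue_append, glue_append, glue_append]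
  cases S with
  | nil => rfl
  | cons s S =>
    have := (hc (by simp)).length_le
    simp only [List.cons_append, List.tail_cons, List.map_append, List.map_cons]
    rw [List.take_append_of_le_length (by simp; omega), List.take_append_of_le_length (by omega),
      List.take_append_of_le_length (by omega)]

/-- Heads and pieces together give the chunks. The heads are needed because overlapping occurrences
leave an empty piece, whatever the length of the overlap. -/
theorem eq_of_heads_of_pieces {w x x' : List Bool} (hw : w ≠ []) (h1 : heads w x = heads w x')
    (h2 : pieces w x = pieces w x') : x = x' := by
  have : chunks w x = chunks w x' := by
    rw [pieces_eq_dropHeads w x hw, pieces_eq_dropHeads w x' hw] at h2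
    unfold heads at h1
    obtain ⟨p, P, hP⟩ := List.exists_cons_of_ne_nil (chunks_ne_nil w x)
    obtain ⟨p', P', hP'⟩ := List.exists_cons_of_ne_nil (chunks_ne_nil w x')
    rw [hP, hP'] at h1 h2 ⊢
    simp only [dropHeads, List.cons.injEq, List.tail_cons] at h1 h2
    congr 1
    · exact h2.1
    · have h3 := h2.2
      clear h2 hP hP'
      induction P generalizing P' with
      | nil => cases P' <;> simp at h1 ⊢
      | cons c P ih =>
        cases P' with
        | nil => simp at h1
        | cons c' P' =>
          simp only [List.map_cons, List.cons.injEq] at h1 h3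
          rw [ih _ h1.2 h3.2, ← List.take_append_drop w.length c, h1.1, h3.1,
            List.take_append_drop]
  rw [← flatten_chunks w x, this, flatten_chunks]

theorem OneDeletion.sum_length {P Q : List (List Bool)} (h : OneDeletion P Q) :
    (P.map List.length).sum = (Q.map List.length).sum + 1 := by
  obtain ⟨S, p, b, q, T, rfl, rfl⟩ := h
  simp
  omega

theorem OneDeletion.forall₂ {P Q : List (List Bool)} (h : OneDeletion P Q) :
    List.Forall₂ (fun p q => q.Sublist p ∧ p.length ≤ q.length + 1) P Q := by
  obtain ⟨S, p, b, q, T, rfl, rfl⟩ := h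
  have refl : ∀ S : List (List Bool),
      List.Forall₂ (fun p q => q.Sublist p ∧ p.length ≤ q.length + 1) S S := by
    intro S
    rw [List.forall₂_same]
    exact fun x _ => ⟨List.Sublist.refl _, by omega⟩
  refine List.rel_append (refl S) (List.Forall₂.cons ⟨?_, by simp; omega⟩ (refl T))
  exact List.Sublist.append_left (List.sublist_cons_self _ _) _

/-! ### Hamming distances of padded sequences -/

/-- Two sequences that differ in at most one entry. -/
def DifferOnce {α : Type*} (l l' : List α) : Prop := ∃ S a b T, l = S ++ a :: T ∧ l' = S ++ b :: T

theorem OneDeletion.differOnce {P Q : List (List Bool)} (h : OneDeletion P Q) : DifferOnce P Q := by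
  obtain ⟨S, p, b, q, T, h1, h2⟩ := h
  exact ⟨S, _, _, T, h1, h2⟩

theorem DifferOnce.symm {α : Type*} {l l' : List α} (h : DifferOnce l l') : DifferOnce l' l := by
  obtain ⟨S, a, b, T, h1, h2⟩ := h
  exact ⟨S, b, a, T, h2, h1⟩

theorem DifferOnce.length_eq {α : Type*} {l l' : List α} (h : DifferOnce l l') :
    l.length = l'.length := by
  obtain ⟨S, a, b, T, rfl, rfl⟩ := h
  simp

theorem DifferOnce.hammingDist_le {α : Type*} {q m : ℕ} (f : α → ZMod q) {l l' : List α}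
    (h : DifferOnce l l') : hammingDist (padded m (l.map f)) (padded m (l'.map f)) ≤ 1 := by
  obtain ⟨S, a, b, T, rfl, rfl⟩ := h
  unfold hammingDist
  rw [Finset.card_le_one]
  have key : ∀ i : Fin m, padded m (List.map f (S ++ a :: T)) i ≠ padded m (List.map f (S ++ b :: T)) i →
      (i : ℕ) = S.length := by
    intro i hi
    by_contra hne
    apply hi
    unfold padded
    simp only [List.map_append, List.map_cons, List.getD_eq_getElem?_getD]
    rcases lt_or_gt_of_ne hne with hlt | hgt
    · rw [List.getElem?_append_left (by simpa), List.getElem?_append_left (by simpa)]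
    · rw [List.getElem?_append_right (by simp; omega), List.getElem?_append_right (by simp; omega)]
      obtain ⟨k, hk⟩ : ∃ k, (i : ℕ) - (S.map f).length = k + 1 :=
        ⟨(i : ℕ) - S.length - 1, by simp; omega⟩
      rw [hk]; rfl
  intro i hi j hj
  simp only [Finset.mem_filter, Finset.mem_univ, true_and] at hi hj
  exact Fin.ext ((key i hi).trans (key j hj).symm)

theorem eq_of_padded_eq {q m : ℕ} {l l' : List (ZMod q)} (hl : l.length = l'.length)
    (hm : l.length ≤ m) (h : padded m l = padded m l') : l = l' := by
  apply List.ext_getElem hl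
  intro i h1 h2
  have := congrFun h ⟨i, by omega⟩
  unfold padded at this
  simpa [List.getD_eq_getElem?_getD, h1, h2] using this

theorem IsParityCheck.eq_of_hammingDist_lt {q r m d : ℕ} {H : Matrix (Fin r) (Fin m) (ZMod q)}
    (hH : IsParityCheck d H) {v v' : Fin m → ZMod q} (h : H.mulVec v = H.mulVec v')
    (hd : hammingDist v v' < d) : v = v' := by
  by_contra hne
  have h1 := hH (v - v') (by rw [Matrix.mulVec_sub, h, sub_self]) (sub_ne_zero.2 hne)
  have h2 : hammingNorm (v - v') = hammingDist v v' := by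
    simp [hammingNorm, hammingDist, sub_ne_zero]
  omega

theorem numOcc_le (w x : List Bool) : numOcc w x ≤ x.length := by
  unfold numOcc occurrences
  refine (List.length_filter_le _ _).trans ?_
  simp

theorem length_le_maxGap {w x p : List Bool} (hp : p ∈ pieces w x) : p.length ≤ maxGap w x := by
  unfold maxGap
  have : ∀ l : List ℕ, ∀ a ∈ l, a ≤ l.foldr max 0 := by
    intro l
    induction l with
    | nil => simp
    | cons b l ih =>
      intro a ha
      rw [List.foldr_cons]
      rcases List.mem_cons.1 ha with rfl | ha
      · exact le_max_left _ _
      · exact (ih a ha).trans (le_max_right _ _)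
  exact this _ _ (List.mem_map_of_mem hp)

/-! ### Reconstruction from the hashes -/

/-- Corresponding words have the same length and the same hash. -/
def SameHash (h : List Bool → ℕ) (P P' : List (List Bool)) : Prop :=
  List.Forall₂ (fun u v => u.length = v.length ∧ h u = h v) P P'

theorem exists_N₁ (n : ℕ) (h : List Bool → ℕ) (s : ℕ) :
    0 < N₁ n h s ∧ n < q₁ h s ^ (N₁ n h s - 1) := by
  have : {N | 0 < N ∧ n < q₁ h s ^ (N - 1)}.Nonempty := by
    refine ⟨n + 1, by omega, ?_⟩
    rw [Nat.add_sub_cancel]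
    exact Nat.lt_pow_self (nextOddPrime_prime _).one_lt
  exact Nat.sInf_mem this

theorem exists_N₂ (n : ℕ) {s : ℕ} (H : Matrix (Fin 2) (Fin s) (ZMod (nextPrime s))) :
    0 < N₂ n H ∧ n < q₂ H ^ N₂ n H - 1 := by
  have : {N | 0 < N ∧ n < q₂ H ^ N - 1}.Nonempty := by
    refine ⟨n + 1, by omega, ?_⟩
    have : n + 1 < q₂ H ^ (n + 1) := Nat.lt_pow_self (nextPrime_prime _).one_lt
    omega
  exact Nat.sInf_mem this

namespace Ingredients

variable {n s C : ℕ} (D : Ingredients n s C)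

theorem sameHash {w x x' : List Bool} (hw : w ≠ []) (hx : x.length = n)
    (hg : maxGap w x ≤ s) (hg' : maxGap w x' ≤ s)
    {a : Fin D.r₁ → ZMod (q₁ D.h s)} (ha : padded _ (D.F x w) ∈ D.C₂ a)
    (ha' : padded _ (D.F x' w) ∈ D.C₂ a) (hl : (pieces w x).length = (pieces w x').length)
    (hd : hammingDist (padded (q₁ D.h s ^ (N₁ n D.h s - 1)) (D.F x w))
      (padded (q₁ D.h s ^ (N₁ n D.h s - 1)) (D.F x' w)) ≤ 4) :
    SameHash D.h (pieces w x) (pieces w x') := by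
  have h1 : padded (q₁ D.h s ^ (N₁ n D.h s - 1)) (D.F x w) = padded _ (D.F x' w) :=
    D.H₁_dist.eq_of_hammingDist_lt ((show _ = a from ha).trans (show _ = a from ha').symm)
      (by omega)
  have h2 : D.F x w = D.F x' w := by
    refine eq_of_padded_eq (by simp [F, hl]) ?_ h1
    unfold F
    rw [List.length_map, length_pieces w x hw]
    have := numOcc_le w x
    have := (exists_N₁ n D.h s).2
    omega
  unfold F at h2
  unfold SameHash
  have h3 : List.Forall₂ (fun u v => D.e₁ (pieceHash D.h u) = D.e₁ (pieceHash D.h v))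
      (pieces w x) (pieces w x') := by
    have := List.forall₂_eq_eq_eq ▸ h2
    rw [List.forall₂_map_left_iff, List.forall₂_map_right_iff] at this
    exact this
  have h4 : List.Forall₂ (fun u v => u ∈ pieces w x ∧ v ∈ pieces w x')
      (pieces w x) (pieces w x') := by
    rw [List.forall₂_iff_get]
    exact ⟨hl, fun i h1 h2 => ⟨List.get_mem _ _, List.get_mem _ _⟩⟩
  rw [List.forall₂_iff_get] at h3 h4 ⊢
  refine ⟨hl, fun i hi hi' => ?_⟩
  have h5 := h3.2 i hi hi'
  obtain ⟨m1, m2⟩ := h4.2 i hi hi'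
  have h6 := D.e₁_inj ⟨_, (length_le_maxGap m1).trans hg, rfl⟩
    ⟨_, (length_le_maxGap m2).trans hg', rfl⟩ h5
  simpa [pieceHash] using h6

end Ingredients

/-- Corresponding words have equal length, equal hash and a common subword in `R` that lacks at most
two of their symbols. -/
theorem IsTwoDeletionHash.eq_of_sameHash {C : ℕ} {h : List Bool → ℕ} (hh : IsTwoDeletionHash C h)
    {P P' R : List (List Bool)} (hs : SameHash h P P')
    (h1 : List.Forall₂ (fun p q => q.Sublist p ∧ p.length ≤ q.length + 2) P R)
    (h2 : List.Forall₂ (fun p q => q.Sublist p ∧ p.length ≤ q.length + 2) P' R) : P = P' := by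
  unfold SameHash at hs
  rw [List.forall₂_iff_get] at hs h1 h2
  apply List.ext_get hs.1
  intro i hi hi'
  have hiR : i < R.length := by omega
  obtain ⟨a1, a2⟩ := hs.2 i hi hi'
  obtain ⟨b1, b2⟩ := h1.2 i hi hiR
  obtain ⟨c1, c2⟩ := h2.2 i hi' hiR
  exact hh.1 _ _ _ a1 b1 c1 b2 a2

theorem forall₂_sublist_trans {P Q R : List (List Bool)}
    (h1 : List.Forall₂ (fun p q => q.Sublist p ∧ p.length ≤ q.length + 1) P Q)
    (h2 : List.Forall₂ (fun p q => q.Sublist p ∧ p.length ≤ q.length + 1) Q R) :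
    List.Forall₂ (fun p q => q.Sublist p ∧ p.length ≤ q.length + 2) P R := by
  rw [List.forall₂_iff_get] at h1 h2 ⊢
  refine ⟨h1.1.trans h2.1, fun i hi hi' => ?_⟩
  have hiQ : i < Q.length := by omega
  obtain ⟨b1, b2⟩ := h1.2 i hi hiQ
  obtain ⟨c1, c2⟩ := h2.2 i hiQ hi'
  exact ⟨c1.trans b1, by omega⟩

theorem forall₂_sublist_refl (P : List (List Bool)) :
    List.Forall₂ (fun p q => q.Sublist p ∧ p.length ≤ q.length + 1) P P := by
  rw [List.forall₂_same]
  exact fun x _ => ⟨List.Sublist.refl _, by omega⟩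

namespace Ingredients

variable {n s C : ℕ} (D : Ingredients n s C)

/-- By the root `1`, a nonzero difference of weight at most two has entries `c` and `-c` at two
positions `i`, `j`. The root `α` then gives `α ^ i = α ^ j`, impossible for distinct exponents below
the order of `α`. -/
theorem eq_of_mem_C₁ {a : D.BCHSyndrome} {v v' : Fin (q₂ D.HR ^ N₂ n D.HR - 1) → ZMod (q₂ D.HR)}
    (h : v ∈ D.C₁ a) (h' : v' ∈ D.C₁ a) (hd : hammingDist v v' ≤ 2) : v = v' := by
  by_contra hne
  obtain ⟨h1, h2⟩ := h
  obtain ⟨h1', h2'⟩ := h'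
  set φ := algebraMap (ZMod (q₂ D.HR)) (GaloisField (q₂ D.HR) (N₂ n D.HR)) with hφ
  have hinj : Function.Injective φ := φ.injective
  set S := Finset.univ.filter fun i => v i ≠ v' i with hS
  have hcard : S.card ≤ 2 := hd
  have hz : ∀ i, i ∉ S → v i - v' i = 0 := by
    intro i hi
    simpa [hS, sub_eq_zero] using hi
  have hz' : ∀ i ∈ S, v i - v' i ≠ 0 := by
    intro i hi
    simpa [hS, sub_eq_zero] using hi
  have e1 : ∑ i ∈ S, (v i - v' i) = 0 := by
    rw [Finset.sum_subset (Finset.subset_univ S) (fun i _ hi => hz i hi), Finset.sum_sub_distrib,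
      h1, h1', sub_self]
  have e2 : ∑ i ∈ S, φ (v i - v' i) * D.α ^ (i : ℕ) = 0 := by
    rw [Finset.sum_subset (Finset.subset_univ S) (fun i _ hi => by rw [hz i hi, map_zero, zero_mul])]
    simp only [map_sub, sub_mul, Finset.sum_sub_distrib]
    rw [h2, h2', sub_self]
  have hpos : 0 < S.card := by
    rw [Finset.card_pos]
    obtain ⟨i, hi⟩ := Function.ne_iff.1 hne
    exact ⟨i, by simpa [hS] using hi⟩
  have hc : S.card = 1 ∨ S.card = 2 := by omega
  rcases hc with hc | hc
  · obtain ⟨i, hi⟩ := Finset.card_eq_one.1 hc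
    rw [hi, Finset.sum_singleton] at e1
    exact hz' i (by simp [hi]) e1
  · obtain ⟨i, j, hij, hi⟩ := Finset.card_eq_two.1 hc
    rw [hi, Finset.sum_pair hij] at e1 e2
    have e3 : v j - v' j = -(v i - v' i) := by linear_combination e1
    rw [e3, map_neg] at e2
    have e4 : φ (v i - v' i) * (D.α ^ (i : ℕ) - D.α ^ (j : ℕ)) = 0 := by linear_combination e2
    rcases mul_eq_zero.1 e4 with h3 | h3
    · exact hz' i (by simp [hi]) (hinj (by rw [h3, map_zero]))
    · have := pow_injOn_Iio_orderOf (x := D.α) (by simp [D.α_order]) (by simp [D.α_order])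
        (sub_eq_zero.1 h3)
      exact hij (Fin.ext this)

/-- The field element for a list of run lengths. -/
noncomputable def runSymbol (t : List ℕ) : ZMod (q₂ D.HR) :=
  D.e₂ (D.HR.mulVec (padded s (t.map fun k => (k : ZMod (nextPrime s)))))

theorem FR_eq_map (x : List Bool) : D.FR x w11011 = (pieceRuns x).map D.runSymbol := by
  unfold FR pieceRuns
  rw [List.map_map]
  rfl

theorem runHash_eq {x x' : List Bool} (hx : x.length = n)
    (hg : maxGap w11011 x ≤ s) (hg' : maxGap w11011 x' ≤ s) {a : D.BCHSyndrome}
    (ha : padded _ (D.FR x w11011) ∈ D.C₁ a) (ha' : padded _ (D.FR x' w11011) ∈ D.C₁ a)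
    {L : List (List ℕ)} (h1 : DifferOnce (pieceRuns x) L) (h2 : DifferOnce (pieceRuns x') L) :
    List.Forall₂ (fun u u' => (u.length ≤ s ∧ u'.length ≤ s) ∧ runHash D.HR u = runHash D.HR u')
      (pieces w11011 x) (pieces w11011 x') := by
  have hl : (pieces w11011 x).length = (pieces w11011 x').length := by
    have := h1.length_eq.trans h2.length_eq.symm
    simpa [pieceRuns] using this
  have hw : w11011 ≠ [] := by simp [w11011]
  have e1 : padded (q₂ D.HR ^ N₂ n D.HR - 1) (D.FR x w11011) = padded _ (D.FR x' w11011) := by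
    refine D.eq_of_mem_C₁ ha ha' ?_
    rw [FR_eq_map, FR_eq_map]
    refine (hammingDist_triangle _ (padded _ (L.map D.runSymbol)) _).trans ?_
    exact add_le_add (h1.hammingDist_le _) (h2.symm.hammingDist_le _)
  have e2 : D.FR x w11011 = D.FR x' w11011 := by
    refine eq_of_padded_eq (by simp [FR, hl]) ?_ e1
    unfold FR
    rw [List.length_map, length_pieces _ x hw]
    have := numOcc_le w11011 x
    have := (exists_N₂ n D.HR).2
    omega
  unfold FR at e2
  have h3 : List.Forall₂ (fun u v => D.e₂ (runHash D.HR u) = D.e₂ (runHash D.HR v))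
      (pieces w11011 x) (pieces w11011 x') := by
    have := List.forall₂_eq_eq_eq ▸ e2
    rw [List.forall₂_map_left_iff, List.forall₂_map_right_iff] at this
    exact this
  rw [List.forall₂_iff_get] at h3 ⊢
  refine ⟨hl, fun i hi hi' => ?_⟩
  have m1 := (length_le_maxGap (List.get_mem (pieces w11011 x) ⟨i, hi⟩)).trans hg
  have m2 := (length_le_maxGap (List.get_mem (pieces w11011 x') ⟨i, hi'⟩)).trans hg'
  exact ⟨⟨m1, m2⟩, D.e₂_inj ⟨_, m1, rfl⟩ ⟨_, m2, rfl⟩ (h3.2 i hi hi')⟩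

end Ingredients

/-! ### The run hash as sum and moment of the run lengths -/

/-- The sum of the entries of a list, weighted by their indices, which start at 1. -/
def moment : List ℕ → ℕ
  | [] => 0
  | a :: l => a + l.sum + moment l

theorem moment_append (l l' : List ℕ) : moment (l ++ l') = moment l + moment l' + l.length * l'.sum := by
  induction l with
  | nil => simp [moment]
  | cons a l ih => simp [moment, ih]; ring

theorem sum_getD {R : Type*} [CommRing R] (l : List ℕ) (s : ℕ) (h : l.length ≤ s) :
    ∑ j : Fin s, (l.map fun k : ℕ => (k : R)).getD j 0 = (l.sum : R) := by
  induction l generalizing s with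
  | nil => simp
  | cons a l ih =>
    obtain ⟨s, rfl⟩ : ∃ k, s = k + 1 := ⟨s - 1, by simp at h; omega⟩
    rw [Fin.sum_univ_succ]
    have := ih s (by simpa using h)
    simp only [List.map_cons, Fin.val_zero, List.getD_cons_zero, Fin.val_succ, List.getD_cons_succ, this]
    simp

theorem sum_mul_getD {R : Type*} [CommRing R] (l : List ℕ) (s : ℕ) (h : l.length ≤ s) :
    ∑ j : Fin s, (((j : ℕ) : R) + 1) * (l.map fun k : ℕ => (k : R)).getD j 0 = (moment l : R) := by
  induction l generalizing s with
  | nil => simp [moment]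
  | cons a l ih =>
    obtain ⟨s, rfl⟩ : ∃ k, s = k + 1 := ⟨s - 1, by simp at h; omega⟩
    have h' : l.length ≤ s := by simpa using h
    rw [Fin.sum_univ_succ]
    have h1 := ih s h'
    have h2 := sum_getD (R := R) l s h'
    simp only [List.map_cons, Fin.val_zero, List.getD_cons_zero, Fin.val_succ, List.getD_cons_succ,
      Nat.cast_add, Nat.cast_one, moment]
    simp only [add_mul _ (1 : R), Finset.sum_add_distrib, one_mul] at h1 ⊢
    rw [h1, h2]
    simp
    ring

theorem lt_nextPrime (m : ℕ) : m < nextPrime m := by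
  have h : {p : ℕ | p.Prime ∧ m < p}.Nonempty := by
    obtain ⟨p, hp, hp'⟩ := Nat.exists_infinite_primes (m + 1)
    exact ⟨p, hp', hp⟩
  exact (Nat.sInf_mem h).2

/-- Two lists of run lengths with the same run hash. -/
def SameRunHash (s : ℕ) (t t' : List ℕ) : Prop :=
  t.length ≤ s ∧ t.sum ≤ s ∧ t.sum = t'.sum ∧ moment t ≡ moment t' [MOD nextPrime s]

theorem sameRunHash_of_runHash_eq {s : ℕ} {u u' : List Bool} (hu : u.length ≤ s)
    (hu' : u'.length ≤ s) (h : runHash (runMatrix s) u = runHash (runMatrix s) u') :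
    SameRunHash s (longOneRuns u) (longOneRuns u') := by
  have l1 := (length_longOneRuns_le u).trans hu
  have l2 := (length_longOneRuns_le u').trans hu'
  have s1 := (sum_longOneRuns_le u).trans hu
  have s2 := (sum_longOneRuns_le u').trans hu'
  have h0 := congrFun h 0
  have h1 := congrFun h 1
  simp only [runHash, Matrix.mulVec, dotProduct, runMatrix, Matrix.of_apply, Matrix.cons_val_zero,
    Matrix.cons_val_one, padded, one_mul] at h0 h1
  -- The cast in `runHash` elaborates to a lift of the whole list in the list monad; this rewrites
  -- it as an ordinary map.
  have e : ∀ l : List ℕ, List.map (fun k => k) (do let a ← l; pure (a : ZMod (nextPrime s))) =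
      l.map fun k : ℕ => (k : ZMod (nextPrime s)) := by
    intro l
    induction l with
    | nil => rfl
    | cons a l ih => simp_all
  rw [e, e] at h0 h1
  rw [sum_getD _ _ l1, sum_getD _ _ l2, ZMod.natCast_eq_natCast_iff] at h0
  rw [sum_mul_getD _ _ l1, sum_mul_getD _ _ l2, ZMod.natCast_eq_natCast_iff] at h1
  -- Both sums are at most `s`, hence smaller than the modulus, and their congruence is an equality.
  have := lt_nextPrime s
  exact ⟨l1, s1, Nat.ModEq.eq_of_lt_of_lt h0 (by omega) (by omega), h1⟩

theorem forall₂_middle {α : Type*} {R : α → α → Prop} {S : List α} {a b : α} {T T' : List α}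
    (h : List.Forall₂ R (S ++ a :: T) (S ++ b :: T')) : R a b := by
  induction S with
  | nil => exact (List.forall₂_cons.1 h).1
  | cons c S ih => exact ih (List.forall₂_cons.1 h).2

theorem sum_runEntry_succ_ne {k : ℕ} (hk : 1 ≤ k) : (runEntry (k + 1)).sum ≠ (runEntry k).sum := by
  unfold runEntry
  rw [if_pos (by omega)]
  split <;> simp

theorem length_mul_two_le_sum {m : List ℕ} (h : ∀ k ∈ m, 2 ≤ k) : 2 * m.length ≤ m.sum := by
  induction m with
  | nil => simp
  | cons a l ih =>
    simp only [List.mem_cons, forall_eq_or_imp] at h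
    have := ih h.2
    simp only [List.length_cons, List.sum_cons]
    omega

theorem le_two_of_sum_eq {m : List ℕ} (h : ∀ k ∈ m, 2 ≤ k) (hs : m.sum = 2 * m.length) :
    ∀ k ∈ m, k ≤ 2 := by
  induction m with
  | nil => simp
  | cons a l ih =>
    simp only [List.mem_cons, forall_eq_or_imp] at h ⊢
    simp only [List.length_cons, List.sum_cons] at hs
    have := length_mul_two_le_sum h.2
    exact ⟨by omega, ih h.2 (by omega)⟩

/-- Lengthening the first or the second of two runs gives different run hashes, unless both runs
contribute nothing to the hash and all the runs between them have length 2. -/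
theorem two_runs_of_sameRunHash {s : ℕ} {P T Q : List (List ℕ)} (hP : P ≠ []) (hT : T ≠ [])
    (hQ : Q ≠ []) (hT2 : ∀ t ∈ T, ∀ k ∈ t, 2 ≤ k) {A B : ℕ} (hA : 1 ≤ A) (hB : 1 ≤ B)
    (h : List.Forall₂ (SameRunHash s)
      (glue P (glue [runEntry (A + 1)] (glue T (glue [runEntry B] Q))))
      (glue P (glue [runEntry A] (glue T (glue [runEntry (B + 1)] Q))))) :
    A = 1 ∧ B = 1 ∧ ∃ m, T = [m] ∧ ∀ k ∈ m, k ≤ 2 := by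
  obtain ⟨r, R, rfl⟩ := List.exists_cons_of_ne_nil hQ
  rcases List.eq_nil_or_concat P with rfl | ⟨S, l, rfl⟩
  · exact absurd rfl hP
  simp only [List.concat_eq_append] at h
  obtain ⟨m, T', rfl⟩ := List.exists_cons_of_ne_nil hT
  have g1 : ∀ k, glue [runEntry k] (r :: R) = (runEntry k ++ r) :: R := fun k => rfl
  rw [g1, g1] at h
  cases T' with
  | cons m' T' =>
    -- The two runs lie in different pieces, and already the sums of the piece with the first run
    -- differ.
    exfalso
    rw [glue_cons_cons, glue_cons_cons] at h
    have g2 : ∀ k X, glue [runEntry k] (m :: X) = (runEntry k ++ m) :: X := fun k X => rfl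
    rw [g2, g2, glue_append, glue_append] at h
    have h1 := (forall₂_middle h).2.2.1
    simp only [List.sum_append] at h1
    exact sum_runEntry_succ_ne hA (by omega)
  | nil =>
    have g2 : ∀ k k' : ℕ, glue [runEntry k] (glue [m] ((runEntry k' ++ r) :: R)) =
      (runEntry k ++ (m ++ (runEntry k' ++ r))) :: R := fun k k' => rfl
    rw [g2, g2, glue_append, glue_append] at h
    obtain ⟨h0, h1, h2, h3⟩ := forall₂_middle h
    have hQs := lt_nextPrime s
    have hm2 := hT2 m (by simp)
    have hm := length_mul_two_le_sum hm2
    by_cases hA2 : 2 ≤ A <;> by_cases hB2 : 2 ≤ B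
    -- Both runs are listed: moving one unit from one to the other changes the moment by the
    -- distance `m.length + 1` of their indices, which is positive and smaller than the prime.
    · exfalso
      simp only [runEntry, if_pos hA2, if_pos hB2, if_pos (show 2 ≤ A + 1 by omega),
        if_pos (show 2 ≤ B + 1 by omega), moment_append, List.sum_append, List.length_append,
        moment, List.sum_cons, List.sum_nil, List.length_cons, List.length_nil] at h0 h1 h2 h3
      have h4 : ∀ x y : ℕ, x = y + (m.length + 1) → x ≡ y [MOD nextPrime s] → False := by
        rintro x y rfl h4
        have h5 := (Nat.modEq_iff_dvd' (Nat.le_add_right y (m.length + 1))).1 h4.symm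
        rw [Nat.add_sub_cancel_left] at h5
        have := Nat.le_of_dvd (by omega) h5
        omega
      refine h4 _ _ ?_ h3.symm
      ring
    -- Only one of the runs is listed before it is lengthened. Lengthening it adds 1 to the sum,
    -- lengthening the other one adds 2.
    · exfalso
      simp only [runEntry, if_pos hA2, if_neg hB2, if_pos (show 2 ≤ A + 1 by omega),
        if_pos (show 2 ≤ B + 1 by omega), List.sum_append,
        List.sum_cons, List.sum_nil] at h2
      omega
    · exfalso
      simp only [runEntry, if_neg hA2, if_pos hB2, if_pos (show 2 ≤ A + 1 by omega),
        if_pos (show 2 ≤ B + 1 by omega), List.sum_append,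
        List.sum_cons, List.sum_nil] at h2
      omega
    -- An entry 2 appears in front of `m` or behind it. The moments differ by `m.sum - 2 *
    -- m.length`, which is at most `s` and vanishes only if all entries of `m` are 2.
    · obtain rfl : A = 1 := by omega
      obtain rfl : B = 1 := by omega
      refine ⟨rfl, rfl, m, rfl, le_two_of_sum_eq hm2 ?_⟩
      simp only [runEntry, if_neg hA2, if_pos (show 2 ≤ 1 + 1 by omega), moment_append,
        List.sum_append, List.length_append,
        moment, List.sum_cons, List.sum_nil, List.length_cons, List.length_nil] at h0 h1 h2 h3
      by_contra hne
      have h4 : ∀ x y : ℕ, x = y + (m.sum - 2 * m.length) → x ≡ y [MOD nextPrime s] → False := by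
        rintro x y rfl h4
        have h5 := (Nat.modEq_iff_dvd' (Nat.le_add_right y (m.sum - 2 * m.length))).1 h4.symm
        rw [Nat.add_sub_cancel_left] at h5
        have := Nat.le_of_dvd (by omega) h5
        omega
      refine h4 _ _ ?_ h3
      obtain ⟨d, hd⟩ : ∃ d, m.sum = 2 * m.length + d := ⟨m.sum - 2 * m.length, by omega⟩
      rw [hd, Nat.add_sub_cancel_left]
      ring

/-! ### Codewords that reach a common word by good deletions -/

/-- A deletion that affects no occurrence of `w` and creates none. -/
def GoodDeletion (w x y : List Bool) : Prop :=
  ∃ r b v, x = r.reverse ++ b :: v ∧ y = r.reverse ++ v ∧ Good w r b v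

theorem GoodDeletion.oneDeletion {w x y : List Bool} (hw : 2 ≤ w.length) (h : GoodDeletion w x y) :
    OneDeletion (pieces w x) (pieces w y) := by
  obtain ⟨r, b, v, rfl, rfl, h⟩ := h
  exact h.oneDeletion hw

theorem GoodDeletion.heads_eq {w x y : List Bool} (hw : 2 ≤ w.length) (h : GoodDeletion w x y) :
    heads w x = heads w y := by
  obtain ⟨r, b, v, rfl, rfl, h⟩ := h
  exact h.heads_eq hw

theorem GoodDeletion.numOcc_eq {w x y : List Bool} (hw : 2 ≤ w.length) (h : GoodDeletion w x y) :
    numOcc w x = numOcc w y := by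
  obtain ⟨r, b, v, rfl, rfl, h⟩ := h
  rw [numOcc_delete_of_avoid hw h.1 h.2.1, h.2.2, Nat.add_zero]

theorem MildDeletion.good1111 {x y : List Bool} (h : MildDeletion x y) : GoodDeletion w1111 x y := by
  obtain ⟨r, b, v, h1, h2, h3, h4, h5⟩ := h
  exact ⟨r, b, v, h1, h2, h3⟩

theorem MildDeletion.good110011 {x y : List Bool} (h : MildDeletion x y) :
    GoodDeletion w110011 x y := by
  obtain ⟨r, b, v, h1, h2, h3, h4, h5⟩ := h
  exact ⟨r, b, v, h1, h2, h4⟩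

theorem MildDeletion.pieceRuns_eq {x y : List Bool} (h : MildDeletion x y) :
    pieceRuns x = pieceRuns y := by
  obtain ⟨r, b, v, h1, h2, h3, h4, h5⟩ := h
  exact h5

/-- At most one deletion. -/
def AtMostOneDeletion (P Q : List (List Bool)) : Prop := P = Q ∨ OneDeletion P Q

theorem AtMostOneDeletion.forall₂ {P Q : List (List Bool)} (h : AtMostOneDeletion P Q) :
    List.Forall₂ (fun p q => q.Sublist p ∧ p.length ≤ q.length + 1) P Q := by
  rcases h with rfl | h
  · exact forall₂_sublist_refl P
  · exact h.forall₂

namespace Ingredients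

variable {n s C : ℕ} (D : Ingredients n s C)

/-- The information that the code gives about two codewords through the word `w`. -/
structure Agree (w x x' : List Bool) : Prop where
  length_eq : x.length = n
  gap_le : maxGap w x ≤ s
  gap_le' : maxGap w x' ≤ s
  syndrome : ∃ a, padded _ (D.F x w) ∈ D.C₂ a ∧ padded _ (D.F x' w) ∈ D.C₂ a

variable {D}

/-- Four changes of a single entry stay below the minimum distance 5. -/
theorem Agree.sameHash_of_differ {w x x' : List Bool} (hw : w ≠ []) (hA : D.Agree w x x')
    {P Q R : List (List Bool)} (h1 : DifferOnce (pieces w x) P) (h2 : DifferOnce P Q)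
    (h3 : DifferOnce Q R) (h4 : DifferOnce R (pieces w x')) :
    SameHash D.h (pieces w x) (pieces w x') := by
  obtain ⟨a, ha, ha'⟩ := hA.syndrome
  refine D.sameHash hw hA.length_eq hA.gap_le hA.gap_le' ha ha'
    (h1.length_eq.trans (h2.length_eq.trans (h3.length_eq.trans h4.length_eq))) ?_
  have e1 := h1.hammingDist_le (m := q₁ D.h s ^ (N₁ n D.h s - 1)) (fun u => D.e₁ (pieceHash D.h u))
  have e2 := h2.hammingDist_le (m := q₁ D.h s ^ (N₁ n D.h s - 1)) (fun u => D.e₁ (pieceHash D.h u))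
  have e3 := h3.hammingDist_le (m := q₁ D.h s ^ (N₁ n D.h s - 1)) (fun u => D.e₁ (pieceHash D.h u))
  have e4 := h4.hammingDist_le (m := q₁ D.h s ^ (N₁ n D.h s - 1)) (fun u => D.e₁ (pieceHash D.h u))
  unfold F
  have t1 := hammingDist_triangle (padded (q₁ D.h s ^ (N₁ n D.h s - 1)) ((pieces w x).map fun u => D.e₁ (pieceHash D.h u)))
    (padded _ (P.map fun u => D.e₁ (pieceHash D.h u))) (padded _ ((pieces w x').map fun u => D.e₁ (pieceHash D.h u)))
  have t2 := hammingDist_triangle (padded (q₁ D.h s ^ (N₁ n D.h s - 1)) (P.map fun u => D.e₁ (pieceHash D.h u)))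
    (padded _ (Q.map fun u => D.e₁ (pieceHash D.h u))) (padded _ ((pieces w x').map fun u => D.e₁ (pieceHash D.h u)))
  have t3 := hammingDist_triangle (padded (q₁ D.h s ^ (N₁ n D.h s - 1)) (Q.map fun u => D.e₁ (pieceHash D.h u)))
    (padded _ (R.map fun u => D.e₁ (pieceHash D.h u))) (padded _ ((pieces w x').map fun u => D.e₁ (pieceHash D.h u)))
  omega

/-- The intermediate sequences need not be the pieces of any word, since only corresponding entries
are compared. This freedom is used for split runs. -/
theorem Agree.pieces_eq {w x x' : List Bool} (hw : w ≠ []) (hA : D.Agree w x x')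
    {P P' R : List (List Bool)} (h1 : AtMostOneDeletion (pieces w x) P) (h2 : AtMostOneDeletion P R)
    (h3 : AtMostOneDeletion (pieces w x') P') (h4 : AtMostOneDeletion P' R) :
    pieces w x = pieces w x' := by
  have conv : ∀ {P Q}, AtMostOneDeletion P Q → P ≠ [] → DifferOnce P Q := by
    rintro P Q (rfl | h) hP
    · obtain ⟨p, P, rfl⟩ := List.exists_cons_of_ne_nil hP
      exact ⟨[], p, p, P, rfl, rfl⟩
    · exact h.differOnce
  have ne : ∀ {P Q : List (List Bool)}, DifferOnce P Q → Q ≠ [] := by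
    rintro P Q ⟨S, a, b, T, rfl, rfl⟩
    simp
  have c1 := conv h1 (pieces_ne_nil w x hw)
  have c2 := conv h2 (ne c1)
  have c3 := conv h3 (pieces_ne_nil w x' hw)
  have c4 := conv h4 (ne c3)
  exact D.h_hash.eq_of_sameHash (hA.sameHash_of_differ hw c1 c2 c4.symm c3.symm)
    (forall₂_sublist_trans h1.forall₂ h2.forall₂) (forall₂_sublist_trans h3.forall₂ h4.forall₂)

/-- If both words reach a common word by two good deletions, then they are equal. -/
theorem Agree.eq_of_good {w x x' x₁ x₁' y : List Bool} (hw : 2 ≤ w.length) (hA : D.Agree w x x')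
    (h1 : GoodDeletion w x x₁) (h2 : GoodDeletion w x₁ y)
    (h3 : GoodDeletion w x' x₁') (h4 : GoodDeletion w x₁' y) : x = x' :=
  eq_of_heads_of_pieces (w_ne_nil hw)
    (((h1.heads_eq hw).trans (h2.heads_eq hw)).trans ((h3.heads_eq hw).trans (h4.heads_eq hw)).symm)
    (hA.pieces_eq (w_ne_nil hw) (Or.inr (h1.oneDeletion hw)) (Or.inr (h2.oneDeletion hw))
      (Or.inr (h3.oneDeletion hw)) (Or.inr (h4.oneDeletion hw)))

theorem Agree.eq_of_good_one {w x x' y : List Bool} (hw : 2 ≤ w.length) (hA : D.Agree w x x')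
    (h1 : GoodDeletion w x y) (h3 : GoodDeletion w x' y) : x = x' :=
  eq_of_heads_of_pieces (w_ne_nil hw) ((h1.heads_eq hw).trans (h3.heads_eq hw).symm)
    (hA.pieces_eq (w_ne_nil hw) (Or.inr (h1.oneDeletion hw)) (Or.inl rfl)
      (Or.inr (h3.oneDeletion hw)) (Or.inl rfl))

/-- Two codewords whose pieces differ in length after one good deletion each. -/
theorem Agree.false_of_length {w x x' x₁ x₁' : List Bool} (hw : 2 ≤ w.length) (hA : D.Agree w x x')
    (h1 : GoodDeletion w x x₁) (h3 : GoodDeletion w x' x₁') {S T₁ T₁' : List (List Bool)}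
    {p p' : List Bool} {Z : List (List Bool)} (e1 : pieces w x₁ = S ++ p :: T₁)
    (e2 : pieces w x₁' = S ++ p' :: T₁') (d1 : DifferOnce (pieces w x₁) Z)
    (d2 : DifferOnce Z (pieces w x₁')) (hp : p'.length + 2 ≤ p.length) : False := by
  have hs := hA.sameHash_of_differ (w_ne_nil hw) (h1.oneDeletion hw).differOnce d1 d2
    (h3.oneDeletion hw).differOnce.symm
  have f1 := (h1.oneDeletion hw).forall₂
  have f3 := (h3.oneDeletion hw).forall₂
  unfold SameHash at hs
  rw [e1] at f1
  rw [e2] at f3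
  rw [List.forall₂_iff_get] at hs f1 f3
  have l1 : S.length < (S ++ p :: T₁).length := by simp
  have l2 : S.length < (S ++ p' :: T₁').length := by simp
  -- The entry at index `S.length` has at least `p.length` symbols in `x` and at most `p'.length +
  -- 1` in `x'`, although equal hashes include equal lengths.
  have a1 := f1.2 S.length (by rw [f1.1]; exact l1) l1
  have a3 := f3.2 S.length (by rw [f3.1]; exact l2) l2
  have a2 := hs.2 S.length (by rw [f1.1]; exact l1) (by rw [f3.1]; exact l2)
  have b1 := a1.1.length_le
  have b3 := a3.2
  have b2 := a2.1
  simp only [List.get_eq_getElem, List.getElem_append_right, le_refl, Nat.sub_self,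
    List.getElem_cons_zero] at b1 b2 b3
  omega

end Ingredients

theorem differOnce_glue {α : Type*} {P Z : List (List α)} (hP : P ≠ []) (hZ : Z ≠ []) (a b : List α) :
    DifferOnce (glue P (glue [a] Z)) (glue P (glue [b] Z)) := by
  obtain ⟨z, Z, rfl⟩ := List.exists_cons_of_ne_nil hZ
  rcases List.eq_nil_or_concat P with rfl | ⟨S, l, rfl⟩
  · exact absurd rfl hP
  have g : ∀ a, glue (S ++ [l]) (glue [a] (z :: Z)) = S ++ (l ++ (a ++ z)) :: Z :=
    fun a => glue_append S l (a ++ z) Z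
  rw [List.concat_eq_append, g, g]
  exact ⟨S, _, _, Z, rfl, rfl⟩

theorem chunks_cons_of_not_prefix {w x : List Bool} {a : Bool} {p : List Bool} {P : List (List Bool)}
    (h : w.isPrefixOf (a :: x) = false) (hc : chunks w x = p :: P) :
    chunks w (a :: x) = (a :: p) :: P := by
  rw [chunks, h, hc]; rfl

theorem chunks_cons_of_prefix {w x : List Bool} {a : Bool} {p : List Bool} {P : List (List Bool)}
    (h : w.isPrefixOf (a :: x) = true) (hc : chunks w x = p :: P) :
    chunks w (a :: x) = [] :: (a :: p) :: P := by
  rw [chunks, h, hc]; rfl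

/-- The occurrences of `110011` on the two sides of the run touch in `110011110011` and overlap in
`11001110011`, so the piece between them is empty in both words. -/
theorem JunctionDeletion.pieces_eq {x y : List Bool} (h : JunctionDeletion x y) :
    pieces w110011 x = pieces w110011 y := by
  obtain ⟨U, V, ⟨U, rfl⟩, ⟨V, rfl⟩, rfl, rfl⟩ := h
  have hw : w110011 ≠ [] := by simp [w110011]
  rw [pieces_eq_dropHeads _ _ hw, pieces_eq_dropHeads _ _ hw]
  obtain ⟨p, P, hP⟩ := List.exists_cons_of_ne_nil (chunks_ne_nil w110011 (true :: true :: V))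
  have e : ∀ k, ([false, false, true, true] ++ U).reverse ++
      (List.replicate k true ++ ([false, false, true, true] ++ V)) =
      U.reverse ++ ([true, true, false, false] ++
        (List.replicate k true ++ ([false, false] ++ (true :: true :: V)))) := by
    intro k; simp
  have c4 : chunks w110011 ([true, true, false, false] ++
        (List.replicate 4 true ++ ([false, false] ++ (true :: true :: V)))) =
      [] :: [true, true, false, false, true, true] :: ([true, true, false, false] ++ p) :: P := by
    have c0 := chunks_cons_of_prefix rfl (chunks_cons_of_not_prefix rfl (chunks_cons_of_not_prefix rfl
      (chunks_cons_of_not_prefix rfl hP (a := false)) (a := false)) (a := true)) (a := true)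
    exact chunks_cons_of_prefix rfl (chunks_cons_of_not_prefix rfl (chunks_cons_of_not_prefix rfl
      (chunks_cons_of_not_prefix rfl (chunks_cons_of_not_prefix rfl (chunks_cons_of_not_prefix rfl c0)))))
  have c3 : chunks w110011 ([true, true, false, false] ++
        (List.replicate 3 true ++ ([false, false] ++ (true :: true :: V)))) =
      [] :: [true, true, false, false, true] :: ([true, true, false, false] ++ p) :: P := by
    have c0 := chunks_cons_of_prefix rfl (chunks_cons_of_not_prefix rfl (chunks_cons_of_not_prefix rfl
      (chunks_cons_of_not_prefix rfl hP (a := false)) (a := false)) (a := true)) (a := true)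
    exact chunks_cons_of_prefix rfl (chunks_cons_of_not_prefix rfl (chunks_cons_of_not_prefix rfl
      (chunks_cons_of_not_prefix rfl (chunks_cons_of_not_prefix rfl c0))))
  -- The ends agree in their first seven symbols, while an occurrence that starts before them
  -- reaches at most five symbols into them.
  obtain ⟨g, G, h4, h3⟩ := chunks_append_of_common (w := w110011) 7 (by simp [w110011])
    (by simp [List.replicate_succ]) c4 c3 U.reverse
  rw [e, e, h4, h3]
  simp [dropHeads, w110011]

theorem straddle_w1111_eq_zero {r v : List Bool} (h : ¬ [true] <+: r ∨ ¬ [true] <+: v) :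
    straddle w1111 r v = 0 := by
  by_contra hne
  rcases created_cases hne with ⟨r', v', rfl, rfl⟩ | ⟨r', v', rfl, rfl⟩ | ⟨r', v', rfl, rfl⟩ <;>
  simp at h

theorem pieces_w1111_append {r v : List Bool} (h : ¬ [true] <+: r ∨ ¬ [true] <+: v) :
    pieces w1111 (r.reverse ++ v) = glue (pieces w1111 r.reverse) (pieces w1111 v) :=
  pieces_append (by simp [w1111]) (by simpa using straddle_w1111_eq_zero h)

theorem pieces_w1111_middle {U V : List Bool} (m : List Bool) (hU : ¬ [true] <+: U) (hV : ¬ [true] <+: V) :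
    pieces w1111 (U.reverse ++ (m ++ V)) =
      glue (pieces w1111 U.reverse) (glue (pieces w1111 m) (pieces w1111 V)) := by
  rw [pieces_w1111_append (Or.inl hU)]
  have := pieces_w1111_append (r := m.reverse) (Or.inr hV)
  rw [List.reverse_reverse] at this
  rw [this]

theorem heads_w1111_middle {U V m m' : List Bool} (hU : ¬ [true] <+: U) (hV : ¬ [true] <+: V)
    (hm : chunks w1111 m = [m]) (hm' : chunks w1111 m' = [m']) :
    heads w1111 (U.reverse ++ (m ++ V)) = heads w1111 (U.reverse ++ (m' ++ V)) := by
  have key : ∀ m, chunks w1111 m = [m] → chunks w1111 (U.reverse ++ (m ++ V)) =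
      glue (chunks w1111 U.reverse) (glue [m] (chunks w1111 V)) := by
    intro m hm
    rw [chunks_append (by simpa using straddle_w1111_eq_zero (Or.inl hU)),
      chunks_append (by simpa using straddle_w1111_eq_zero (Or.inr hV)), hm]
  unfold heads
  rw [key m hm, key m' hm']
  obtain ⟨S, c, hS, hc⟩ := chunks_last w1111 U.reverse
  obtain ⟨d, T, hT⟩ := List.exists_cons_of_ne_nil (chunks_ne_nil w1111 V)
  have g : ∀ m, glue (S ++ [c]) (glue [m] (d :: T)) = S ++ (c ++ (m ++ d)) :: T :=
    fun m => glue_append S c (m ++ d) T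
  rw [hS, hT, g, g]
  cases S with
  | nil => rfl
  | cons s S =>
    have := (hc (by simp)).length_le
    simp only [List.cons_append, List.tail_cons, List.map_append, List.map_cons]
    rw [List.take_append_of_le_length this, List.take_append_of_le_length this]

/-! ### Comparison of deletions in long runs of ones -/

/-- Deleting a one from a run of at least four ones. -/
def LongRunDeletion (x y : List Bool) : Prop :=
  ∃ r v, x = r.reverse ++ true :: v ∧ y = r.reverse ++ v ∧ Destroys true r v

/-- Deleting a zero that separates two runs of ones, of together at least four symbols. -/
def MergingDeletion (x y : List Bool) : Prop :=
  ∃ r v, x = r.reverse ++ false :: v ∧ y = r.reverse ++ v ∧ straddle w1111 r v ≠ 0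

theorem LongRunDeletion.cases {x y : List Bool} (h : LongRunDeletion x y) :
    GoodDeletion w110011 x y ∨ JunctionDeletion x y := by
  obtain ⟨r, v, rfl, rfl, h⟩ := h
  rcases destroys_true_cases h with ⟨r', v', h1, h2, h3⟩ | h
  · exact Or.inl ⟨r', true, v', h1.symm, h2.symm, h3⟩
  · exact Or.inr h

theorem not_prefix_of_zeros {U : List Bool} {l : List Bool} (h : (false :: l) <+: U) : ¬ [true] <+: U := by
  obtain ⟨t, rfl⟩ := h
  simp

theorem two_zeros_of_append {M V : List Bool} {k : ℕ} (hM : [false] <+: M)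
    (h : [false, false] <+: M ++ (List.replicate (k + 1) true ++ V)) : [false, false] <+: M := by
  obtain ⟨M, rfl⟩ := hM
  cases M with
  | nil => simp [List.replicate_succ] at h
  | cons a M => simpa using h

theorem exists_long_of_infix {M : List Bool} (h : w1111 <:+: M) : ∃ k ∈ longOneRuns M, 4 ≤ k := by
  obtain ⟨a, b, rfl⟩ := h
  obtain ⟨i, a', rfl, ha⟩ := exists_append_replicate true a
  obtain ⟨j, b', rfl, hb⟩ := exists_replicate_append true b
  have e : a' ++ List.replicate i true ++ w1111 ++ (List.replicate j true ++ b') =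
      a' ++ (List.replicate (i + j + 3 + 1) true ++ b') := by
    rw [show i + j + 3 + 1 = i + (4 + j) by omega, List.replicate_add, List.replicate_add]
    simp [w1111, List.replicate_succ]
  have b1 : ∀ x ∈ (List.replicate (i + j + 3 + 1) true).getLast?, ∀ y ∈ b'.head?, (x == y) = false := by
    intro x hx y hy
    have hx : x = true := by simpa [List.getLast?_replicate, eq_comm] using hx
    cases b' with
    | nil => simp at hy
    | cons c b' =>
      simp at hy hb
      subst hx hy
      simpa using hb
  have b2 : ∀ x ∈ a'.getLast?, ∀ y ∈ (List.replicate (i + j + 3 + 1) true ++ b').head?,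
      (x == y) = false := by
    intro x hx y hy
    rcases List.eq_nil_or_concat a' with rfl | ⟨a'', c, rfl⟩
    · simp at hx
    · simp [List.replicate_succ] at hx hy ha
      subst hx hy
      simpa using ha
  unfold longOneRuns
  rw [e, oneRuns_append b2, oneRuns_append b1, oneRuns_replicate_true]
  exact ⟨i + j + 3 + 1, by simp, by omega⟩

namespace Ingredients

variable {n s C : ℕ} {D : Ingredients n s C} {p : D.Params}

theorem agree0000 {x x' : List Bool} (hx : x ∈ D.code p) (hx' : x' ∈ D.code p) :
    D.Agree w0000 x x' :=
  ⟨hx.1.1, hx.1.2.1, hx'.1.2.1, _, hx.2.2.2.2.2.2.2.1, hx'.2.2.2.2.2.2.2.1⟩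

theorem agree1111 {x x' : List Bool} (hx : x ∈ D.code p) (hx' : x' ∈ D.code p) :
    D.Agree w1111 x x' :=
  ⟨hx.1.1, hx.1.2.2.1, hx'.1.2.2.1, _, hx.2.2.2.2.2.2.2.2.1, hx'.2.2.2.2.2.2.2.2.1⟩

theorem agree110011 {x x' : List Bool} (hx : x ∈ D.code p) (hx' : x' ∈ D.code p) :
    D.Agree w110011 x x' :=
  ⟨hx.1.1, hx.1.2.2.2.1, hx'.1.2.2.2.1, _, hx.2.2.2.2.2.2.2.2.2.1, hx'.2.2.2.2.2.2.2.2.2.1⟩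

theorem modEq_of_code {w x x' : List Bool} {c : ZMod 7} (h : (numOcc w x : ZMod 7) = c)
    (h' : (numOcc w x' : ZMod 7) = c) : numOcc w x ≡ numOcc w x' [MOD 7] :=
  (ZMod.natCast_eq_natCast_iff _ _ _).1 (h.trans h'.symm)

theorem sameRunHash_of_code (hR : D.HR = runMatrix s) {x x' : List Bool} (hx : x ∈ D.code p)
    (hx' : x' ∈ D.code p) {L : List (List ℕ)} (h1 : DifferOnce (pieceRuns x) L)
    (h2 : DifferOnce (pieceRuns x') L) :
    List.Forall₂ (SameRunHash s) (pieceRuns x) (pieceRuns x') := by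
  have h := D.runHash_eq hx.1.1 hx.1.2.2.2.2.1 hx'.1.2.2.2.2.1 hx.2.2.2.2.2.2.2.2.2.2.1
    hx'.2.2.2.2.2.2.2.2.2.2.1 h1 h2
  unfold pieceRuns
  rw [List.forall₂_map_left_iff, List.forall₂_map_right_iff]
  refine h.imp fun u u' hu => sameRunHash_of_runHash_eq hu.1.1 hu.1.2 ?_
  rw [← hR]
  exact hu.2

/-- The comparison of two words that arise from a common word by changing different runs of ones. -/
theorem two_runs_of_code (hR : D.HR = runMatrix s) {x x' : List Bool} (hx : x ∈ D.code p)
    (hx' : x' ∈ D.code p) {U M V : List Bool} (hU : ¬ [true] <+: U) (hV : ¬ [true] <+: V)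
    (hM : [false] <+: M) (hM' : [false] <+: M.reverse)
    (h1 : [false, false] <+: U ∨ [false, false] <+: M)
    (h2 : [false, false] <+: M.reverse ∨ [false, false] <+: V) {a b : ℕ} (ha : 3 ≤ a) (hb : 3 ≤ b)
    (e : pieceRuns x = pieceRuns (U.reverse ++ (List.replicate (a + 1) true ++
      (M ++ (List.replicate b true ++ V)))))
    (e' : pieceRuns x' = pieceRuns (U.reverse ++ (List.replicate a true ++
      (M ++ (List.replicate (b + 1) true ++ V))))) :
    a = 3 ∧ b = 3 ∧ ¬ w1111 <:+: M ∧ ¬ ([false, false] <+: U ∧ [false, false] <+: M) := by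
  obtain ⟨P, M₁, Q, δ, hδ, ε, hε, hP, hQ, hMM, hδ0, hT⟩ := pieceRuns_two_runs hU hV hM hM' h1 h2
  have hM₁ := pieceRuns_ne_nil M₁
  have E1 := hT (a + 1) b (by omega) hb
  have E2 := hT a (b + 1) ha (by omega)
  have E0 := hT a b ha hb
  rw [← e] at E1
  rw [← e'] at E2
  have ne1 : ∀ k, glue [runEntry k] Q ≠ [] := fun k => glue_ne_nil (by simp) hQ
  have ne2 : ∀ k, glue (pieceRuns M₁) (glue [runEntry k] Q) ≠ [] := fun k => glue_ne_nil hM₁ (ne1 k)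
  -- Both sequences differ in one entry from the sequence for the lengths `a` and `b`, so their
  -- distance is at most two, less than that of the BCH code.
  have d1 : DifferOnce (pieceRuns x) (glue P (glue [runEntry (a - δ)] (glue (pieceRuns M₁)
      (glue [runEntry (b - ε)] Q)))) := by
    rw [E1]
    exact differOnce_glue hP (ne2 _) _ _
  have d2 : DifferOnce (pieceRuns x') (glue P (glue [runEntry (a - δ)] (glue (pieceRuns M₁)
      (glue [runEntry (b - ε)] Q)))) := by
    have as : ∀ k, glue P (glue [runEntry (a - δ)] (glue (pieceRuns M₁) (glue [runEntry k] Q))) =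
        glue (glue P (glue [runEntry (a - δ)] (pieceRuns M₁))) (glue [runEntry k] Q) := by
      intro k
      rw [glue_assoc hP (glue_ne_nil (by simp) hM₁) (ne1 k), glue_assoc (by simp) hM₁ (ne1 k)]
    rw [E2, as, as]
    exact differOnce_glue (glue_ne_nil hP (glue_ne_nil (by simp) hM₁)) hQ _ _
  have hh := sameRunHash_of_code hR hx hx' d1 d2
  rw [E1, E2, show a + 1 - δ = a - δ + 1 by omega, show b + 1 - ε = b - ε + 1 by omega] at hh
  have hT2 : ∀ t ∈ pieceRuns M₁, ∀ k ∈ t, 2 ≤ k := by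
    intro t ht k hk
    obtain ⟨u, -, rfl⟩ := List.mem_map.1 ht
    exact two_le_of_mem_longOneRuns hk
  obtain ⟨hA, hB, m, hm, hm2⟩ := two_runs_of_sameRunHash hP hM₁ hQ hT2 (by omega) (by omega) hh
  -- From `a - δ = 1`, `a ≥ 3` and `δ ≤ 2` follow `a = 3` and `δ = 2`, likewise for `b`. The value
  -- `δ = 2` is excluded if `00` stands on both sides of the first run.
  refine ⟨by omega, by omega, ?_, ?_⟩
  · intro h
    have hone : pieces w11011 M₁ = [M₁] := by
      have hw : w11011 ≠ [] := by simp [w11011]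
      have hl : (pieces w11011 M₁).length = 1 := by
        have := congrArg List.length hm
        simpa [pieceRuns] using this
      rw [length_pieces _ _ hw, ← length_chunks] at hl
      obtain ⟨c, hc⟩ := List.length_eq_one_iff.1 hl
      have hf := flatten_chunks w11011 M₁
      rw [hc] at hf
      rw [pieces_eq_dropHeads _ _ hw, hc]
      simpa [dropHeads] using hf
    have hm' : m = longOneRuns M₁ := by
      unfold pieceRuns at hm
      rw [hone] at hm
      simpa using hm.symm
    obtain ⟨k, hk, hk4⟩ := exists_long_of_infix (h.trans hMM)
    rw [← hm'] at hk
    have := hm2 k hk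
    omega
  · rintro ⟨h3, h4⟩
    have := hδ0 h3 h4
    omega

/-- The runs of a junction have `00` on both sides, so they lose no ones to `11011` and the
exception in `two_runs_of_code` cannot occur. -/
theorem eq_of_junction_aux (hR : D.HR = runMatrix s) {x x' x₁ x₁' : List Bool}
    (hx : x ∈ D.code p) (hx' : x' ∈ D.code p) (h1 : MildDeletion x x₁) (h1' : MildDeletion x' x₁')
    {U V U' V' M : List Bool} (hU : [false, false, true, true] <+: U)
    (hV : [false, false, true, true] <+: V) (hV' : [false, false, true, true] <+: V')
    (e : x₁ = U.reverse ++ (List.replicate 4 true ++ V))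
    (e' : x₁' = U'.reverse ++ (List.replicate 4 true ++ V'))
    (hM : V = M ++ (List.replicate 3 true ++ V')) (hM' : U' = M.reverse ++ (List.replicate 3 true ++ U))
    (hMf : [false] <+: M) (hMr : [false] <+: M.reverse) : False := by
  have z : ∀ {U : List Bool}, [false, false, true, true] <+: U → [false, false] <+: U :=
    fun h => List.IsPrefix.trans ⟨[true, true], rfl⟩ h
  have hM00 : [false, false] <+: M := two_zeros_of_append hMf (k := 2) (V := V') (by rw [← hM]; exact z hV)
  have := two_runs_of_code hR hx hx' (U := U) (M := M) (V := V') (a := 3) (b := 3)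
    (not_prefix_of_zeros hU) (not_prefix_of_zeros hV') hMf hMr (Or.inl (z hU)) (Or.inr (z hV'))
    le_rfl le_rfl (by rw [h1.pieceRuns_eq, e, hM]) (by
      rw [h1'.pieceRuns_eq, e', hM']
      congr 1
      simp [List.replicate_succ])
  exact this.2.2.2 ⟨z hU, hM00⟩

/-- A mild deletion, followed by a deletion in a long run of ones. -/
theorem eq_of_longRunDeletion (hR : D.HR = runMatrix s) {x x' x₁ x₁' y : List Bool}
    (hx : x ∈ D.code p) (hx' : x' ∈ D.code p) (h1 : MildDeletion x x₁) (h2 : LongRunDeletion x₁ y)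
    (h1' : MildDeletion x' x₁') (h2' : LongRunDeletion x₁' y) : x = x' := by
  have hw : 2 ≤ w110011.length := by simp [w110011]
  have g := h1.good110011.oneDeletion hw
  have g' := h1'.good110011.oneDeletion hw
  have hA := agree110011 hx hx'
  have h2s := h2
  have h2s' := h2'
  rcases h2.cases with h2 | h2 <;> rcases h2'.cases with h2' | h2'
  · exact hA.eq_of_good hw h1.good110011 h2 h1'.good110011 h2'
  -- The pieces of `x` and `x'` are equal, but their total length exceeds that for `y` by two along
  -- one path and by one along the other, where the junction is invisible.
  · exfalso
    have e := hA.pieces_eq (w_ne_nil hw) (Or.inr g) (Or.inr (h2.oneDeletion hw)) (Or.inr g')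
      (Or.inl h2'.pieces_eq)
    have s1 := g.sum_length
    have s2 := (h2.oneDeletion hw).sum_length
    have s3 := g'.sum_length
    rw [h2'.pieces_eq, ← e] at s3
    omega
  · exfalso
    have e := hA.pieces_eq (w_ne_nil hw) (Or.inr g) (Or.inl h2.pieces_eq) (Or.inr g')
      (Or.inr (h2'.oneDeletion hw))
    have s1 := g.sum_length
    have s2 := (h2'.oneDeletion hw).sum_length
    have s3 := g'.sum_length
    rw [h2.pieces_eq, e] at s1
    omega
  · obtain ⟨U, V, hU, hV, e, ey⟩ := h2
    obtain ⟨U', V', hU', hV', e', ey'⟩ := h2'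
    rcases runs_compare (by omega) (by omega) (not_prefix_of_zeros hU) (not_prefix_of_zeros hV)
      (not_prefix_of_zeros hU') (not_prefix_of_zeros hV') (ey.symm.trans ey') with
      ⟨rfl, -, rfl⟩ | ⟨M, hM, hM', hMf, hMr⟩ | ⟨M, hM, hM', hMf, hMr⟩
    -- If the run is the same, then `x₁ = x₁'`, and a single deletion that is good for `1111`
    -- remains.
    · have h3 := h1'.good1111
      rw [e', ← e] at h3
      exact (agree1111 hx hx').eq_of_good_one (by simp [w1111]) h1.good1111 h3
    · exact (eq_of_junction_aux hR hx hx' h1 h1' hU hV hV' e e' hM hM' hMf hMr).elim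
    · exact (eq_of_junction_aux hR hx' hx h1' h1 hU' hV' hV e' e hM hM' hMf hMr).elim

end Ingredients

theorem chunks_w1111_replicate (k : ℕ) :
    ∃ Z, chunks w1111 (List.replicate (k + 4) true) = [] :: (Z ++ [w1111]) := by
  induction k with
  | zero => exact ⟨[], rfl⟩
  | succ k ih =>
    obtain ⟨Z, hZ⟩ := ih
    exact ⟨[true] :: Z, chunks_cons_of_prefix (by simp [w1111, List.replicate_succ]) hZ⟩

theorem pieces_w1111_replicate (k : ℕ) :
    ∃ Z, pieces w1111 (List.replicate (k + 4) true) = [] :: (Z ++ [[]]) := by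
  obtain ⟨Z, hZ⟩ := chunks_w1111_replicate k
  refine ⟨Z.map (List.drop 4), ?_⟩
  rw [pieces_eq_dropHeads _ _ (by simp [w1111]), hZ]
  simp [dropHeads, w1111]

/-- A zero between two ones lies in no occurrence of `110011`, so merging only creates occurrences.
There are at most five of them, few enough to be determined by the count modulo 7. -/
theorem MergingDeletion.numOcc_w110011 {x y : List Bool} (h : MergingDeletion x y) :
    ∃ k ≤ 5, numOcc w110011 y = numOcc w110011 x + k ∧ (k = 0 → GoodDeletion w110011 x y) ∧
      (k ≠ 0 → SplitDeletion x y) := by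
  obtain ⟨r, v, rfl, rfl, h⟩ := h
  have ha := avoid_of_created h
  refine ⟨straddle w110011 r v, straddle_le w110011 r v (by simp [w110011]),
    numOcc_delete_of_avoid (by simp [w110011]) ha.1 ha.2, fun h0 => ?_, splitDeletion_of_created h⟩
  exact ⟨r, false, v, rfl, rfl, ha.1, ha.2, h0⟩

theorem LongRunDeletion.numOcc_w110011 {x y : List Bool} (h : LongRunDeletion x y) :
    numOcc w110011 y = numOcc w110011 x := by
  rcases h.cases with h | h
  · exact (h.numOcc_eq (by simp [w110011])).symm
  · have := congrArg List.length h.pieces_eq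
    rw [length_pieces _ _ (by simp [w110011]), length_pieces _ _ (by simp [w110011])] at this
    omega

namespace Ingredients

variable {n s C : ℕ} {D : Ingredients n s C} {p : D.Params}

/-- For `c = 3` neither `10111` nor `11101` contains `1111`, and both become `1111` when the zero is
deleted. For `c ≥ 4` the two additional symbols stand on opposite sides of occurrences of `1111`,
and the lengths of the pieces disagree. -/
theorem eq_of_split_same_run {x x' x₁ x₁' : List Bool} (hx : x ∈ D.code p) (hx' : x' ∈ D.code p)
    (h1 : MildDeletion x x₁) (h1' : MildDeletion x' x₁') {U V : List Bool} {c : ℕ} (hc : 3 ≤ c)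
    (hU : ¬ [true] <+: U) (hV : ¬ [true] <+: V)
    (e : x₁ = U.reverse ++ (true :: false :: List.replicate c true ++ V))
    (e' : x₁' = U.reverse ++ (List.replicate c true ++ false :: true :: V)) : x = x' := by
  have hw : 2 ≤ w1111.length := by simp [w1111]
  have hA := agree1111 hx hx'
  have e2 : x₁' = U.reverse ++ ((List.replicate c true ++ [false, true]) ++ V) := by simp [e']
  have e1 : x₁ = U.reverse ++ (([true, false] ++ List.replicate c true) ++ V) := by simp [e]
  obtain ⟨S, g, hS⟩ : ∃ S g, pieces w1111 U.reverse = S ++ [g] := by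
    obtain ⟨S, g, h⟩ := List.eq_nil_or_concat (pieces w1111 U.reverse) |>.resolve_left
      (pieces_ne_nil _ _ (w_ne_nil hw))
    exact ⟨S, g, by simpa using h⟩
  obtain ⟨h, T, hT⟩ := List.exists_cons_of_ne_nil (pieces_ne_nil w1111 V (w_ne_nil hw))
  have p1 := pieces_w1111_middle ([true, false] ++ List.replicate c true) hU hV
  have p2 := pieces_w1111_middle (List.replicate c true ++ [false, true]) hU hV
  rw [← e1, hS, hT] at p1
  rw [← e2, hS, hT] at p2
  obtain rfl | ⟨k, rfl⟩ : c = 3 ∨ ∃ k, c = k + 4 := by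
    rcases hc.eq_or_lt with h | h
    · exact Or.inl h.symm
    · exact Or.inr ⟨c - 4, by omega⟩
  · have m1 : pieces w1111 ([true, false] ++ List.replicate 3 true) =
      [[true, false] ++ List.replicate 3 true] := rfl
    have m2 : pieces w1111 (List.replicate 3 true ++ [false, true]) =
      [List.replicate 3 true ++ [false, true]] := rfl
    have gg : ∀ m, glue (S ++ [g]) (glue [m] (h :: T)) = S ++ (g ++ (m ++ h)) :: T :=
      fun m => glue_append S g (m ++ h) T
    rw [m1, gg] at p1
    rw [m2, gg] at p2
    -- The merged entry contains `1111` and is no piece for `1111`; it serves only as the common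
    -- subword.
    have o1 : OneDeletion (pieces w1111 x₁) (S ++ (g ++ (w1111 ++ h)) :: T) := by
      rw [p1]
      exact ⟨S, g ++ [true], false, [true, true, true] ++ h, T, by simp [List.replicate_succ], by simp [w1111]⟩
    have o2 : OneDeletion (pieces w1111 x₁') (S ++ (g ++ (w1111 ++ h)) :: T) := by
      rw [p2]
      exact ⟨S, g ++ [true, true, true], false, [true] ++ h, T, by simp [List.replicate_succ], by simp [w1111]⟩
    refine eq_of_heads_of_pieces (w_ne_nil hw) ?_ (hA.pieces_eq (w_ne_nil hw)
      (Or.inr (h1.good1111.oneDeletion hw)) (Or.inr o1) (Or.inr (h1'.good1111.oneDeletion hw)) (Or.inr o2))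
    rw [h1.good1111.heads_eq hw, h1'.good1111.heads_eq hw, e1, e2]
    exact heads_w1111_middle hU hV rfl rfl
  · exfalso
    obtain ⟨Z, hZ⟩ := pieces_w1111_replicate k
    have q1 : pieces w1111 ([true, false] ++ List.replicate (k + 4) true) =
        [true, false] :: (Z ++ [[]]) := by
      have := pieces_w1111_append (r := [false, true]) (v := List.replicate (k + 4) true)
        (Or.inl (by simp))
      rw [hZ] at this
      exact this
    have q2 : pieces w1111 (List.replicate (k + 4) true ++ [false, true]) =
        [] :: (Z ++ [[false, true]]) := by
      have := pieces_w1111_append (r := (List.replicate (k + 4) true).reverse) (v := [false, true])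
        (Or.inr (by simp))
      rw [List.reverse_reverse, hZ] at this
      exact this.trans (glue_append ([] :: Z) [] [false, true] [])
    rw [q1, ← List.cons_append, glue_append, List.cons_append, glue_append] at p1
    rw [q2, ← List.cons_append, glue_append, List.cons_append, glue_append] at p2
    simp only [List.append_nil, List.nil_append] at p1 p2
    refine hA.false_of_length hw h1.good1111 h1'.good1111 p1 p2 (Z := S ++ g :: (Z ++ h :: T)) ?_ ?_ (by simp)
    · rw [p1]; exact ⟨S, _, _, _, rfl, rfl⟩
    · rw [p2]
      exact ⟨S ++ g :: Z, h, [false, true] ++ h, T, by simp, by simp⟩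

/-- For the run hash, splitting off a one is the same as shortening the run by one. So only the
exception remains: both runs of `y` are `1111`, with no `1111` in between. In `x₁` the split run and
`M` belong to the piece before the second run, while in `x₁'` the corresponding piece ends before
them, a difference of more than one symbol. -/
theorem false_of_split_two_runs (hR : D.HR = runMatrix s) {x x' x₁ x₁' : List Bool}
    (hx : x ∈ D.code p) (hx' : x' ∈ D.code p) (h1 : MildDeletion x x₁) (h1' : MildDeletion x' x₁')
    {U V U' V' M : List Bool} {c c' : ℕ} (hc : 3 ≤ c) (hc' : 3 ≤ c') (hU : ¬ [true] <+: U)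
    (hV' : ¬ [true] <+: V')
    (e : [false, false] <+: U ∧ x₁ = U.reverse ++ (true :: false :: List.replicate c true ++ V) ∨
      [false, false] <+: V ∧ x₁ = U.reverse ++ (List.replicate c true ++ false :: true :: V))
    (e' : [false, false] <+: U' ∧ x₁' = U'.reverse ++ (true :: false :: List.replicate c' true ++ V') ∨
      [false, false] <+: V' ∧ x₁' = U'.reverse ++ (List.replicate c' true ++ false :: true :: V'))
    (hM : V = M ++ (List.replicate (c' + 1) true ++ V'))
    (hM' : U' = M.reverse ++ (List.replicate (c + 1) true ++ U))
    (hMf : [false] <+: M) (hMr : [false] <+: M.reverse) : False := by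
  have hw : 2 ≤ w1111.length := by simp [w1111]
  have r1 : pieceRuns x₁ = pieceRuns (U.reverse ++ (List.replicate c true ++ V)) := by
    rcases e with ⟨h, rfl⟩ | ⟨h, rfl⟩
    · exact pieceRuns_split_left h
    · exact pieceRuns_split_right h
  have r1' : pieceRuns x₁' = pieceRuns (U'.reverse ++ (List.replicate c' true ++ V')) := by
    rcases e' with ⟨h, rfl⟩ | ⟨h, rfl⟩
    · exact pieceRuns_split_left h
    · exact pieceRuns_split_right h
  have z1 : [false, false] <+: U ∨ [false, false] <+: M := by
    rcases e with ⟨h, -⟩ | ⟨h, -⟩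
    · exact Or.inl h
    · exact Or.inr (two_zeros_of_append hMf (hM ▸ h))
  have z2 : [false, false] <+: M.reverse ∨ [false, false] <+: V' := by
    rcases e' with ⟨h, -⟩ | ⟨h, -⟩
    · exact Or.inl (two_zeros_of_append hMr (hM' ▸ h))
    · exact Or.inr h
  obtain ⟨rfl, rfl, hM4, -⟩ := two_runs_of_code hR hx' hx hU hV' hMf hMr z1 z2 hc hc'
    (by rw [h1'.pieceRuns_eq, r1', hM']; simp) (by rw [h1.pieceRuns_eq, r1, hM])
  obtain ⟨S₁, l₁, c₁, f₁⟩ : ∃ S₁ : List Bool, 2 ≤ S₁.length ∧ pieces w1111 S₁ = [S₁] ∧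
      x₁ = U.reverse ++ (S₁ ++ V) := by
    rcases e with ⟨-, h⟩ | ⟨-, h⟩
    · exact ⟨true :: false :: List.replicate 3 true, by simp, rfl, h⟩
    · exact ⟨List.replicate 3 true ++ [false, true], by simp, rfl, by simp [h]⟩
  obtain ⟨S₂, c₂, f₂⟩ : ∃ S₂ : List Bool, pieces w1111 S₂ = [S₂] ∧
      x₁' = U'.reverse ++ (S₂ ++ V') := by
    rcases e' with ⟨-, h⟩ | ⟨-, h⟩
    · exact ⟨true :: false :: List.replicate 3 true, rfl, h⟩
    · exact ⟨List.replicate 3 true ++ [false, true], rfl, by simp [h]⟩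
  have hMf1 : ¬ [true] <+: M := not_prefix_of_zeros hMf
  have hMr1 : ¬ [true] <+: M.reverse := not_prefix_of_zeros hMr
  have cM := pieces_of_not_infix hM4
  have c4 : pieces w1111 (List.replicate 4 true) = [[], []] := rfl
  have cat : ∀ a b : List Bool, ¬ [true] <+: a.reverse ∨ ¬ [true] <+: b →
      pieces w1111 (a ++ b) = glue (pieces w1111 a) (pieces w1111 b) := by
    intro a b h
    simpa using pieces_w1111_append (r := a.reverse) h
  have m1 : pieces w1111 (S₁ ++ (M ++ List.replicate 4 true)) = [S₁ ++ M, []] := by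
    rw [cat S₁ _ (Or.inr ?_), cat M _ (Or.inl hMr1), c₁, cM, c4]
    · simp [glue]
    · obtain ⟨t, rfl⟩ := hMf
      simp
  have m2 : pieces w1111 (List.replicate 4 true ++ (M ++ S₂)) = [[], M ++ S₂] := by
    rw [cat _ (M ++ S₂) (Or.inr ?_), cat M _ (Or.inl hMr1), c₂, cM, c4]
    · simp [glue]
    · obtain ⟨t, rfl⟩ := hMf
      simp
  have p1 := pieces_w1111_middle (S₁ ++ (M ++ List.replicate 4 true)) hU hV'
  have p2 := pieces_w1111_middle (List.replicate 4 true ++ (M ++ S₂)) hU hV'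
  obtain ⟨S, g, hS⟩ : ∃ S g, pieces w1111 U.reverse = S ++ [g] := by
    obtain ⟨S, g, h⟩ := List.eq_nil_or_concat (pieces w1111 U.reverse) |>.resolve_left
      (pieces_ne_nil _ _ (w_ne_nil hw))
    exact ⟨S, g, by simpa using h⟩
  obtain ⟨h, T, hT⟩ := List.exists_cons_of_ne_nil (pieces_ne_nil w1111 V' (w_ne_nil hw))
  rw [show U.reverse ++ ((S₁ ++ (M ++ List.replicate 4 true)) ++ V') = x₁ by rw [f₁, hM]; simp,
    hS, hT, m1] at p1
  rw [show U.reverse ++ ((List.replicate 4 true ++ (M ++ S₂)) ++ V') = x₁' by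
    rw [f₂, hM']; simp, hS, hT, m2] at p2
  have gg : ∀ a b : List Bool, glue (S ++ [g]) (glue [a, b] (h :: T)) =
      S ++ (g ++ a) :: (b ++ h) :: T := by
    intro a b
    rw [show [a, b] = [a] ++ [b] from rfl, glue_append, List.cons_append, glue_append]
    rfl
  rw [gg] at p1 p2
  refine (agree1111 hx hx').false_of_length hw h1.good1111 h1'.good1111 p1 p2
    (Z := S ++ (g ++ []) :: ([] ++ h) :: T) ?_ ?_ (by simp; omega)
  · rw [p1]; exact ⟨S, _, _, _, rfl, rfl⟩
  · rw [p2]; exact ⟨S ++ [g ++ []], _, _, T, by simp; rfl, by simp; rfl⟩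

/-- A mild deletion, followed by the deletion of a separating zero. -/
theorem eq_of_mergingDeletion (hR : D.HR = runMatrix s) {x x' x₁ x₁' y : List Bool}
    (hx : x ∈ D.code p) (hx' : x' ∈ D.code p) (h1 : MildDeletion x x₁) (h2 : MergingDeletion x₁ y)
    (h1' : MildDeletion x' x₁') (h2' : MergingDeletion x₁' y) : x = x' := by
  have hw : 2 ≤ w110011.length := by simp [w110011]
  obtain ⟨k, hk, n1, k0, k1⟩ := h2.numOcc_w110011
  obtain ⟨k', hk', n1', k0', k1'⟩ := h2'.numOcc_w110011
  have hm : numOcc w110011 x ≡ numOcc w110011 x' [MOD 7] :=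
    modEq_of_code hx.2.2.2.2.2.1 hx'.2.2.2.2.2.1
  rw [h1.good110011.numOcc_eq hw, h1'.good110011.numOcc_eq hw] at hm
  have hkk : k = k' := by
    unfold Nat.ModEq at hm
    omega
  subst hkk
  by_cases hk0 : k = 0
  · exact (agree110011 hx hx').eq_of_good hw h1.good110011 (k0 hk0) h1'.good110011 (k0' hk0)
  · obtain ⟨U, V, c, hc, hU, hV, ey, e⟩ := k1 hk0
    obtain ⟨U', V', c', hc', hU', hV', ey', e'⟩ := k1' hk0
    rcases runs_compare (by omega) (by omega) hU hV hU' hV' (ey.symm.trans ey') with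
      ⟨rfl, hcc, rfl⟩ | ⟨M, hM, hM', hMf, hMr⟩ | ⟨M, hM, hM', hMf, hMr⟩
    · obtain rfl : c = c' := by omega
      rcases e with ⟨-, e⟩ | ⟨-, e⟩ <;> rcases e' with ⟨-, e'⟩ | ⟨-, e'⟩
      · have h3 := h1'.good1111
        rw [e', ← e] at h3
        exact (agree1111 hx hx').eq_of_good_one (by simp [w1111]) h1.good1111 h3
      · exact eq_of_split_same_run hx hx' h1 h1' hc hU hV e e'
      · exact (eq_of_split_same_run hx' hx h1' h1 hc hU hV e' e).symm
      · have h3 := h1'.good1111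
        rw [e', ← e] at h3
        exact (agree1111 hx hx').eq_of_good_one (by simp [w1111]) h1.good1111 h3
    · exact (false_of_split_two_runs hR hx hx' h1 h1' hc hc' hU hV' e e' hM hM' hMf hMr).elim
    · exact (false_of_split_two_runs hR hx' hx h1' h1 hc' hc hU' hV e' e hM hM' hMf hMr).elim

/-- Mild and long-run deletions preserve the number of `110011`, so the merging deletion creates
none and is good. A junction after it would contradict the total length of the pieces. -/
theorem eq_of_mild_of_merging {x x' x₁ x₁' y : List Bool}
    (hx : x ∈ D.code p) (hx' : x' ∈ D.code p) (h1 : MildDeletion x x₁) (h2 : MildDeletion x₁ y)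
    (h1' : MergingDeletion x' x₁') (h2' : LongRunDeletion x₁' y) : x = x' := by
  have hw : 2 ≤ w110011.length := by simp [w110011]
  obtain ⟨k, hk, n1, k0, -⟩ := h1'.numOcc_w110011
  have hm : numOcc w110011 x ≡ numOcc w110011 x' [MOD 7] :=
    modEq_of_code hx.2.2.2.2.2.1 hx'.2.2.2.2.2.1
  rw [h1.good110011.numOcc_eq hw, h2.good110011.numOcc_eq hw, h2'.numOcc_w110011] at hm
  have hA := agree110011 hx hx'
  have g := h1.good110011.oneDeletion hw
  have g2 := h2.good110011.oneDeletion hw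
  have good := k0 (by unfold Nat.ModEq at hm; omega)
  have g' := good.oneDeletion hw
  rcases h2'.cases with h2' | h2'
  · exact hA.eq_of_good hw h1.good110011 h2.good110011 good h2'
  · exfalso
    have e := hA.pieces_eq (w_ne_nil hw) (Or.inr g) (Or.inr g2) (Or.inr g') (Or.inl h2'.pieces_eq)
    have s1 := g.sum_length
    have s2 := g2.sum_length
    have s3 := g'.sum_length
    rw [h2'.pieces_eq, ← e] at s3
    omega

end Ingredients

/-! ### Two deletions as a sequence of steps -/

theorem numOcc_singleton (b : Bool) (x : List Bool) : numOcc [b] x = x.count b := by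
  induction x with
  | nil => rfl
  | cons a x ih =>
    rw [numOcc_cons, ih, List.count_cons]
    cases a <;> cases b <;> simp [add_comm]

/-- The deletion of the symbol `b`, which creates `c` runs of four of the other symbol and
destroys `d` occurrences of `bbbb`. -/
def Step (b : Bool) (x y : List Bool) (c d : ℕ) : Prop :=
  ∃ r v, x = r.reverse ++ b :: v ∧ y = r.reverse ++ v ∧ c = straddle [!b, !b, !b, !b] r v ∧ d ≤ 1 ∧
    numOcc [b, b, b, b] y + d = numOcc [b, b, b, b] x ∧
    (d = 0 → Good [b, b, b, b] r b v) ∧ (d ≠ 0 → Destroys b r v)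

theorem exists_step (b : Bool) (r v : List Bool) :
    ∃ d, Step b (r.reverse ++ b :: v) (r.reverse ++ v) (straddle [!b, !b, !b, !b] r v) d ∧
      (d ≠ 0 → Destroys b r v) := by
  rcases numOcc_w4_eq b r v with ⟨h, hg⟩ | ⟨h, hd⟩
  · exact ⟨0, ⟨r, v, rfl, rfl, rfl, by omega, h, fun _ => hg, by simp⟩, by simp⟩
  · exact ⟨1, ⟨r, v, rfl, rfl, rfl, le_rfl, h, by simp, fun _ => hd⟩, fun _ => hd⟩

namespace Step

variable {b : Bool} {x y : List Bool} {c d : ℕ}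

theorem bounds (h : Step b x y c d) : c ≤ 3 ∧ d ≤ 1 ∧ (c = 0 ∨ d = 0) ∧
    numOcc [b, b, b, b] y + d = numOcc [b, b, b, b] x ∧
    numOcc [!b, !b, !b, !b] y = numOcc [!b, !b, !b, !b] x + c := by
  obtain ⟨r, v, rfl, rfl, rfl, hd, hn, hg, hD⟩ := h
  refine ⟨straddle_w4_le _ r v, hd, ?_, hn, numOcc_w4_ne (by simp) r v⟩
  by_contra hne
  push Not at hne
  exact not_destroys_of_created (by simp) hne.1 (hD hne.2)

theorem good_of_created_eq_zero (h : Step b x y c d) (hc : c = 0) :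
    GoodDeletion [!b, !b, !b, !b] x y := by
  obtain ⟨r, v, rfl, rfl, rfl, hd, hn, hg, hD⟩ := h
  exact ⟨r, b, v, rfl, rfl, good_w4_ne (by simp) hc⟩

theorem good_of_destroyed_eq_zero (h : Step b x y c d) (hd : d = 0) :
    GoodDeletion [b, b, b, b] x y := by
  obtain ⟨r, v, rfl, rfl, rfl, -, hn, hg, hD⟩ := h
  exact ⟨r, b, v, rfl, rfl, hg hd⟩

theorem mild_of_created (h : Step true x y c d) (hc : c ≠ 0) : MildDeletion x y := by
  obtain ⟨r, v, rfl, rfl, rfl, hd, hn, hg, hD⟩ := h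
  exact mildDeletion_of_created hc

theorem mild_of_destroyed (h : Step false x y c d) (hd : d ≠ 0) : MildDeletion x y := by
  obtain ⟨r, v, rfl, rfl, rfl, -, hn, hg, hD⟩ := h
  exact mildDeletion_of_destroys (hD hd)

theorem longRunDeletion (h : Step true x y c d) (hd : d ≠ 0) : LongRunDeletion x y := by
  obtain ⟨r, v, rfl, rfl, rfl, -, hn, hg, hD⟩ := h
  exact ⟨r, v, rfl, rfl, hD hd⟩

theorem mergingDeletion (h : Step false x y c d) (hc : c ≠ 0) : MergingDeletion x y := by
  obtain ⟨r, v, rfl, rfl, rfl, hd, hn, hg, hD⟩ := h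
  exact ⟨r, v, rfl, rfl, hc⟩

end Step

theorem prefix_of_straddle {c : Bool} {r v : List Bool} (h : straddle [c, c, c, c] r v ≠ 0) :
    [c] <+: r ∧ [c] <+: v := by
  rcases created_cases h with ⟨r', v', rfl, rfl⟩ | ⟨r', v', rfl, rfl⟩ | ⟨r', v', rfl, rfl⟩ <;> simp

theorem prefix_of_destroys {c : Bool} {r v : List Bool} (h : Destroys c r v) :
    [c] <+: r ∨ [c] <+: v := by
  rcases destroys_cases h with ⟨v', rfl⟩ | ⟨r', v', rfl, rfl⟩ | ⟨r', v', rfl, rfl⟩ | ⟨r', rfl⟩ <;> simp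

/-- The deletion of two symbols, in either order. -/
theorem exists_two_steps (A B C : List Bool) (a b : Bool) :
    (∃ d e, Step a (A ++ a :: (B ++ b :: C)) (A ++ (B ++ b :: C))
        (straddle [!a, !a, !a, !a] A.reverse (B ++ b :: C)) d ∧
      Step b (A ++ (B ++ b :: C)) (A ++ (B ++ C))
        (straddle [!b, !b, !b, !b] (A ++ B).reverse C) e ∧
      (d ≠ 0 → Destroys a A.reverse (B ++ b :: C)) ∧ (e ≠ 0 → Destroys b (A ++ B).reverse C)) ∧
    (∃ d e, Step b (A ++ a :: (B ++ b :: C)) (A ++ a :: (B ++ C))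
        (straddle [!b, !b, !b, !b] (A ++ a :: B).reverse C) d ∧
      Step a (A ++ a :: (B ++ C)) (A ++ (B ++ C))
        (straddle [!a, !a, !a, !a] A.reverse (B ++ C)) e ∧
      (d ≠ 0 → Destroys b (A ++ a :: B).reverse C) ∧ (e ≠ 0 → Destroys a A.reverse (B ++ C))) := by
  constructor
  · obtain ⟨d, h, hd⟩ := exists_step a A.reverse (B ++ b :: C)
    obtain ⟨e, h', he⟩ := exists_step b (A ++ B).reverse C
    refine ⟨d, e, by simpa using h, ?_, hd, he⟩
    rw [List.reverse_reverse, List.append_assoc, List.append_assoc] at h'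
    exact h'
  · obtain ⟨d, h, hd⟩ := exists_step b (A ++ a :: B).reverse C
    obtain ⟨e, h', he⟩ := exists_step a A.reverse (B ++ C)
    rw [List.reverse_reverse] at h'
    rw [List.reverse_reverse, List.append_assoc, List.append_assoc] at h
    exact ⟨d, e, h, h', hd, he⟩

/-- If both orders failed, `A` would end and `C` would start with a zero, and the run through the
first deleted one would have at most two symbols, too few to destroy `1111`. -/
theorem exists_true_steps (A B C : List Bool) :
    ∃ x₁ c d e f, Step true (A ++ true :: (B ++ true :: C)) x₁ c d ∧ Step true x₁ (A ++ (B ++ C)) e f ∧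
      (d = 0 ∨ e = 0) := by
  obtain ⟨⟨d, f, h1, h2, hd, -⟩, d', f', h1', h2', -, -⟩ := exists_two_steps A B C true true
  by_cases h : d = 0 ∨ straddle [!true, !true, !true, !true] (A ++ B).reverse C = 0
  · exact ⟨_, _, _, _, _, h1, h2, h⟩
  refine ⟨_, _, _, _, _, h1', h2', Or.inr ?_⟩
  push Not at h
  by_contra h3
  obtain ⟨p1, p2⟩ := prefix_of_straddle h.2
  obtain ⟨p3, p4⟩ := prefix_of_straddle h3
  obtain ⟨A', hA'⟩ := p3
  obtain ⟨C', rfl⟩ := p2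
  have hD := hd h.1
  rw [← hA'] at hD
  cases B with
  | nil =>
    rcases destroys_cases hD with ⟨v', h⟩ | ⟨r', v', h, -⟩ | ⟨r', v', h, -⟩ | ⟨r', h⟩ <;> simp at h
  | cons a B =>
    have : a = false := by simpa [eq_comm] using p4
    subst this
    have := prefix_of_destroys hD
    simp at this

/-- If both orders failed, the second deleted zero would stand between ones and could not destroy
`0000`. -/
theorem exists_false_steps (A B C : List Bool) :
    ∃ x₁ c d e f, Step false (A ++ false :: (B ++ false :: C)) x₁ c d ∧
      Step false x₁ (A ++ (B ++ C)) e f ∧ (c = 0 ∨ f = 0) := by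
  obtain ⟨⟨d, f, h1, h2, -, hf⟩, d', f', h1', h2', -, -⟩ := exists_two_steps A B C false false
  by_cases h : straddle [!false, !false, !false, !false] A.reverse (B ++ false :: C) = 0 ∨ f = 0
  · exact ⟨_, _, _, _, _, h1, h2, h⟩
  refine ⟨_, _, _, _, _, h1', h2', Or.inl ?_⟩
  push Not at h
  by_contra h3
  obtain ⟨p1, p2⟩ := prefix_of_straddle h.1
  obtain ⟨p3, p4⟩ := prefix_of_straddle h3
  obtain ⟨C', rfl⟩ := p4
  rcases List.eq_nil_or_concat B with rfl | ⟨B, b, rfl⟩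
  · simp at p2
  · have : b = true := by simpa [eq_comm] using p3
    subst this
    have := prefix_of_destroys (hf h.2)
    simp at this

theorem exists_mixed_steps (A B C : List Bool) (a : Bool) :
    (∃ x₁ c d e f, Step false (A ++ a :: (B ++ (!a) :: C)) x₁ c d ∧ Step true x₁ (A ++ (B ++ C)) e f) ∧
    (∃ x₁ c d e f, Step true (A ++ a :: (B ++ (!a) :: C)) x₁ c d ∧
      Step false x₁ (A ++ (B ++ C)) e f) := by
  obtain ⟨⟨d, f, h1, h2, -, -⟩, d', f', h1', h2', -, -⟩ := exists_two_steps A B C a (!a)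
  cases a
  · exact ⟨⟨_, _, _, _, _, h1, h2⟩, _, _, _, _, _, h1', h2'⟩
  · exact ⟨⟨_, _, _, _, _, h1', h2'⟩, _, _, _, _, _, h1, h2⟩

theorem exists_deletion {x y : List Bool} (h : y.Sublist x) (hl : y.length + 1 = x.length) :
    ∃ A a B, x = A ++ a :: B ∧ y = A ++ B := by
  induction h with
  | slnil => simp at hl
  | @cons y x a h ih =>
    have : y = x := h.eq_of_length (by simpa using hl)
    exact ⟨[], a, x, rfl, this⟩
  | @cons_cons y x a h ih =>
    obtain ⟨A, b, B, rfl, rfl⟩ := ih (by simpa using hl)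
    exact ⟨a :: A, b, B, rfl, rfl⟩

theorem exists_of_mem_deletionBall {x y : List Bool} (h : y ∈ deletionBall x) :
    ∃ A a B b C, x = A ++ a :: (B ++ b :: C) ∧ y = A ++ (B ++ C) := by
  obtain ⟨h, hl⟩ := h
  induction h with
  | slnil => simp at hl
  | @cons y x a h ih =>
    obtain ⟨A, b, B, rfl, rfl⟩ := exists_deletion h (by simpa using hl)
    exact ⟨[], a, A, b, B, rfl, rfl⟩
  | @cons_cons y x a h ih =>
    obtain ⟨A, c, B, b, C, rfl, rfl⟩ := ih (by simpa using hl)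
    exact ⟨a :: A, c, B, b, C, rfl, rfl⟩

namespace Ingredients

variable {n s C : ℕ} {D : Ingredients n s C} {p : D.Params}

theorem modEq_w0000 {x x' : List Bool} (hx : x ∈ D.code p) (hx' : x' ∈ D.code p) :
    numOcc w0000 x % 7 = numOcc w0000 x' % 7 :=
  modEq_of_code hx.2.2.2.1 hx'.2.2.2.1

theorem modEq_w1111 {x x' : List Bool} (hx : x ∈ D.code p) (hx' : x' ∈ D.code p) :
    numOcc w1111 x % 7 = numOcc w1111 x' % 7 :=
  modEq_of_code hx.2.2.2.2.1 hx'.2.2.2.2.1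

theorem eq_of_true_steps (hR : D.HR = runMatrix s) {x x' x₁ x₁' y : List Bool} {c d e f c' d' e' f' : ℕ}
    (hx : x ∈ D.code p) (hx' : x' ∈ D.code p) (h1 : Step true x x₁ c d) (h2 : Step true x₁ y e f)
    (h1' : Step true x' x₁' c' d') (h2' : Step true x₁' y e' f') (ho : d = 0 ∨ e = 0)
    (ho' : d' = 0 ∨ e' = 0) : x = x' := by
  have m0 := modEq_w0000 hx hx'
  have m1 := modEq_w1111 hx hx'
  obtain ⟨a1, a2, a3, a4, a5⟩ := h1.bounds
  obtain ⟨b1, b2, b3, b4, b5⟩ := h2.bounds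
  obtain ⟨a1', a2', a3', a4', a5'⟩ := h1'.bounds
  obtain ⟨b1', b2', b3', b4', b5'⟩ := h2'.bounds
  simp only [Bool.not_true] at a5 b5 a5' b5'
  unfold w0000 at m0
  unfold w1111 at m1
  -- Each step creates at most three occurrences, so both totals are at most 6 and congruence modulo
  -- 7 is equality.
  have s0 : c + e = c' + e' := by omega
  have s1 : d + f = d' + f' := by omega
  by_cases z0 : c + e = 0
  · exact (agree0000 hx hx').eq_of_good (by simp [w0000])
      (h1.good_of_created_eq_zero (by omega)) (h2.good_of_created_eq_zero (by omega))
      (h1'.good_of_created_eq_zero (by omega)) (h2'.good_of_created_eq_zero (by omega))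
  by_cases z1 : d + f = 0
  · exact (agree1111 hx hx').eq_of_good (by simp [w1111])
      (h1.good_of_destroyed_eq_zero (by omega)) (h2.good_of_destroyed_eq_zero (by omega))
      (h1'.good_of_destroyed_eq_zero (by omega)) (h2'.good_of_destroyed_eq_zero (by omega))
  -- Since `d = 0 ∨ e = 0` and no step both creates and destroys, the first step creates `0000` and
  -- the second destroys `1111`.
  exact eq_of_longRunDeletion hR hx hx' (h1.mild_of_created (by omega)) (h2.longRunDeletion (by omega))
    (h1'.mild_of_created (by omega)) (h2'.longRunDeletion (by omega))

theorem eq_of_false_steps (hR : D.HR = runMatrix s) {x x' x₁ x₁' y : List Bool} {c d e f c' d' e' f' : ℕ}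
    (hx : x ∈ D.code p) (hx' : x' ∈ D.code p) (h1 : Step false x x₁ c d) (h2 : Step false x₁ y e f)
    (h1' : Step false x' x₁' c' d') (h2' : Step false x₁' y e' f') (ho : c = 0 ∨ f = 0)
    (ho' : c' = 0 ∨ f' = 0) : x = x' := by
  have m0 := modEq_w0000 hx hx'
  have m1 := modEq_w1111 hx hx'
  obtain ⟨a1, a2, a3, a4, a5⟩ := h1.bounds
  obtain ⟨b1, b2, b3, b4, b5⟩ := h2.bounds
  obtain ⟨a1', a2', a3', a4', a5'⟩ := h1'.bounds
  obtain ⟨b1', b2', b3', b4', b5'⟩ := h2'.bounds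
  simp only [Bool.not_false] at a5 b5 a5' b5'
  unfold w0000 at m0
  unfold w1111 at m1
  have s0 : c + e = c' + e' := by omega
  have s1 : d + f = d' + f' := by omega
  by_cases z0 : c + e = 0
  · exact (agree1111 hx hx').eq_of_good (by simp [w1111])
      (h1.good_of_created_eq_zero (by omega)) (h2.good_of_created_eq_zero (by omega))
      (h1'.good_of_created_eq_zero (by omega)) (h2'.good_of_created_eq_zero (by omega))
  by_cases z1 : d + f = 0
  · exact (agree0000 hx hx').eq_of_good (by simp [w0000])
      (h1.good_of_destroyed_eq_zero (by omega)) (h2.good_of_destroyed_eq_zero (by omega))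
      (h1'.good_of_destroyed_eq_zero (by omega)) (h2'.good_of_destroyed_eq_zero (by omega))
  exact eq_of_mergingDeletion hR hx hx' (h1.mild_of_destroyed (by omega)) (h2.mergingDeletion (by omega))
    (h1'.mild_of_destroyed (by omega)) (h2'.mergingDeletion (by omega))

theorem eq_of_mixed_steps (hR : D.HR = runMatrix s) {x x' y : List Bool}
    (hx : x ∈ D.code p) (hx' : x' ∈ D.code p)
    (h : ∃ x₁ c d e f, Step false x x₁ c d ∧ Step true x₁ y e f)
    (k : ∃ x₁ c d e f, Step true x x₁ c d ∧ Step false x₁ y e f)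
    (h' : ∃ x₁ c d e f, Step false x' x₁ c d ∧ Step true x₁ y e f)
    (k' : ∃ x₁ c d e f, Step true x' x₁ c d ∧ Step false x₁ y e f) : x = x' := by
  have m0 := modEq_w0000 hx hx'
  have m1 := modEq_w1111 hx hx'
  unfold w0000 at m0
  unfold w1111 at m1
  obtain ⟨x₁, c, d, e, f, h1, h2⟩ := h
  obtain ⟨x₁', c', d', e', f', h1', h2'⟩ := h'
  obtain ⟨a1, a2, a3, a4, a5⟩ := h1.bounds
  obtain ⟨b1, b2, b3, b4, b5⟩ := h2.bounds
  obtain ⟨a1', a2', a3', a4', a5'⟩ := h1'.bounds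
  obtain ⟨b1', b2', b3', b4', b5'⟩ := h2'.bounds
  simp only [Bool.not_true, Bool.not_false] at a5 b5 a5' b5'
  -- Both sides are at most 4, so the congruence modulo 7 is again an equality.
  have s0 : d + e' = d' + e := by omega
  have s1 : c + f' = c' + f := by omega
  by_cases z0 : d = 0 ∧ e = 0 ∧ d' = 0 ∧ e' = 0
  · obtain ⟨i1, i2, i3, i4⟩ := z0
    exact (agree0000 hx hx').eq_of_good (by simp [w0000])
      (h1.good_of_destroyed_eq_zero i1) (h2.good_of_created_eq_zero i2)
      (h1'.good_of_destroyed_eq_zero i3) (h2'.good_of_created_eq_zero i4)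
  by_cases z1 : c = 0 ∧ f = 0 ∧ c' = 0 ∧ f' = 0
  · obtain ⟨i1, i2, i3, i4⟩ := z1
    exact (agree1111 hx hx').eq_of_good (by simp [w1111])
      (h1.good_of_created_eq_zero i1) (h2.good_of_destroyed_eq_zero i2)
      (h1'.good_of_created_eq_zero i3) (h2'.good_of_destroyed_eq_zero i4)
  by_cases z2 : d ≠ 0 ∧ f ≠ 0 ∧ d' ≠ 0 ∧ f' ≠ 0
  · obtain ⟨i1, i2, i3, i4⟩ := z2
    exact eq_of_longRunDeletion hR hx hx' (h1.mild_of_destroyed i1) (h2.longRunDeletion i2)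
      (h1'.mild_of_destroyed i3) (h2'.longRunDeletion i4)
  by_cases z3 : d ≠ 0 ∧ e ≠ 0 ∧ c' ≠ 0 ∧ f' ≠ 0
  · obtain ⟨i1, i2, i3, i4⟩ := z3
    exact eq_of_mild_of_merging hx hx' (h1.mild_of_destroyed i1) (h2.mild_of_created i2)
      (h1'.mergingDeletion i3) (h2'.longRunDeletion i4)
  by_cases z4 : d' ≠ 0 ∧ e' ≠ 0 ∧ c ≠ 0 ∧ f ≠ 0
  · obtain ⟨i1, i2, i3, i4⟩ := z4
    exact (eq_of_mild_of_merging hx' hx (h1'.mild_of_destroyed i1) (h2'.mild_of_created i2)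
      (h1.mergingDeletion i3) (h2.longRunDeletion i4)).symm
  -- What remains is that both words create `0000` and `1111` and destroy neither. With the zero
  -- deleted first no step is mild by construction, so the other order is taken.
  have q : e ≠ 0 ∧ d = 0 ∧ c ≠ 0 ∧ f = 0 := by
    clear m0 m1 a4 a5 b4 b5 a4' a5' b4' b5'
    omega
  clear z0 z1 z2 z3 z4 m0 m1
  obtain ⟨x₂, c₂, d₂, e₂, f₂, k1, k2⟩ := k
  obtain ⟨x₂', c₂', d₂', e₂', f₂', k1', k2'⟩ := k'
  obtain ⟨u1, u2, u3, u4, u5⟩ := k1.bounds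
  obtain ⟨v1, v2, v3, v4, v5⟩ := k2.bounds
  obtain ⟨u1', u2', u3', u4', u5'⟩ := k1'.bounds
  obtain ⟨v1', v2', v3', v4', v5'⟩ := k2'.bounds
  simp only [Bool.not_true, Bool.not_false] at u5 v5 u5' v5'
  -- The net changes do not depend on the order, so the deletion of the one still creates `0000` and
  -- that of the zero still creates `1111`.
  have t0 : c₂ = e + f₂ := by omega
  have t0' : c₂' = e + f₂' := by omega
  have t1 : e₂ = c + d₂ := by omega
  have t1' : e₂' = c + d₂' := by omega
  exact eq_of_mergingDeletion hR hx hx' (k1.mild_of_created (by rw [t0]; simp [q.1]))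
    (k2.mergingDeletion (by rw [t1]; simp [q.2.2.1]))
    (k1'.mild_of_created (by rw [t0']; simp [q.1])) (k2'.mergingDeletion (by rw [t1']; simp [q.2.2.1]))

theorem correctsTwoDeletions (hR : D.HR = runMatrix s) (p : D.Params) :
    CorrectsTwoDeletions (D.code p) := by
  intro x hx x' hx' y hy hy'
  obtain ⟨A, a, B, b, E, e, ey⟩ := exists_of_mem_deletionBall hy
  obtain ⟨A', a', B', b', E', e', ey'⟩ := exists_of_mem_deletionBall hy'
  have n0 : numOcc [true] x % 7 = numOcc [true] x' % 7 := modEq_of_code hx.2.2.1 hx'.2.2.1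
  rw [numOcc_singleton, numOcc_singleton] at n0
  have cx : x.count true = y.count true + a.toNat + b.toNat := by
    rw [e, ey]; cases a <;> cases b <;> simp <;> omega
  have cx' : x'.count true = y.count true + a'.toNat + b'.toNat := by
    rw [e', ey']; cases a' <;> cases b' <;> simp <;> omega
  rw [cx, cx'] at n0
  have mixed : ∀ {x A B E a b}, x = A ++ a :: (B ++ b :: E) → y = A ++ (B ++ E) → a ≠ b →
      (∃ x₁ c d e f, Step false x x₁ c d ∧ Step true x₁ y e f) ∧
      (∃ x₁ c d e f, Step true x x₁ c d ∧ Step false x₁ y e f) := by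
    intro x A B E a b e ey hab
    obtain rfl : b = !a := by cases a <;> cases b <;> simp_all
    rw [e, ey]
    exact exists_mixed_steps A B E a
  by_cases hab : a = b
  · subst hab
    have : a' = a ∧ b' = a := by
      cases a <;> cases a' <;> cases b' <;> simp at n0 ⊢ <;> omega
    obtain ⟨rfl, rfl⟩ := this
    cases b'
    · obtain ⟨x₁, c, d, f, g, h1, h2, ho⟩ := exists_false_steps A B E
      obtain ⟨x₁', c', d', f', g', h1', h2', ho'⟩ := exists_false_steps A' B' E'
      rw [← e] at h1
      rw [← ey] at h2
      rw [← e'] at h1'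
      rw [← ey'] at h2'
      exact eq_of_false_steps hR hx hx' h1 h2 h1' h2' ho ho'
    · obtain ⟨x₁, c, d, f, g, h1, h2, ho⟩ := exists_true_steps A B E
      obtain ⟨x₁', c', d', f', g', h1', h2', ho'⟩ := exists_true_steps A' B' E'
      rw [← e] at h1
      rw [← ey] at h2
      rw [← e'] at h1'
      rw [← ey'] at h2'
      exact eq_of_true_steps hR hx hx' h1 h2 h1' h2' ho ho'
  · have hab' : a' ≠ b' := by
      rintro rfl
      cases a <;> cases b <;> cases a' <;> simp at n0 hab <;> omega
    obtain ⟨h, k⟩ := mixed e ey hab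
    obtain ⟨h', k'⟩ := mixed e' ey' hab'
    exact eq_of_mixed_steps hR hx hx' h k h' k'

end Ingredients

/-! ### The matrix of the run hash, and averaging over the parameters -/

theorem runMatrix_isParityCheck (s : ℕ) : IsParityCheck 3 (runMatrix s) := by
  intro v hv hne
  by_contra hlt
  have h0 : ∑ j, v j = 0 := by
    simpa [runMatrix, Matrix.mulVec, dotProduct] using congrFun hv 0
  have h1 : ∑ j : Fin s, (((j : ℕ) : ZMod (nextPrime s)) + 1) * v j = 0 := by
    simpa [runMatrix, Matrix.mulVec, dotProduct] using congrFun hv 1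
  obtain ⟨i, hi⟩ := Function.ne_iff.1 hne
  -- Subtracting a multiple of the first row removes the entry at `i`. At most one further entry is
  -- left, with the nonzero factor `j - i`.
  have h2 : ∑ j : Fin s, (((j : ℕ) : ZMod (nextPrime s)) - (i : ℕ)) * v j = 0 := by
    have : ∀ j : Fin s, (((j : ℕ) : ZMod (nextPrime s)) - (i : ℕ)) * v j =
        (((j : ℕ) : ZMod (nextPrime s)) + 1) * v j - ((i : ℕ) + 1) * v j := fun j => by ring
    rw [Finset.sum_congr rfl fun j _ => this j, Finset.sum_sub_distrib, h1, ← Finset.mul_sum, h0]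
    ring
  have hcard : ((Finset.univ.filter fun j => v j ≠ 0).erase i).card ≤ 1 := by
    have : i ∈ Finset.univ.filter fun j => v j ≠ 0 := by simpa using hi
    rw [Finset.card_erase_of_mem this]
    unfold hammingNorm at hlt
    omega
  have hz : ∀ j, j ≠ i → v j = 0 := by
    intro j hj
    by_contra hvj
    have huniq : ∀ k, k ≠ i → k ≠ j → v k = 0 := by
      intro k hk hkj
      by_contra hvk
      exact hkj (Finset.card_le_one.1 hcard k (by simp [hk, hvk]) j (by simp [hj, hvj]))
    rw [Finset.sum_eq_single j] at h2
    · rcases mul_eq_zero.1 h2 with h | h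
      · rw [sub_eq_zero] at h
        have hjs := lt_nextPrime s
        have := (ZMod.natCast_eq_natCast_iff' _ _ _).1 h
        rw [Nat.mod_eq_of_lt (j.2.trans hjs), Nat.mod_eq_of_lt (i.2.trans hjs)] at this
        exact hj (Fin.ext this)
      · exact hvj h
    · intro k _ hk
      by_cases hki : k = i
      · rw [hki]; ring
      · rw [huniq k hki hk, mul_zero]
    · simp
  rw [Finset.sum_eq_single i (fun j _ hj => hz j hj) (by simp)] at h0
  exact hi h0

theorem CT2_finite (n s : ℕ) : (CT2 n s).Finite :=
  (List.finite_length_eq Bool n).subset fun _ hx => hx.1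

namespace Ingredients

variable {n s C : ℕ} (D : Ingredients n s C)

theorem code_finite (p : D.Params) : (D.code p).Finite :=
  (CT2_finite n s).subset fun _ hx => hx.1

/-- Some code contains at least the average number of words. -/
theorem exists_code_ncard_ge : ∃ p : D.Params, ((CT2 n s).ncard : ℝ) /
    (7 ^ 6 * (q₁ D.h s : ℝ) ^ (3 * D.r₁) * (q₂ D.HR : ℝ) ^ (1 + N₂ n D.HR) * (s + 1))
      ≤ ((D.code p).ncard : ℝ) := by
  classical
  have hN : N₂ n D.HR ≠ 0 := (exists_N₂ n D.HR).1.ne'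
  have := Fintype.ofFinite (GaloisField (q₂ D.HR) (N₂ n D.HR))
  let T := (Fin D.r₁ → ZMod (q₁ D.h s)) × (Fin D.r₁ → ZMod (q₁ D.h s)) ×
    (Fin D.r₁ → ZMod (q₁ D.h s)) × D.BCHSyndrome × (Fin 6 → ZMod 7) × ZMod (s + 1)
  -- Each word is mapped to the parameters of the code that contains it; a fibre of at least average
  -- size is the required code.
  let f : List Bool → T := fun x =>
    (D.H₁.mulVec (padded _ (D.F x w0000)), D.H₁.mulVec (padded _ (D.F x w1111)),
      D.H₁.mulVec (padded _ (D.F x w110011)),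
      (∑ i, padded (q₂ D.HR ^ N₂ n D.HR - 1) (D.FR x w11011) i,
        ∑ i, algebraMap (ZMod (q₂ D.HR)) (GaloisField (q₂ D.HR) (N₂ n D.HR))
          (padded (q₂ D.HR ^ N₂ n D.HR - 1) (D.FR x w11011) i) * D.α ^ (i : ℕ)),
      ![(numOcc [false] x : ZMod 7), (numOcc [true] x : ZMod 7), (numOcc w0000 x : ZMod 7),
        (numOcc w1111 x : ZMod 7), (numOcc w110011 x : ZMod 7), (numOcc w11011 x : ZMod 7)],
      (oddRunSum x : ZMod (s + 1)))
  have hT : (Fintype.card T : ℝ) = 7 ^ 6 * (q₁ D.h s : ℝ) ^ (3 * D.r₁) *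
      (q₂ D.HR : ℝ) ^ (1 + N₂ n D.HR) * (s + 1) := by
    have hG : Fintype.card (GaloisField (q₂ D.HR) (N₂ n D.HR)) = q₂ D.HR ^ N₂ n D.HR := by
      rw [← Nat.card_eq_fintype_card]
      exact GaloisField.card _ _ hN
    simp only [T, Fintype.card_prod, Fintype.card_fun, ZMod.card, Fintype.card_fin, hG]
    push_cast
    ring
  have hpos : (0 : ℝ) < Fintype.card T := by
    exact_mod_cast Fintype.card_pos_iff.2 ⟨f []⟩
  rw [← hT]
  obtain ⟨t, -, ht⟩ := Finset.exists_le_card_fiber_of_nsmul_le_card_of_maps_to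
    (s := (CT2_finite n s).toFinset) (t := (Finset.univ : Finset T)) (f := f)
    (b := ((CT2 n s).ncard : ℝ) / Fintype.card T) (fun _ _ => Finset.mem_univ _)
    ⟨f [], Finset.mem_univ _⟩ (by
      rw [Finset.card_univ, nsmul_eq_mul, mul_div_cancel₀ _ hpos.ne',
        Set.ncard_eq_toFinset_card _ (CT2_finite n s)])
  refine ⟨⟨t.1, t.2.1, t.2.2.1, t.2.2.2.1, t.2.2.2.2.1, t.2.2.2.2.2⟩, ht.trans ?_⟩
  rw [Nat.cast_le, ← Set.ncard_coe_finset]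
  refine Set.ncard_le_ncard ?_ (D.code_finite _)
  intro x hx
  simp only [Finset.coe_filter, Set.Finite.mem_toFinset, Set.mem_ofPred_eq] at hx
  obtain ⟨hx, rfl⟩ := hx
  exact ⟨hx, rfl, rfl, rfl, rfl, rfl, rfl, rfl, rfl, rfl, ⟨rfl, rfl⟩, rfl⟩

end Ingredients

/-! ### The size of the constrained set -/

/-- By induction from the right end: a new occurrence in the first chunk would start at the new
symbol, and exactly there the word is cut. So a later chunk contains no occurrence once its first
symbol is removed. -/
theorem not_infix_of_chunks {w : List Bool} (hw : w ≠ []) (x : List Bool) :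
    ∃ p P, chunks w x = p :: P ∧ ¬ w <:+: p ∧ ∀ c ∈ P, ¬ w <:+: c.drop w.length := by
  induction x with
  | nil => exact ⟨[], [], rfl, by simpa using hw, by simp⟩
  | cons a x ih =>
    obtain ⟨p, P, hc, hp, hP⟩ := ih
    by_cases h : w.isPrefixOf (a :: x) = true
    · refine ⟨[], _, chunks_cons_of_prefix h hc, by simpa using hw, ?_⟩
      intro c hc
      rcases List.mem_cons.1 hc with rfl | hc
      · intro hi
        obtain ⟨b, w, rfl⟩ := List.exists_cons_of_ne_nil hw
        exact hp (hi.trans (by simpa using (List.drop_suffix _ p).isInfix))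
      · exact hP c hc
    · refine ⟨_, _, chunks_cons_of_not_prefix (by rwa [Bool.not_eq_true] at h) hc, ?_, hP⟩
      rw [List.infix_cons_iff]
      rintro (hi | hi)
      · refine h (List.isPrefixOf_iff_prefix.2 (hi.trans ?_))
        have := flatten_chunks w x
        rw [hc] at this
        exact ⟨P.flatten, by simpa using this⟩
      · exact hp hi

theorem infix_flatten {α : Type*} {l : List α} {L : List (List α)} (h : l ∈ L) : l <:+: L.flatten := by
  obtain ⟨S, T, rfl⟩ := List.append_of_mem h
  exact ⟨S.flatten, T.flatten, by simp⟩

theorem pieces_infix {w x u : List Bool} (hw : w ≠ []) (hu : u ∈ pieces w x) :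
    u <:+: x ∧ ¬ w <:+: u := by
  obtain ⟨p, P, hc, hp, hP⟩ := not_infix_of_chunks hw x
  have hf := flatten_chunks w x
  rw [pieces_eq_dropHeads _ _ hw, hc] at hu
  have hu : u = p ∨ ∃ c ∈ P, c.drop w.length = u := by simpa [dropHeads] using hu
  rcases hu with rfl | ⟨c, hcP, rfl⟩
  · refine ⟨?_, hp⟩
    rw [← hf, hc]
    exact infix_flatten (by simp)
  · refine ⟨(List.drop_suffix _ _).isInfix.trans ?_, hP c hcP⟩
    rw [← hf, hc]
    exact infix_flatten (by simp [hcP])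

theorem foldr_max_le_iff (l : List ℕ) (s : ℕ) : l.foldr max 0 ≤ s ↔ ∀ k ∈ l, k ≤ s := by
  induction l with
  | nil => simp
  | cons a l ih => simp [ih]

theorem maxGap_le_iff {w x : List Bool} {s : ℕ} : maxGap w x ≤ s ↔ ∀ u ∈ pieces w x, u.length ≤ s := by
  simp [maxGap, foldr_max_le_iff]

theorem maxRun_le_iff {x : List Bool} {s : ℕ} : maxRun x ≤ s ↔ ∀ u ∈ runs x, u.length ≤ s := by
  simp [maxRun, foldr_max_le_iff]

theorem runs_infix {x u : List Bool} (hu : u ∈ runs x) :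
    u <:+: x ∧ (¬ w0000 <:+: u ∨ ¬ w1111 <:+: u) := by
  constructor
  · have := infix_flatten hu
    rwa [flatten_runs] at this
  · by_contra h
    push Not at h
    have h1 : false ∈ u := h.1.mem (by simp [w0000])
    have h2 : true ∈ u := h.2.mem (by simp [w1111])
    have hc := List.isChain_of_mem_splitBy hu
    have hc : u.IsChain (· = ·) := hc.imp fun a b hab => by simpa using hab
    have := List.Pairwise.forall_of_forall (R := (· = ·)) (fun _ _ => rfl)
      (List.isChain_iff_pairwise.1 hc) h1 h2
    exact absurd this (by simp)

theorem mem_CT2_of_length_le {n s : ℕ} (h : n ≤ s) {x : List Bool} (hx : x.length = n) : x ∈ CT2 n s := by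
  have hp : ∀ w, w ≠ [] → maxGap w x ≤ s := fun w hw => maxGap_le_iff.2 fun u hu =>
    ((pieces_infix hw hu).1.length_le.trans hx.le).trans h
  exact ⟨hx, hp _ (by simp [w0000]), hp _ (by simp [w1111]), hp _ (by simp [w110011]),
    hp _ (by simp [w11011]), maxRun_le_iff.2 fun u hu => ((runs_infix hu).1.length_le.trans hx.le).trans h⟩

/-- The words of length `n`. -/
noncomputable def words (n : ℕ) : Finset (List Bool) := (List.finite_length_eq Bool n).toFinset

theorem mem_words {n : ℕ} {x : List Bool} : x ∈ words n ↔ x.length = n := by simp [words]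

theorem card_words (n : ℕ) : (words n).card = 2 ^ n := by
  have : Fintype {x : List Bool // x.length = n} := inferInstanceAs (Fintype (List.Vector Bool n))
  rw [← Fintype.card_of_subtype (p := fun x : List Bool => x.length = n) (words n) fun x => mem_words]
  rw [← Nat.card_eq_fintype_card]
  exact (Nat.card_eq_fintype_card (α := List.Vector Bool n)).trans (card_vector n)

/-- The words of length `s` in which `w` does not occur. -/
noncomputable def avoiding (w : List Bool) (s : ℕ) : Finset (List Bool) :=
  (words s).filter fun u => ¬ w <:+: u

/-- Behind `r` free symbols come `t` blocks of six, and each block misses at least one of the 64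
words, namely `w` filled up with ones. -/
theorem card_avoiding_le {w : List Bool} (hw : w.length ≤ 6) (t : ℕ) {r : ℕ} :
    (avoiding w (r + 6 * t)).card ≤ 2 ^ r * 63 ^ t := by
  induction t with
  | zero =>
    refine (Finset.card_filter_le _ _).trans ?_
    simp [card_words]
  | succ t ih =>
    have h6 : (avoiding w 6).card ≤ 63 := by
      have : avoiding w 6 ⊆ (words 6).erase (w ++ List.replicate (6 - w.length) true) := by
        intro u hu
        unfold avoiding at hu
        rw [Finset.mem_filter] at hu
        refine Finset.mem_erase.2 ⟨?_, hu.1⟩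
        rintro rfl
        exact hu.2 (List.prefix_append _ _).isInfix
      refine (Finset.card_le_card this).trans ?_
      rw [Finset.card_erase_of_mem (by simp [mem_words]; omega), card_words]
      norm_num
    have hsub : avoiding w (r + 6 * (t + 1)) ⊆
        Finset.image₂ (· ++ ·) (avoiding w (r + 6 * t)) (avoiding w 6) := by
      intro u hu
      unfold avoiding at hu
      rw [Finset.mem_filter, mem_words] at hu
      refine Finset.mem_image₂.2 ⟨u.take (r + 6 * t), ?_, u.drop (r + 6 * t), ?_, List.take_append_drop _ _⟩
      · refine Finset.mem_filter.2 ⟨mem_words.2 (by simp; omega), fun h => hu.2 ?_⟩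
        exact h.trans (List.take_prefix _ _).isInfix
      · refine Finset.mem_filter.2 ⟨mem_words.2 (by simp; omega), fun h => hu.2 ?_⟩
        exact h.trans (List.drop_suffix _ _).isInfix
    calc _ ≤ _ := Finset.card_le_card hsub
      _ ≤ _ := Finset.card_image₂_le _ _ _
      _ ≤ 2 ^ r * 63 ^ t * 63 := Nat.mul_le_mul ih h6
      _ = _ := by ring

open Classical in
/-- The words of length `n` with a substring of length `s` in which `w` does not occur. -/
noncomputable def avoidingSomewhere (w : List Bool) (n s : ℕ) : Finset (List Bool) :=
  (words n).filter fun x => ∃ u, u <:+: x ∧ u.length = s ∧ ¬ w <:+: u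

theorem mem_avoidingSomewhere {w x : List Bool} {n s : ℕ} : x ∈ avoidingSomewhere w n s ↔
    x.length = n ∧ ∃ u, u <:+: x ∧ u.length = s ∧ ¬ w <:+: u := by
  classical
  simp [avoidingSomewhere, mem_words]

theorem card_avoidingSomewhere_le (w : List Bool) {n s : ℕ} (hs : 1 ≤ s) (hn : s ≤ n) :
    (avoidingSomewhere w n s).card ≤ n * (2 ^ (n - s) * (avoiding w s).card) := by
  have hsub : avoidingSomewhere w n s ⊆ (Finset.range (n - s + 1)).biUnion fun i =>
      (words i ×ˢ (avoiding w s ×ˢ words (n - s - i))).image fun t => t.1 ++ t.2.1 ++ t.2.2 := by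
    intro x hx
    rw [mem_avoidingSomewhere] at hx
    obtain ⟨hx, u, ⟨a, b, rfl⟩, hu, huw⟩ := hx
    simp only [List.length_append] at hx
    rw [Finset.mem_biUnion]
    refine ⟨a.length, Finset.mem_range.2 (by omega), Finset.mem_image.2
      ⟨(a, u, b), ?_, rfl⟩⟩
    simp only [Finset.mem_product, avoiding, Finset.mem_filter, mem_words]
    exact ⟨trivial, ⟨hu, huw⟩, by omega⟩
  refine (Finset.card_le_card hsub).trans ((Finset.card_biUnion_le_card_mul _ _
    (2 ^ (n - s) * (avoiding w s).card) fun i hi => ?_).trans ?_)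
  · refine Finset.card_image_le.trans (le_of_eq ?_)
    rw [Finset.card_product, Finset.card_product, card_words, card_words,
      show n - s = i + (n - s - i) by have := Finset.mem_range.1 hi; omega, pow_add]
    simp only [Nat.add_sub_cancel_left]
    ring
  · rw [Finset.card_range]
    exact Nat.mul_le_mul_right _ (by omega)

theorem compl_CT2_subset (n s : ℕ) : words n \ (CT2_finite n s).toFinset ⊆
    avoidingSomewhere w0000 n s ∪ avoidingSomewhere w1111 n s ∪ avoidingSomewhere w110011 n s ∪
      avoidingSomewhere w11011 n s := by
  intro x hx
  simp only [Finset.mem_sdiff, Set.Finite.mem_toFinset, mem_words] at hx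
  obtain ⟨hx, hn⟩ := hx
  have key : ∀ w u, u <:+: x → ¬ w <:+: u → s < u.length → x ∈ avoidingSomewhere w n s := by
    intro w u hu hw hs
    have ht := (List.take_prefix s u).isInfix
    exact mem_avoidingSomewhere.2 ⟨hx, u.take s, ht.trans hu, by simp; omega,
      fun h => hw (h.trans ht)⟩
  have gap : ∀ w, w ≠ [] → ¬ maxGap w x ≤ s → x ∈ avoidingSomewhere w n s := by
    intro w hw h
    rw [maxGap_le_iff] at h
    push Not at h
    obtain ⟨u, hu, hs⟩ := h
    exact key w u (pieces_infix hw hu).1 (pieces_infix hw hu).2 hs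
  simp only [Finset.mem_union]
  by_contra hcon
  push Not at hcon
  obtain ⟨⟨⟨c1, c2⟩, c3⟩, c4⟩ := hcon
  refine hn ⟨hx, ?_, ?_, ?_, ?_, ?_⟩
  · by_contra h; exact c1 (gap _ (by simp [w0000]) h)
  · by_contra h; exact c2 (gap _ (by simp [w1111]) h)
  · by_contra h; exact c3 (gap _ (by simp [w110011]) h)
  · by_contra h; exact c4 (gap _ (by simp [w11011]) h)
  · refine maxRun_le_iff.2 fun u hu => ?_
    by_contra h
    push Not at h
    rcases (runs_infix hu).2 with h' | h'
    · exact c1 (key _ u (runs_infix hu).1 h' h)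
    · exact c2 (key _ u (runs_infix hu).1 h' h)

/-- Every 45 blocks gain a factor of two, because `2 * 63 ^ 45 ≤ 64 ^ 45`. -/
theorem two_pow_mul_le (t : ℕ) : 63 ^ t * 2 ^ (t / 45) ≤ 64 ^ t := by
  conv_lhs => rw [← Nat.div_add_mod t 45]
  conv_rhs => rw [← Nat.div_add_mod t 45]
  have h : (63 ^ 45 * 2) ^ (t / 45) ≤ (64 ^ 45) ^ (t / 45) := Nat.pow_le_pow_left (by norm_num) _
  have h' : 63 ^ (t % 45) ≤ 64 ^ (t % 45) := Nat.pow_le_pow_left (by norm_num) _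
  rw [show (45 * (t / 45) + t % 45) / 45 = t / 45 by omega]
  calc 63 ^ (45 * (t / 45) + t % 45) * 2 ^ (t / 45)
      = (63 ^ 45 * 2) ^ (t / 45) * 63 ^ (t % 45) := by rw [pow_add, pow_mul, mul_pow]; ring
    _ ≤ (64 ^ 45) ^ (t / 45) * 64 ^ (t % 45) := Nat.mul_le_mul h h'
    _ = _ := by rw [pow_add, pow_mul]

/-- Each of the four words accounts for at most an eighth of all words, so at least half remain. A
run that is too long avoids `0000` or `1111` and needs no separate estimate. -/
theorem two_pow_le_ncard_CT2 {n s : ℕ} (hn : 2 ≤ n) (hs : 1065 * Real.logb 2 n ≤ s) :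
    2 ^ n ≤ 2 * (CT2 n s).ncard := by
  rw [Set.ncard_eq_toFinset_card _ (CT2_finite n s)]
  rcases le_or_gt n s with h | h
  · have : words n ⊆ (CT2_finite n s).toFinset := fun x hx => by
      simpa using mem_CT2_of_length_le h (mem_words.1 hx)
    have := Finset.card_le_card this
    rw [card_words] at this
    omega
  · have hl1 : 1 ≤ Real.logb 2 n := by
      rw [Real.le_logb_iff_rpow_le (by norm_num) (by positivity)]
      simpa using hn
    have hs1 : 1065 ≤ s := by
      have : (1065 : ℝ) ≤ s := by linarith
      exact_mod_cast this
    -- Here `n > s ≥ 1065`.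
    have hl10 : 10 ≤ Real.logb 2 n := by
      rw [Real.le_logb_iff_rpow_le (by norm_num) (by positivity)]
      have : (1024 : ℝ) ≤ n := by exact_mod_cast (by omega : 1024 ≤ n)
      norm_num1
      exact this
    -- A factor of two costs `270 = 6 * 45` symbols of the window. The factor `8 n` pays for the
    -- positions of the window and the share of one eighth.
    have hk : 8 * n ≤ 2 ^ (s / 270) := by
      have h1 : (s : ℝ) ≤ 270 * ((s / 270 : ℕ) : ℝ) + 269 := by
        exact_mod_cast (by omega : s ≤ 270 * (s / 270) + 269)
      have h2 : Real.logb 2 (8 * n) ≤ (s / 270 : ℕ) := by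
        have h8 : Real.logb 2 8 = 3 := by
          rw [show (8 : ℝ) = 2 ^ (3 : ℝ) by norm_num]
          exact Real.logb_rpow (by norm_num) (by norm_num)
        rw [Real.logb_mul (by norm_num) (by positivity), h8]
        linarith
      rw [Real.logb_le_iff_le_rpow (by norm_num) (by positivity), Real.rpow_natCast] at h2
      exact_mod_cast h2
    set t := s / 6
    have hst : s = s % 6 + 6 * t := by omega
    have hpow : 8 * n * (2 ^ (s % 6) * 63 ^ t) ≤ 2 ^ s := by
      have h3 := two_pow_mul_le t
      rw [show t / 45 = s / 270 by omega] at h3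
      calc 8 * n * (2 ^ (s % 6) * 63 ^ t) ≤ 2 ^ (s / 270) * (2 ^ (s % 6) * 63 ^ t) :=
            Nat.mul_le_mul_right _ hk
        _ = 2 ^ (s % 6) * (63 ^ t * 2 ^ (s / 270)) := by ring
        _ ≤ 2 ^ (s % 6) * 64 ^ t := Nat.mul_le_mul_left _ h3
        _ = 2 ^ s := by
          conv_rhs => rw [hst, pow_add, pow_mul]
          rfl
    have hw : ∀ w : List Bool, w.length ≤ 6 → 8 * (avoidingSomewhere w n s).card ≤ 2 ^ n := by
      intro w hw
      have h4 := card_avoiding_le hw t (r := s % 6)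
      rw [← hst] at h4
      calc 8 * (avoidingSomewhere w n s).card ≤ 8 * (n * (2 ^ (n - s) * (2 ^ (s % 6) * 63 ^ t))) :=
            Nat.mul_le_mul_left _ ((card_avoidingSomewhere_le w (by omega) h.le).trans (by gcongr))
        _ = 2 ^ (n - s) * (8 * n * (2 ^ (s % 6) * 63 ^ t)) := by ring
        _ ≤ 2 ^ (n - s) * 2 ^ s := Nat.mul_le_mul_left _ hpow
        _ = 2 ^ n := by rw [← pow_add]; congr 1; omega
    have b1 := hw w0000 (by simp [w0000])
    have b2 := hw w1111 (by simp [w1111])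
    have b3 := hw w110011 (by simp [w110011])
    have b4 := hw w11011 (by simp [w11011])
    have hc := (Finset.card_le_card (compl_CT2_subset n s)).trans ((Finset.card_union_le _ _).trans
      (Nat.add_le_add_right ((Finset.card_union_le _ _).trans
        (Nat.add_le_add_right (Finset.card_union_le _ _) _)) _))
    have hd := Finset.le_card_sdiff (CT2_finite n s).toFinset (words n)
    rw [card_words] at hd
    omega

theorem CT2_large : ∃ K : ℝ, ∀ n s : ℕ, 2 ≤ n → 1065 * Real.logb 2 n ≤ s →
    (CT2 n s).Nonempty ∧ (n : ℝ) - K ≤ Real.logb 2 (CT2 n s).ncard := by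
  refine ⟨1, fun n s hn hs => ?_⟩
  have h := two_pow_le_ncard_CT2 hn hs
  have hpos : 0 < (CT2 n s).ncard := by
    have := Nat.two_pow_pos n
    omega
  refine ⟨(Set.ncard_pos (CT2_finite n s)).1 hpos, ?_⟩
  rw [Real.le_logb_iff_rpow_le (by norm_num) (by exact_mod_cast hpos), Real.rpow_sub (by norm_num),
    Real.rpow_natCast, Real.rpow_one, div_le_iff₀ (by norm_num), mul_comm]
  exact_mod_cast h

/-! ### The redundancy for `s = ⌈1065 log₂ n⌉` -/

theorem nextPrime_le {m : ℕ} (hm : m ≠ 0) : nextPrime m ≤ 2 * m := by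
  obtain ⟨p, hp, h1, h2⟩ := Nat.exists_prime_lt_and_le_two_mul m hm
  have : nextPrime m ≤ p := Nat.sInf_le ⟨hp, h1⟩
  exact this.trans h2

theorem nextOddPrime_le (m : ℕ) : nextOddPrime m ≤ 2 * m + 4 := by
  obtain ⟨p, hp, h1, h2⟩ := Nat.exists_prime_lt_and_le_two_mul (m + 2) (by omega)
  have : nextOddPrime m ≤ p := Nat.sInf_le ⟨hp, hp.odd_of_ne_two (by omega), by omega⟩
  omega

theorem hashImage_finite (h : List Bool → ℕ) (s : ℕ) : (hashImage h s).Finite :=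
  (List.finite_length_le Bool s).image _

/-- Length `m ≥ 1` contributes at most `C * m ^ 4` pairs, and these bounds sum to at most `C * s ^
5`; the summand 1 is the empty word. -/
theorem IsTwoDeletionHash.ncard_hashImage_le {C : ℕ} {h : List Bool → ℕ} (hh : IsTwoDeletionHash C h)
    (s : ℕ) : (hashImage h s).ncard ≤ 1 + C * s ^ 5 := by
  induction s with
  | zero =>
    have : hashImage h 0 = {pieceHash h []} := by
      unfold hashImage
      rw [show {u : List Bool | u.length ≤ 0} = {[]} by ext u; simp]
      simp
    rw [this]
    simp
  | succ s ih =>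
    have hsub : hashImage h (s + 1) ⊆ hashImage h s ∪
        Prod.mk (s + 1) '' (h '' {u | u.length = s + 1}) := by
      rintro _ ⟨u, hu, rfl⟩
      rcases Nat.lt_or_ge s u.length with hl | hl
      · have : u.length = s + 1 := le_antisymm hu hl
        exact Or.inr ⟨h u, ⟨u, this, rfl⟩, by rw [pieceHash, this]⟩
      · exact Or.inl ⟨u, hl, rfl⟩
    have hfin : (h '' {u : List Bool | u.length = s + 1}).Finite :=
      (List.finite_length_eq Bool (s + 1)).image _
    have h1 := Set.ncard_le_ncard hsub ((hashImage_finite h s).union (hfin.image _))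
    have h2 := Set.ncard_union_le (hashImage h s) (Prod.mk (s + 1) '' (h '' {u | u.length = s + 1}))
    have h3 := Set.ncard_image_le (f := Prod.mk (s + 1)) hfin
    have h4 := hh.2 (s + 1) (by omega)
    have h5 : C * s ^ 5 + C * (s + 1) ^ 4 ≤ C * (s + 1) ^ 5 := by
      rw [← mul_add]
      refine Nat.mul_le_mul_left _ ?_
      have : s ^ 4 ≤ (s + 1) ^ 4 := Nat.pow_le_pow_left (by omega) 4
      calc s ^ 5 + (s + 1) ^ 4 = s * s ^ 4 + (s + 1) ^ 4 := by ring
        _ ≤ s * (s + 1) ^ 4 + (s + 1) ^ 4 := by gcongr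
        _ = _ := by ring
    omega

theorem ncard_runImage_le {s : ℕ} (H : Matrix (Fin 2) (Fin s) (ZMod (nextPrime s))) :
    (runImage H).ncard ≤ nextPrime s ^ 2 := by
  have h := Set.ncard_le_ncard (Set.subset_univ (runImage H)) Set.finite_univ
  rwa [Set.ncard_univ, Nat.card_eq_fintype_card, Fintype.card_fun, ZMod.card, Fintype.card_fin] at h

theorem runImage_nonempty {s : ℕ} (H : Matrix (Fin 2) (Fin s) (ZMod (nextPrime s))) :
    (runImage H).Nonempty := ⟨_, [], by simp, rfl⟩

theorem q₁_pow_le {n : ℕ} (hn : 1 ≤ n) (h : List Bool → ℕ) (s : ℕ) :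
    2 ≤ N₁ n h s ∧ q₁ h s ^ (N₁ n h s - 2) ≤ n := by
  obtain ⟨h0, h1⟩ := exists_N₁ n h s
  have h2 : 2 ≤ N₁ n h s := by
    by_contra hlt
    rw [show N₁ n h s - 1 = 0 by omega] at h1
    simp at h1
    omega
  refine ⟨h2, ?_⟩
  by_contra hlt
  have := Nat.sInf_le (s := {N | 0 < N ∧ n < q₁ h s ^ (N - 1)}) (m := N₁ n h s - 1)
    ⟨by omega, by rw [Nat.sub_sub]; exact not_le.1 hlt⟩
  change N₁ n h s ≤ _ at this
  omega

theorem q₂_pow_le {n s : ℕ} (H : Matrix (Fin 2) (Fin s) (ZMod (nextPrime s))) :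
    q₂ H ^ (N₂ n H - 1) ≤ n + 1 := by
  obtain ⟨h0, h1⟩ := exists_N₂ n H
  by_contra hlt
  push Not at hlt
  rcases Nat.lt_or_ge 1 (N₂ n H) with h | h
  · have := Nat.sInf_le (s := {N | 0 < N ∧ n < q₂ H ^ N - 1}) (m := N₂ n H - 1)
      ⟨by omega, by omega⟩
    change N₂ n H ≤ _ at this
    omega
  · rw [show N₂ n H - 1 = 0 by omega] at hlt
    simp at hlt

theorem two_le_logb {n : ℕ} (hn : 4 ≤ n) : 2 ≤ Real.logb 2 n := by
  rw [Real.le_logb_iff_rpow_le (by norm_num) (by positivity)]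
  have : (4 : ℝ) ≤ n := by exact_mod_cast hn
  norm_num1
  exact this

theorem logb_sOf_le {n : ℕ} (hn : 4 ≤ n) : 1 ≤ sOf n ∧ 1 ≤ Real.logb 2 (Real.logb 2 n) ∧
    Real.logb 2 ((sOf n : ℝ) + 1) ≤ 12 * Real.logb 2 (Real.logb 2 n) := by
  have h2 := two_le_logb hn
  have hs : (sOf n : ℝ) < 1065 * Real.logb 2 n + 1 := Nat.ceil_lt_add_one (by positivity)
  have h1 : 1 ≤ Real.logb 2 (Real.logb 2 n) := by
    rw [Real.le_logb_iff_rpow_le (by norm_num) (by positivity)]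
    simpa using h2
  refine ⟨Nat.ceil_pos.2 (by positivity), h1, ?_⟩
  -- As `log₂ n ≥ 2`, the estimate `1065 log₂ n + 2 ≤ 2 ^ 11 log₂ n` holds. The exponent 11 is then
  -- absorbed by `log₂ log₂ n ≥ 1`.
  have h3 : Real.logb 2 ((sOf n : ℝ) + 1) ≤ Real.logb 2 (2 ^ (11 : ℝ) * Real.logb 2 n) := by
    refine Real.logb_le_logb_of_le (by norm_num) (by positivity) ?_
    norm_num1
    linarith
  rw [Real.logb_mul (by positivity) (by positivity), Real.logb_rpow (by norm_num) (by norm_num)] at h3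
  linarith

/-- Without rounding the bound is `6 N + (N - 1)`, and rounding up adds at most 2. -/
theorem three_mul_r₁_le {N r : ℕ} (hN : 1 ≤ N) (h : r ≤ 2 * N + ⌈((N : ℚ) - 1) / 3⌉₊) :
    3 * r ≤ 7 * N + 1 := by
  obtain ⟨N, rfl⟩ := Nat.exists_eq_add_of_le' hN
  have h1 : ⌈(((N + 1 : ℕ) : ℚ) - 1) / 3⌉₊ ≤ (N + 2) / 3 := by
    rw [Nat.ceil_le]
    have : N ≤ 3 * ((N + 2) / 3) := by omega
    have : (N : ℚ) ≤ 3 * ((N + 2) / 3 : ℕ) := by exact_mod_cast this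
    push_cast at *
    linarith
  omega

theorem logb_pow_le {q k m : ℕ} (hq : 0 < q) (h : q ^ k ≤ m) :
    (k : ℝ) * Real.logb 2 q ≤ Real.logb 2 m := by
  rw [← Real.logb_pow]
  exact Real.logb_le_logb_of_le (by norm_num) (by positivity) (by exact_mod_cast h)

namespace Ingredients

variable {C n : ℕ}

theorem logb_q₁_le (hn : 4 ≤ n) (D : Ingredients n (sOf n) C) :
    Real.logb 2 (q₁ D.h (sOf n)) ≤
      (Real.logb 2 (2 * C + 6) + 60) * Real.logb 2 (Real.logb 2 n) := by
  obtain ⟨h1, h2, h3⟩ := logb_sOf_le hn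
  have h4 : q₁ D.h (sOf n) ≤ (2 * C + 6) * sOf n ^ 5 := by
    have h5 := nextOddPrime_le (hashImage D.h (sOf n)).ncard
    have h6 := D.h_hash.ncard_hashImage_le (sOf n)
    have h7 : 1 ≤ sOf n ^ 5 := Nat.one_le_pow _ _ h1
    calc q₁ D.h (sOf n) ≤ 2 * (1 + C * sOf n ^ 5) + 4 := by unfold q₁; omega
      _ ≤ _ := by linarith
  have h5 : Real.logb 2 (q₁ D.h (sOf n)) ≤ Real.logb 2 ((2 * C + 6) * ((sOf n : ℝ) + 1) ^ 5) := by
    refine Real.logb_le_logb_of_le (by norm_num)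
      (by exact_mod_cast (nextOddPrime_prime _).pos) ?_
    calc (q₁ D.h (sOf n) : ℝ) ≤ (2 * C + 6) * (sOf n : ℝ) ^ 5 := by exact_mod_cast h4
      _ ≤ _ := by gcongr; linarith
  rw [Real.logb_mul (by positivity) (by positivity), Real.logb_pow] at h5
  have h6 : 0 ≤ Real.logb 2 (2 * C + 6) := by
    refine Real.logb_nonneg (by norm_num) ?_
    have : (0 : ℝ) ≤ C := by positivity
    linarith
  push_cast at h5
  nlinarith

theorem logb_q₂_le (hn : 4 ≤ n) (D : Ingredients n (sOf n) C) :
    Real.logb 2 (q₂ D.HR) ≤ 27 * Real.logb 2 (Real.logb 2 n) := by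
  obtain ⟨h1, h2, h3⟩ := logb_sOf_le hn
  have h4 : q₂ D.HR ≤ 8 * sOf n ^ 2 := by
    have h5 := nextPrime_le (m := (runImage D.HR).ncard)
      ((Set.ncard_pos (Set.toFinite _)).2 (runImage_nonempty D.HR)).ne'
    have h6 := ncard_runImage_le D.HR
    have h7 : nextPrime (sOf n) ^ 2 ≤ (2 * sOf n) ^ 2 :=
      Nat.pow_le_pow_left (nextPrime_le (by omega)) 2
    calc q₂ D.HR ≤ 2 * (2 * sOf n) ^ 2 := by unfold q₂; omega
      _ = _ := by ring
  have h5 : Real.logb 2 (q₂ D.HR) ≤ Real.logb 2 (2 ^ (3 : ℝ) * ((sOf n : ℝ) + 1) ^ 2) := by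
    refine Real.logb_le_logb_of_le (by norm_num) (by exact_mod_cast (nextPrime_prime _).pos) ?_
    calc (q₂ D.HR : ℝ) ≤ 8 * (sOf n : ℝ) ^ 2 := by exact_mod_cast h4
      _ = 2 ^ (3 : ℝ) * (sOf n : ℝ) ^ 2 := by norm_num
      _ ≤ _ := by gcongr; linarith
  rw [Real.logb_mul (by positivity) (by positivity), Real.logb_pow,
    Real.logb_rpow (by norm_num) (by norm_num)] at h5
  push_cast at h5
  linarith

theorem logb_index_le (hn : 4 ≤ n) (D : Ingredients n (sOf n) C) :
    Real.logb 2 (7 ^ 6 * (q₁ D.h (sOf n) : ℝ) ^ (3 * D.r₁) * (q₂ D.HR : ℝ) ^ (1 + N₂ n D.HR) *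
      ((sOf n : ℝ) + 1)) ≤ 8 * Real.logb 2 n +
      (15 * (Real.logb 2 (2 * C + 6) + 60) + 85) * Real.logb 2 (Real.logb 2 n) := by
  obtain ⟨h1, h2, h3⟩ := logb_sOf_le hn
  have p1 : (0 : ℝ) < q₁ D.h (sOf n) := by exact_mod_cast (nextOddPrime_prime _).pos
  have p2 : (0 : ℝ) < q₂ D.HR := by exact_mod_cast (nextPrime_prime _).pos
  rw [Real.logb_mul (by positivity) (by positivity), Real.logb_mul (by positivity) (by positivity),
    Real.logb_mul (by positivity) (by positivity), Real.logb_pow, Real.logb_pow, Real.logb_pow]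
  have g1 := D.logb_q₁_le hn
  have g2 := D.logb_q₂_le hn
  obtain ⟨hN, hq⟩ := q₁_pow_le (by omega : 1 ≤ n) D.h (sOf n)
  have e1 := logb_pow_le (nextOddPrime_prime _).pos hq
  have e2 := logb_pow_le (nextPrime_prime _).pos (q₂_pow_le (n := n) D.HR)
  have z1 : 0 ≤ Real.logb 2 (q₁ D.h (sOf n)) :=
    Real.logb_nonneg (by norm_num) (by exact_mod_cast (nextOddPrime_prime _).one_le)
  have z2 : 0 ≤ Real.logb 2 (q₂ D.HR) :=
    Real.logb_nonneg (by norm_num) (by exact_mod_cast (nextPrime_prime _).one_le)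
  have e7 : Real.logb 2 7 ≤ 3 := by
    rw [Real.logb_le_iff_le_rpow (by norm_num) (by norm_num)]
    norm_num
  have en : Real.logb 2 ((n + 1 : ℕ) : ℝ) ≤ Real.logb 2 n + 1 := by
    have : Real.logb 2 n + 1 = Real.logb 2 (n * 2) := by
      rw [Real.logb_mul (by positivity) (by norm_num), Real.logb_self_eq_one (by norm_num)]
    rw [this]
    refine Real.logb_le_logb_of_le (by norm_num) (by positivity) ?_
    exact_mod_cast (by omega : n + 1 ≤ n * 2)
  have r3 := three_mul_r₁_le (by omega) D.r₁_le
  -- The minimality of `N₁` gives `q₁ ^ (N₁ - 2) ≤ n`, so `7 N₁ + 1` is written as `7 (N₁ - 2) +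
  -- 15`.
  have f1 : ((3 * D.r₁ : ℕ) : ℝ) * Real.logb 2 (q₁ D.h (sOf n)) ≤
      7 * Real.logb 2 n + 15 * Real.logb 2 (q₁ D.h (sOf n)) := by
    have : ((3 * D.r₁ : ℕ) : ℝ) ≤ 7 * ((N₁ n D.h (sOf n) - 2 : ℕ) : ℝ) + 15 := by
      exact_mod_cast (by omega : 3 * D.r₁ ≤ 7 * (N₁ n D.h (sOf n) - 2) + 15)
    have := mul_le_mul_of_nonneg_right this z1
    linarith
  have f2 : ((1 + N₂ n D.HR : ℕ) : ℝ) * Real.logb 2 (q₂ D.HR) ≤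
      Real.logb 2 n + 1 + 2 * Real.logb 2 (q₂ D.HR) := by
    have hN2 := (exists_N₂ n D.HR).1
    have : ((1 + N₂ n D.HR : ℕ) : ℝ) = ((N₂ n D.HR - 1 : ℕ) : ℝ) + 2 := by
      exact_mod_cast (by omega : 1 + N₂ n D.HR = (N₂ n D.HR - 1) + 2)
    rw [this, add_mul]
    linarith
  -- The constant is `85 = 6 * 3 + 1 + 2 * 27 + 12`: the counts modulo 7, the passage from `n + 1`
  -- to `n`, two powers of `q₂`, and `s + 1`.
  push_cast at f1 f2 ⊢
  linarith

theorem exists_large_code (C : ℕ) : ∃ K : ℝ, ∀ n : ℕ, 4 ≤ n → ∀ D : Ingredients n (sOf n) C,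
    ∃ p : D.Params, (D.code p).Nonempty ∧
      Real.logb 2 (CT2 n (sOf n)).ncard - 8 * Real.logb 2 n - K * Real.logb 2 (Real.logb 2 n)
        ≤ Real.logb 2 (D.code p).ncard := by
  refine ⟨15 * (Real.logb 2 (2 * C + 6) + 60) + 85, fun n hn D => ?_⟩
  obtain ⟨p, hp⟩ := D.exists_code_ncard_ge
  have hs : 1065 * Real.logb 2 n ≤ sOf n := Nat.le_ceil _
  have hc : (0 : ℝ) < (CT2 n (sOf n)).ncard := by
    have h := two_pow_le_ncard_CT2 (by omega) hs
    have := Nat.two_pow_pos n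
    exact_mod_cast (by omega : 0 < (CT2 n (sOf n)).ncard)
  have p1 : (0 : ℝ) < q₁ D.h (sOf n) := by exact_mod_cast (nextOddPrime_prime _).pos
  have p2 : (0 : ℝ) < q₂ D.HR := by exact_mod_cast (nextPrime_prime _).pos
  have hpos : (0 : ℝ) < (CT2 n (sOf n)).ncard / (7 ^ 6 * (q₁ D.h (sOf n) : ℝ) ^ (3 * D.r₁) *
      (q₂ D.HR : ℝ) ^ (1 + N₂ n D.HR) * ((sOf n : ℝ) + 1)) := by positivity
  refine ⟨p, (Set.ncard_pos (D.code_finite p)).1 (by exact_mod_cast hpos.trans_le hp), ?_⟩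
  have h1 := Real.logb_le_logb_of_le (b := 2) (by norm_num) hpos hp
  rw [Real.logb_div hc.ne' (by positivity)] at h1
  have h2 := D.logb_index_le hn
  linarith

end Ingredients

/-! ### Existence of the hash by greedy colouring -/

theorem exists_greedy_coloring {α : Type*} [DecidableEq α] (R : α → α → Prop) (hs : ∀ u v, R u v → R v u)
    (hi : ∀ u, ¬ R u u) (d : ℕ) (S : Finset α)
    (hd : ∀ u ∈ S, ∃ N : Finset α, N.card ≤ d ∧ ∀ v ∈ S, R u v → v ∈ N) :
    ∃ c : α → ℕ, (∀ u, c u ≤ d) ∧ ∀ u ∈ S, ∀ v ∈ S, R u v → c u ≠ c v := by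
  induction S using Finset.induction_on with
  | empty => exact ⟨fun _ => 0, by simp, by simp⟩
  | insert a S ha ih =>
    obtain ⟨c, hc, hcR⟩ := ih fun u hu => by
      obtain ⟨N, hN, h⟩ := hd u (Finset.mem_insert_of_mem hu)
      exact ⟨N, hN, fun v hv => h v (Finset.mem_insert_of_mem hv)⟩
    obtain ⟨N, hN, hNR⟩ := hd a (Finset.mem_insert_self a S)
    obtain ⟨k, hk, hkN⟩ : ∃ k ∈ Finset.range (d + 1), k ∉ N.image c := by
      by_contra h
      push Not at h
      have := (Finset.card_le_card (fun k hk => h k hk)).trans Finset.card_image_le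
      rw [Finset.card_range] at this
      omega
    have hka : ∀ v ∈ S, R a v → k ≠ c v := fun v hv h e =>
      hkN (Finset.mem_image.2 ⟨v, hNR v (Finset.mem_insert_of_mem hv) h, e.symm⟩)
    have hne : ∀ v ∈ S, v ≠ a := fun v hv h => ha (h ▸ hv)
    refine ⟨Function.update c a k, fun u => ?_, ?_⟩
    · by_cases h : u = a
      · rw [h, Function.update_self]
        have := Finset.mem_range.1 hk
        omega
      · rw [Function.update_of_ne h]
        exact hc u
    · intro u hu v hv huv
      rw [Finset.mem_insert] at hu hv
      rcases hu with rfl | hu <;> rcases hv with rfl | hv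
      · exact absurd huv (hi _)
      · rw [Function.update_self, Function.update_of_ne (hne v hv)]
        exact hka v hv huv
      · rw [Function.update_self, Function.update_of_ne (hne u hu)]
        exact (hka u hu (hs _ _ huv)).symm
      · rw [Function.update_of_ne (hne u hu), Function.update_of_ne (hne v hv)]
        exact hcR u hu v hv huv

/-- Different words of equal length with a common subword that lacks at most two symbols. -/
def Confusable (u v : List Bool) : Prop :=
  u ≠ v ∧ u.length = v.length ∧ ∃ y : List Bool, y.Sublist u ∧ y.Sublist v ∧ u.length ≤ y.length + 2

/-- Delete the symbols at the positions `i` and `i + j + 1`, then insert `a` and `b`. -/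
def exchange (u : List Bool) (t : (ℕ × ℕ) × (ℕ × ℕ) × Bool × Bool) : List Bool :=
  let z := u.take t.1.1 ++ ((u.drop (t.1.1 + 1)).take t.1.2 ++ (u.drop (t.1.1 + 1)).drop (t.1.2 + 1))
  z.take t.2.1.1 ++ t.2.2.1 :: ((z.drop t.2.1.1).take t.2.1.2 ++
    t.2.2.2 :: (z.drop t.2.1.1).drop t.2.1.2)

/-- A confusable word arises by deleting two symbols and inserting two: `m ^ 2` choices of lengths
for the deletion, `m ^ 2` for the insertion and 4 for the inserted symbols. -/
theorem Confusable.exists_neighbors (m : ℕ) (u : List Bool) (hu : u.length = m) :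
    ∃ N : Finset (List Bool), N.card ≤ 4 * m ^ 4 ∧ ∀ v ∈ words m, Confusable u v → v ∈ N := by
  rcases Nat.lt_or_ge m 2 with hm | hm
  · obtain rfl | rfl : m = 0 ∨ m = 1 := by omega
    · refine ⟨∅, by simp, fun v hv h => ?_⟩
      rw [mem_words, List.length_eq_zero_iff] at hv
      exact absurd ((List.length_eq_zero_iff.1 hu).trans hv.symm) h.1
    · exact ⟨words 1, by rw [card_words]; norm_num, fun v hv _ => hv⟩
  · refine ⟨((Finset.range m ×ˢ Finset.range m) ×ˢ (Finset.range m ×ˢ Finset.range m) ×ˢ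
      (Finset.univ : Finset (Bool × Bool))).image (exchange u), ?_, ?_⟩
    · refine Finset.card_image_le.trans (le_of_eq ?_)
      simp only [Finset.card_product, Finset.card_range, Finset.card_univ, Fintype.card_prod,
        Fintype.card_bool]
      ring
    · rintro v hv ⟨-, hl, y, hyu, hyv, hy⟩
      rw [mem_words] at hv
      -- The common subword is shortened to exactly `m - 2` symbols.
      have ht := List.take_sublist (m - 2) y
      have hlen : (y.take (m - 2)).length + 2 = m := by
        rw [List.length_take]
        omega
      obtain ⟨A, a, B, b, E, hu', hz⟩ := exists_of_mem_deletionBall (x := u) ⟨ht.trans hyu, by omega⟩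
      obtain ⟨A', a', B', b', E', hv', hz'⟩ :=
        exists_of_mem_deletionBall (x := v) ⟨ht.trans hyv, by omega⟩
      rw [hz] at hz'
      have l1 := congrArg List.length hu'
      have l2 := congrArg List.length hv'
      simp only [List.length_append, List.length_cons] at l1 l2
      refine Finset.mem_image.2 ⟨((A.length, B.length), (A'.length, B'.length), a', b'), ?_, ?_⟩
      · simp only [Finset.mem_product, Finset.mem_range, Finset.mem_univ, and_true]
        omega
      · have e : u.take A.length ++ ((u.drop (A.length + 1)).take B.length ++
            (u.drop (A.length + 1)).drop (B.length + 1)) = A' ++ (B' ++ E') := by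
          have e1 : u.drop (A.length + 1) = B ++ b :: E := by
            rw [hu', ← List.drop_drop, List.drop_left]
            rfl
          rw [← hz', e1, ← List.drop_drop, List.drop_left, List.take_left, hu', List.take_left]
          rfl
        simp only [exchange, e]
        rw [hv']
        simp

/-- The hash is the colour in a proper colouring of the confusability graph on the words of each
length. Degree at most `4 * m ^ 4` needs `4 * m ^ 4 + 1 ≤ 5 * m ^ 4` colours. -/
theorem exists_twoDeletionHash : ∃ h, IsTwoDeletionHash 5 h := by
  have hcol : ∀ m : ℕ, ∃ c : List Bool → ℕ, (∀ u, c u ≤ 4 * m ^ 4) ∧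
      ∀ u ∈ words m, ∀ v ∈ words m, Confusable u v → c u ≠ c v := fun m =>
    exists_greedy_coloring Confusable
      (fun u v ⟨h1, h2, y, h3, h4, h5⟩ => ⟨h1.symm, h2.symm, y, h4, h3, h2 ▸ h5⟩)
      (fun u h => h.1 rfl) _ _ fun u hu => Confusable.exists_neighbors m u (mem_words.1 hu)
  choose c hc hcR using hcol
  refine ⟨fun u => c u.length u, ?_, ?_⟩
  · intro u v y hl hu hv hy he
    by_contra hne
    refine hcR u.length u (mem_words.2 rfl) v (mem_words.2 hl.symm) ⟨hne, hl, y, hu, hv, hy⟩ ?_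
    change c u.length u = c v.length v at he
    rwa [← hl] at he
  · intro m hm
    have hsub : (fun u => c u.length u) '' {u | u.length = m} ⊆ (Finset.range (4 * m ^ 4 + 1) : Set ℕ) := by
      rintro _ ⟨u, rfl, rfl⟩
      have := hc u.length u
      simpa [Nat.lt_succ_iff] using this
    refine (Set.ncard_le_ncard hsub (Finset.finite_toSet _)).trans ?_
    rw [Set.ncard_coe_finset, Finset.card_range]
    have := Nat.one_le_pow 4 m hm
    omega

/-! ### Double-error-correcting codes from squares and cubic forms -/

section Collinear

variable {F K : Type*} [Field F] [Field K] [Algebra F K]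

/-- The degree of `a` over `F` is at most 2 and divides an odd number. -/
theorem mem_range_of_quadratic [FiniteDimensional F K] (hodd : Odd (Module.finrank F K)) {α β γ : F}
    (h0 : α ≠ 0 ∨ β ≠ 0) {a : K}
    (h : algebraMap F K α * a ^ 2 + algebraMap F K β * a + algebraMap F K γ = 0) :
    ∃ t, algebraMap F K t = a := by
  open Polynomial in
  have ha : IsIntegral F a := IsIntegral.of_finite F a
  set p : F[X] := C α * X ^ 2 + C β * X + C γ with hp
  have hp0 : p ≠ 0 := by
    intro hz
    rcases h0 with h0 | h0
    · have := congrArg (coeff · 2) hz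
      simp [hp] at this
      exact h0 this
    · have := congrArg (coeff · 1) hz
      simp [hp, coeff_C] at this
      exact h0 this
  have hpa : aeval a p = 0 := by
    simpa [hp] using h
  have h2 : (minpoly F a).natDegree ≤ 2 :=
    (natDegree_le_of_dvd (minpoly.dvd F a hpa) hp0).trans natDegree_quadratic_le
  have hd : (minpoly F a).natDegree ∣ Module.finrank F K := minpoly.degree_dvd ha
  have hpos := minpoly.natDegree_pos ha
  have h1 : (minpoly F a).natDegree = 1 := by
    rcases Nat.lt_or_ge (minpoly F a).natDegree 2 with h | h
    · omega
    · have : (minpoly F a).natDegree = 2 := by omega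
      rw [this] at hd
      exact absurd (even_iff_two_dvd.2 hd) (Nat.not_even_iff_odd.2 hodd)
  exact minpoly.natDegree_eq_one_iff.1 h1

/-- Three vectors with a common linear relation and the same relation between their squares are
parallel, if the degree of the field is odd. -/
theorem exists_parallel [FiniteDimensional F K] (hodd : Odd (Module.finrank F K)) (h2 : (2 : F) ≠ 0)
    {c₁ c₂ c₃ : F} (hc₁ : c₁ ≠ 0) (hc₂ : c₂ ≠ 0) (hc₃ : c₃ ≠ 0) {y₁ y₂ y₃ : K} (hy₃ : y₃ ≠ 0)
    (h : c₁ • y₁ + c₂ • y₂ + c₃ • y₃ = 0) (hh : c₁ • y₁ ^ 2 + c₂ • y₂ ^ 2 + c₃ • y₃ ^ 2 = 0) :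
    ∃ a b : F, y₁ = a • y₃ ∧ y₂ = b • y₃ := by
  simp only [Algebra.smul_def] at h hh ⊢
  have hc₂' : algebraMap F K c₂ ≠ 0 := by simpa using hc₂
  -- Eliminating `y₂` from the two relations gives this quadratic equation for `y₁ / y₃`. Its linear
  -- coefficient is nonzero because the characteristic is odd.
  obtain ⟨a, ha⟩ : ∃ t, algebraMap F K t = y₁ / y₃ := by
    refine mem_range_of_quadratic hodd (α := c₁ * (c₂ + c₁)) (β := 2 * c₁ * c₃)
      (γ := c₃ * (c₃ + c₂)) (Or.inr (by simp [h2, hc₁, hc₃])) ?_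
    simp only [map_mul, map_add, map_ofNat]
    field_simp
    linear_combination (algebraMap F K c₂) * hh -
      (algebraMap F K c₂ * y₂ - algebraMap F K c₁ * y₁ - algebraMap F K c₃ * y₃) * h
  have h₁ : y₁ = algebraMap F K a * y₃ := by
    rw [ha]
    field_simp
  refine ⟨a, -(c₁ * a + c₃) / c₂, h₁, ?_⟩
  rw [map_div₀, map_neg, map_add, map_mul]
  field_simp
  rw [h₁] at h
  linear_combination h

/-- The polynomial `(Y - y₁) * (Y - y₂)`, applied to the relations, keeps only the term at `y₀`. -/
theorem eq_zero_of_three_points {c₀ c₁ c₂ : F} {y₀ y₁ y₂ : K} (h1 : y₀ ≠ y₁) (h2 : y₀ ≠ y₂)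
    (e0 : c₀ + c₁ + c₂ = 0) (e1 : c₀ • y₀ + c₁ • y₁ + c₂ • y₂ = 0)
    (e2 : c₀ • y₀ ^ 2 + c₁ • y₁ ^ 2 + c₂ • y₂ ^ 2 = 0) : c₀ = 0 := by
  simp only [Algebra.smul_def] at e1 e2
  have e0' := congrArg (algebraMap F K) e0
  simp only [map_add, map_zero] at e0'
  have : algebraMap F K c₀ * ((y₀ - y₁) * (y₀ - y₂)) = 0 := by
    linear_combination e2 - (y₁ + y₂) * e1 + y₁ * y₂ * e0'
  rcases mul_eq_zero.1 this with h | h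
  · simpa using h
  · rcases mul_eq_zero.1 h with h | h
    · exact absurd (sub_eq_zero.1 h) h1
    · exact absurd (sub_eq_zero.1 h) h2

end Collinear

/-- On a line a cubic form is a cubic polynomial whose leading coefficient is the value of the form
at the direction; the middle coefficients are irrelevant. -/
theorem det_add_smul_fin_three {R : Type*} [CommRing R] (A B : Matrix (Fin 3) (Fin 3) R) :
    ∃ e₁ e₂ : R, ∀ t : R, (A + t • B).det = A.det + e₁ * t + e₂ * t ^ 2 + B.det * t ^ 3 := by
  refine ⟨(A.updateRow 0 (B 0)).det + (A.updateRow 1 (B 1)).det + (A.updateRow 2 (B 2)).det,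
    (B.updateRow 0 (A 0)).det + (B.updateRow 1 (A 1)).det + (B.updateRow 2 (A 2)).det, fun t => ?_⟩
  simp only [Matrix.det_fin_three, Matrix.add_apply, Matrix.smul_apply, smul_eq_mul,
    Matrix.updateRow_apply]
  simp
  ring

section FourPoints

universe u

variable {F V K : Type u} [Field F] [AddCommGroup V] [Module F V] [Field K] [Algebra F K]
  [FiniteDimensional F K] {k : ℕ}

/-- Four points with a linear relation that also holds for their squares and for the values of
a system of cubic forms without common zero. -/
theorem false_of_four_points (hodd : Odd (Module.finrank F K)) (h2 : (2 : F) ≠ 0) (ι : V →ₗ[F] K)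
    (hι : Function.Injective ι) (M : V →ₗ[F] (Fin k → Matrix (Fin 3) (Fin 3) F))
    (hM : ∀ d, d ≠ 0 → ∃ j, (M d j).det ≠ 0) {c₀ c₁ c₂ c₃ : F} (hc₁ : c₁ ≠ 0) (hc₂ : c₂ ≠ 0)
    (hc₃ : c₃ ≠ 0) {x₀ x₁ x₂ x₃ : V} (h10 : x₁ ≠ x₀) (h30 : x₃ ≠ x₀) (h12 : x₁ ≠ x₂)
    (h13 : x₁ ≠ x₃) (e0 : c₀ + c₁ + c₂ + c₃ = 0)
    (e1 : c₀ • x₀ + c₁ • x₁ + c₂ • x₂ + c₃ • x₃ = 0)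
    (e2 : c₀ • ι x₀ ^ 2 + c₁ • ι x₁ ^ 2 + c₂ • ι x₂ ^ 2 + c₃ • ι x₃ ^ 2 = 0)
    (e3 : ∀ j, c₀ * (M x₀ j).det + c₁ * (M x₁ j).det + c₂ * (M x₂ j).det + c₃ * (M x₃ j).det = 0) :
    False := by
  have hy₃ : ι (x₃ - x₀) ≠ 0 := fun h => h30 (sub_eq_zero.1 (hι (h.trans (map_zero ι).symm)))
  have e0' := congrArg (algebraMap F K) e0
  have e1' := congrArg ι e1
  simp only [map_add, map_smul, map_zero, Algebra.smul_def] at e0' e1' e2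
  -- Translating `x₀` to the origin turns the relations into relations between three differences;
  -- these are parallel, so the four points lie on a line over `F`.
  obtain ⟨a, b, ha, hb⟩ := exists_parallel hodd h2 hc₁ hc₂ hc₃ hy₃ (y₁ := ι (x₁ - x₀))
    (y₂ := ι (x₂ - x₀)) (by
      simp only [map_sub, Algebra.smul_def]
      linear_combination e1' - ι x₀ * e0') (by
      simp only [map_sub, Algebra.smul_def]
      linear_combination e2 - 2 * ι x₀ * e1' + ι x₀ ^ 2 * e0')
  rw [← map_smul] at ha hb
  have f1 : x₁ = x₀ + a • (x₃ - x₀) := by rw [← hι ha]; abel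
  have f2 : x₂ = x₀ + b • (x₃ - x₀) := by rw [← hι hb]; abel
  have f3 : x₃ = x₀ + (1 : F) • (x₃ - x₀) := by rw [one_smul]; abel
  have hd : x₃ - x₀ ≠ 0 := sub_ne_zero.2 h30
  set d := x₃ - x₀
  have ha0 : a ≠ 0 := by
    rintro rfl
    exact h10 (by rw [f1, zero_smul, add_zero])
  have ha1 : a ≠ 1 := by
    rintro rfl
    exact h13 (f1.trans f3.symm)
  have hab : a ≠ b := by
    rintro rfl
    exact h12 (f1.trans f2.symm)
  have g1 : c₁ * a + c₂ * b + c₃ = 0 := by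
    have h : (c₁ * a + c₂ * b + c₃) • d = 0 := by
      have h' : c₀ • x₀ + c₁ • (x₀ + a • d) + c₂ • (x₀ + b • d) + c₃ • (x₀ + (1 : F) • d) = 0 := by
        rw [← f1, ← f2, ← f3]
        exact e1
      have h'' : (c₀ + c₁ + c₂ + c₃) • x₀ + (c₁ * a + c₂ * b + c₃) • d = 0 := by
        rw [← h']
        module
      rwa [e0, zero_smul, zero_add] at h''
    exact (smul_eq_zero.1 h).resolve_right hd
  have hιd : ι d ≠ 0 := hy₃
  have g2 : c₁ * a ^ 2 + c₂ * b ^ 2 + c₃ = 0 := by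
    have g1' := congrArg (algebraMap F K) g1
    simp only [map_add, map_mul, map_zero] at g1'
    have i1 := congrArg ι f1
    have i2 := congrArg ι f2
    have i3 := congrArg ι f3
    simp only [map_add, map_smul, Algebra.smul_def, map_one] at i1 i2 i3
    rw [i1, i2, i3] at e2
    have h : algebraMap F K (c₁ * a ^ 2 + c₂ * b ^ 2 + c₃) * ι d ^ 2 = 0 := by
      simp only [map_add, map_mul, map_pow]
      linear_combination e2 - ι x₀ ^ 2 * e0' - 2 * ι x₀ * ι d * g1'
    have := (mul_eq_zero.1 h).resolve_right (pow_ne_zero 2 hιd)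
    exact (map_eq_zero (algebraMap F K)).1 this
  -- Some form does not vanish at the direction `d`. The lower coefficients on the line drop out by
  -- the relations for the powers 0, 1 and 2.
  have g3 : c₁ * a ^ 3 + c₂ * b ^ 3 + c₃ = 0 := by
    obtain ⟨j, hj⟩ := hM d hd
    obtain ⟨r₁, r₂, hr⟩ := det_add_smul_fin_three (M x₀ j) (M d j)
    have i : ∀ t : F, (M (x₀ + t • d) j).det =
        (M x₀ j).det + r₁ * t + r₂ * t ^ 2 + (M d j).det * t ^ 3 := by
      intro t
      rw [← hr, map_add, map_smul]
      rfl
    have h := e3 j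
    rw [f1, f2, f3, i, i, i] at h
    have h' : (c₁ * a ^ 3 + c₂ * b ^ 3 + c₃) * (M d j).det = 0 := by
      linear_combination h - (M x₀ j).det * e0 - r₁ * g1 - r₂ * g2
    exact (mul_eq_zero.1 h').resolve_right hj
  -- The polynomial `t * (t - b) * (t - 1)` vanishes at the parameters `0`, `b`, `1` of the other
  -- three points.
  have h : c₁ * (a * (a - b) * (a - 1)) = 0 := by
    linear_combination g3 - (b + 1) * g2 + b * g1
  rcases mul_eq_zero.1 h with h | h
  · exact hc₁ h
  · rcases mul_eq_zero.1 h with h | h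
    · rcases mul_eq_zero.1 h with h | h
      · exact ha0 h
      · exact hab (sub_eq_zero.1 h)
    · exact ha1 (sub_eq_zero.1 h)

theorem eq_zero_of_card_support_le_four [Fintype V] [DecidableEq V] [DecidableEq F]
    (hV : 3 ≤ Fintype.card V)
    (hodd : Odd (Module.finrank F K)) (h2 : (2 : F) ≠ 0) (ι : V →ₗ[F] K)
    (hι : Function.Injective ι) (M : V →ₗ[F] (Fin k → Matrix (Fin 3) (Fin 3) F))
    (hM : ∀ d, d ≠ 0 → ∃ j, (M d j).det ≠ 0) (v : V → F)
    (s0 : ∑ x, v x = 0) (s1 : ∑ x, v x • x = 0) (s2 : ∑ x, v x • ι x ^ 2 = 0)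
    (s3 : ∀ j, ∑ x, v x * (M x j).det = 0)
    (hv : (Finset.univ.filter fun x => v x ≠ 0).card ≤ 4) : v = 0 := by
  by_contra hne
  obtain ⟨x₀, hx₀⟩ := Function.ne_iff.1 hne
  set S := Finset.univ.filter fun x => v x ≠ 0 with hS
  have hmem : x₀ ∈ S := by simpa [hS] using hx₀
  have hcard := Finset.card_erase_of_mem hmem
  rcases Nat.lt_or_ge S.card 4 with hlt | hge
  -- A smaller support is filled up to three points, for which the cubic forms are not needed.
  · obtain ⟨E, hE1, hE2, hE3⟩ := Finset.exists_subsuperset_card_eq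
      (Finset.erase_subset_erase x₀ (Finset.subset_univ S)) (n := 2) (by omega) (by
        rw [Finset.card_erase_of_mem (Finset.mem_univ _), Finset.card_univ]
        omega)
    obtain ⟨x₁, x₂, h12, rfl⟩ := Finset.card_eq_two.1 hE3
    have h1 : x₁ ≠ x₀ := Finset.ne_of_mem_erase (hE2 (by simp))
    have h2 : x₂ ≠ x₀ := Finset.ne_of_mem_erase (hE2 (by simp))
    have hz : ∀ x, x ∉ ({x₀, x₁, x₂} : Finset V) → v x = 0 := by
      intro x hx
      by_contra hvx
      rw [Finset.mem_insert, not_or] at hx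
      exact hx.2 (hE1 (Finset.mem_erase.2 ⟨hx.1, by simpa [hS] using hvx⟩))
    have hsum : ∀ {W : Type u} [AddCommGroup W] [Module F W] (f : V → W), ∑ x, v x • f x =
        v x₀ • f x₀ + v x₁ • f x₁ + v x₂ • f x₂ := by
      intro W _ _ f
      rw [← Finset.sum_subset (Finset.subset_univ {x₀, x₁, x₂}) fun x _ hx => by rw [hz x hx, zero_smul],
        Finset.sum_insert (by simp [h1.symm, h2.symm]), Finset.sum_insert (by simp [h12]),
        Finset.sum_singleton, add_assoc]
    have t0 : v x₀ + v x₁ + v x₂ = 0 := by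
      rw [← s0]
      simpa using (hsum fun _ => (1 : F)).symm
    have t1 : v x₀ • ι x₀ + v x₁ • ι x₁ + v x₂ • ι x₂ = 0 := by
      rw [← hsum]
      simpa using congrArg ι s1
    have t2 := (hsum fun x => ι x ^ 2).symm.trans s2
    exact hx₀ (eq_zero_of_three_points (fun h => h1 (hι h).symm) (fun h => h2 (hι h).symm) t0 t1 t2)
  · obtain ⟨x₁, x₂, x₃, h12, h13, h23, hE⟩ := Finset.card_eq_three.1
      (hcard.trans (show S.card - 1 = 3 by omega))
    have hm : ∀ x, x ∈ ({x₁, x₂, x₃} : Finset V) → x ≠ x₀ ∧ v x ≠ 0 := by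
      intro x hx
      rw [← hE, Finset.mem_erase] at hx
      simpa [hS] using hx
    obtain ⟨h1, hv1⟩ := hm x₁ (by simp)
    obtain ⟨h2', hv2⟩ := hm x₂ (by simp)
    obtain ⟨h3, hv3⟩ := hm x₃ (by simp)
    have hz : ∀ x, x ∉ ({x₀, x₁, x₂, x₃} : Finset V) → v x = 0 := by
      intro x hx
      by_contra hvx
      rw [Finset.mem_insert, not_or] at hx
      exact hx.2 (hE ▸ Finset.mem_erase.2 ⟨hx.1, by simpa [hS] using hvx⟩)
    have hsum : ∀ {W : Type u} [AddCommGroup W] [Module F W] (f : V → W), ∑ x, v x • f x =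
        v x₀ • f x₀ + v x₁ • f x₁ + v x₂ • f x₂ + v x₃ • f x₃ := by
      intro W _ _ f
      rw [← Finset.sum_subset (Finset.subset_univ {x₀, x₁, x₂, x₃})
          fun x _ hx => by rw [hz x hx, zero_smul],
        Finset.sum_insert (by simp [h1.symm, h2'.symm, h3.symm]),
        Finset.sum_insert (by simp [h12, h13]), Finset.sum_insert (by simp [h23]),
        Finset.sum_singleton, add_assoc, add_assoc]
    have t0 : v x₀ + v x₁ + v x₂ + v x₃ = 0 := by
      rw [← s0]
      simpa using (hsum fun _ => (1 : F)).symm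
    have t1 := (hsum fun x => x).symm.trans s1
    have t2 := (hsum fun x => ι x ^ 2).symm.trans s2
    have t3 := fun j => (hsum fun x => (M x j).det).symm.trans (s3 j)
    exact false_of_four_points hodd h2 ι hι M hM hv1 hv2 hv3 h1 h3 h12 h13 t0 t1 t2 t3

end FourPoints

/-- A double-error-correcting code of length `q ^ m` with redundancy about `7 m / 3`. -/
theorem exists_isParityCheck_five (q m : ℕ) [Fact q.Prime] (hq : q ≠ 2) (hm : 1 ≤ m) :
    ∃ r ≤ 2 * (m + 1) + (m + 2) / 3, ∃ H : Matrix (Fin r) (Fin (q ^ m)) (ZMod q), IsParityCheck 5 H := by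
  classical
  have hq2 : 2 < q := lt_of_le_of_ne (Fact.out : q.Prime).two_le hq.symm
  -- The extension that contains the squares must have odd degree, which costs at most one more
  -- dimension.
  obtain ⟨m', hm', hodd⟩ : ∃ m', (m' = m ∨ m' = m + 1) ∧ Odd m' := by
    rcases Nat.even_or_odd m with h | h
    · exact ⟨m + 1, Or.inr rfl, h.add_one⟩
    · exact ⟨m, Or.inl rfl, h⟩
  set k := (m + 2) / 3
  let F := ZMod q
  let K := GaloisField q m'
  let K₃ := GaloisField q 3
  have hK : Module.finrank F K = m' := GaloisField.finrank q (by omega)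
  have hK₃ : Module.finrank F K₃ = 3 := GaloisField.finrank q (by norm_num)
  obtain ⟨ι, hι⟩ := (finrank_le_iff_exists_linearMap (R := F) (M := Fin m → F) (M' := K)).1 (by
    rw [hK, Module.finrank_fin_fun]
    omega)
  obtain ⟨L, hL⟩ := (finrank_le_iff_exists_linearMap (R := F) (M := Fin m → F)
    (M' := Fin k → K₃)).1 (by
      rw [Module.finrank_fin_fun, Module.finrank_pi_fintype]
      simp only [hK₃, Finset.sum_const, Finset.card_univ, Fintype.card_fin, smul_eq_mul]
      omega)
  -- Norms from the extension of degree 3, written as determinants of multiplication matrices, are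
  -- cubic forms. Applied to the coordinates of the injective map `L`, they have only the trivial
  -- common zero.
  let b : Module.Basis (Fin 3) F K₃ := Module.finBasisOfFinrankEq F K₃ hK₃
  let M : (Fin m → F) →ₗ[F] (Fin k → Matrix (Fin 3) (Fin 3) F) :=
    LinearMap.pi fun j => (Algebra.leftMulMatrix b).toLinearMap ∘ₗ LinearMap.proj j ∘ₗ L
  have hM : ∀ d, d ≠ 0 → ∃ j, (M d j).det ≠ 0 := by
    intro d hd
    have hLd : L d ≠ 0 := fun h => hd (hL (h.trans (map_zero L).symm))
    obtain ⟨j, hj⟩ := Function.ne_iff.1 hLd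
    refine ⟨j, fun h0 => ?_⟩
    have h1 : Algebra.leftMulMatrix b (L d j) * Algebra.leftMulMatrix b (L d j)⁻¹ = 1 := by
      rw [← map_mul, mul_inv_cancel₀ hj, map_one]
    have h2 := congrArg Matrix.det h1
    rw [Matrix.det_mul, Matrix.det_one] at h2
    have h3 : (Algebra.leftMulMatrix b (L d j)).det = 0 := h0
    rw [h3, zero_mul] at h2
    exact zero_ne_one h2
  let W := F × (Fin m → F) × K × (Fin k → F)
  let col : (Fin m → F) → W := fun x => (1, x, ι x ^ 2, fun j => (M x j).det)
  have hW : Module.finrank F W = 1 + (m + (m' + k)) := by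
    simp only [W, Module.finrank_prod, hK, Module.finrank_fin_fun, Module.finrank_self]
  let e : W ≃ₗ[F] (Fin (1 + (m + (m' + k))) → F) :=
    LinearEquiv.ofFinrankEq _ _ (by rw [hW, Module.finrank_fin_fun])
  let σ : Fin (q ^ m) ≃ (Fin m → F) := Fintype.equivOfCardEq (by simp [F, ZMod.card])
  -- The summands are the dimensions of the constant, the point, its square and the cubic forms; `m'
  -- ≤ m + 1` gives the bound.
  refine ⟨1 + (m + (m' + k)), by omega, Matrix.of fun i x => e (col (σ x)) i, ?_⟩
  intro v hv hne
  by_contra hlt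
  have hsum : ∑ x, v (σ.symm x) • col x = 0 := by
    apply e.injective
    rw [map_zero, ← hv, map_sum]
    ext i
    rw [Finset.sum_apply, Matrix.mulVec, dotProduct, ← Equiv.sum_comp σ]
    refine Finset.sum_congr rfl fun x _ => ?_
    simp [mul_comm]
  have hφ : ∀ {X : Type} [AddCommGroup X] [Module F X] (φ : W →ₗ[F] X),
      ∑ x, v (σ.symm x) • φ (col x) = 0 := by
    intro X _ _ φ
    rw [← map_zero φ, ← hsum, map_sum]
    simp only [map_smul]
  apply hne
  have hz := eq_zero_of_card_support_le_four (F := F) (K := K) (k := k) (V := Fin m → F) (by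
      rw [Fintype.card_fun, ZMod.card, Fintype.card_fin]
      exact hq2.trans_le (Nat.le_self_pow (by omega) q)) (by rw [hK]; exact hodd) (by
      intro h
      have := (ZMod.natCast_eq_zero_iff 2 q).1 (by exact_mod_cast h)
      exact absurd (Nat.le_of_dvd (by norm_num) this) (by omega)) ι hι M hM (fun x => v (σ.symm x))
    ((Finset.sum_congr rfl fun x _ => (mul_one (v (σ.symm x))).symm).trans
      (hφ (LinearMap.fst F F ((Fin m → F) × K × (Fin k → F)))))
    (hφ (LinearMap.fst F (Fin m → F) (K × (Fin k → F)) ∘ₗ LinearMap.snd F F _))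
    (hφ (LinearMap.fst F K (Fin k → F) ∘ₗ LinearMap.snd F (Fin m → F) _ ∘ₗ LinearMap.snd F F _))
    (fun j => hφ (LinearMap.proj j ∘ₗ LinearMap.snd F K (Fin k → F) ∘ₗ
      LinearMap.snd F (Fin m → F) _ ∘ₗ LinearMap.snd F F _))
    (by
      have : (Finset.univ.filter fun x => v (σ.symm x) ≠ 0).card ≤ hammingNorm v := by
        unfold hammingNorm
        refine Finset.card_le_card_of_injOn σ.symm ?_ σ.symm.injective.injOn
        intro x hx
        simpa using hx
      omega)
  ext x
  simpa using congrFun hz (σ x)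

/-! ### Existence of all ingredients, and the main theorem -/

theorem exists_injOn_zmod {α : Type*} {S : Set α} (hS : S.Finite) {q : ℕ} [NeZero q]
    (hq : S.ncard ≤ q) : ∃ e : α → ZMod q, Set.InjOn e S := by
  obtain ⟨e, -, he⟩ := Set.Finite.exists_injOn_of_encard_le (s := S) (t := (Set.univ : Set (ZMod q))) hS (by
    rw [← hS.cast_ncard_eq, ← Set.finite_univ.cast_ncard_eq, Set.ncard_univ, Nat.card_zmod]
    exact_mod_cast hq)
  exact ⟨e, he⟩

theorem exists_orderOf_eq {q N : ℕ} [Fact q.Prime] (hN : N ≠ 0) :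
    ∃ α : GaloisField q N, orderOf α = q ^ N - 1 := by
  classical
  have := Fintype.ofFinite (GaloisField q N)
  obtain ⟨g, hg⟩ := IsCyclic.exists_ofOrder_eq_natCard (α := (GaloisField q N)ˣ)
  refine ⟨g, ?_⟩
  rw [orderOf_units, hg, Nat.card_units, GaloisField.card q N hN]

theorem lt_nextOddPrime (m : ℕ) : m < nextOddPrime m ∧ Odd (nextOddPrime m) := by
  have h : {p : ℕ | p.Prime ∧ Odd p ∧ m < p}.Nonempty := by
    obtain ⟨p, hp, hp'⟩ := Nat.exists_infinite_primes (m + 3)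
    exact ⟨p, hp', hp'.odd_of_ne_two (by omega), by omega⟩
  exact ⟨(Nat.sInf_mem h).2.2, (Nat.sInf_mem h).2.1⟩

theorem exists_ingredients {n : ℕ} (hn : 1 ≤ n) (s : ℕ) :
    ∃ D : Ingredients n s 5, D.HR = runMatrix s := by
  obtain ⟨h, hh⟩ := exists_twoDeletionHash
  obtain ⟨e₁, he₁⟩ := exists_injOn_zmod (hashImage_finite h s) (lt_nextOddPrime (hashImage h s).ncard).1.le
  obtain ⟨e₂, he₂⟩ := exists_injOn_zmod (runImage (runMatrix s)).toFinite
    (lt_nextPrime (runImage (runMatrix s)).ncard).le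
  obtain ⟨α, hα⟩ := exists_orderOf_eq (q := q₂ (runMatrix s)) (exists_N₂ n (runMatrix s)).1.ne'
  obtain ⟨hN, -⟩ := q₁_pow_le hn h s
  obtain ⟨r, hr, H, hH⟩ := exists_isParityCheck_five (q₁ h s) (N₁ n h s - 1) (by
    intro h2
    have := (lt_nextOddPrime (hashImage h s).ncard).2
    rw [show nextOddPrime (hashImage h s).ncard = 2 from h2] at this
    exact absurd this (by decide)) (by omega)
  refine ⟨⟨h, hh, e₁, he₁, r, hr.trans ?_, H, hH, runMatrix s, runMatrix_isParityCheck s, e₂, he₂, α, hα⟩, rfl⟩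
  -- With `m = N₁ - 1`, the natural-number quotient `(m + 2) / 3` is `m / 3` rounded up.
  have : (N₁ n h s - 1 + 2) / 3 ≤ ⌈((N₁ n h s : ℚ) - 1) / 3⌉₊ := by
    refine Nat.lt_add_one_iff.1 (Nat.div_lt_of_lt_mul ?_)
    have h1 : ((N₁ n h s : ℚ) - 1) / 3 ≤ ⌈((N₁ n h s : ℚ) - 1) / 3⌉₊ := Nat.le_ceil _
    have h2 : (N₁ n h s : ℚ) ≤ ((3 * ⌈((N₁ n h s : ℚ) - 1) / 3⌉₊ + 1 : ℕ) : ℚ) := by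
      push_cast
      linarith
    have h3 : N₁ n h s ≤ 3 * ⌈((N₁ n h s : ℚ) - 1) / 3⌉₊ + 1 := by exact_mod_cast h2
    omega
  omega

end TwoDel

theorem mainTheorem2 :
    -- the code corrects two deletions, for all values of its parameters
    (∀ s : ℕ, TwoDel.IsParityCheck 3 (TwoDel.runMatrix s)) ∧
    (∀ (n s C : ℕ) (D : TwoDel.Ingredients n s C), D.HR = TwoDel.runMatrix s →
      ∀ p : D.Params, TwoDel.CorrectsTwoDeletions (D.code p)) ∧
    -- averaging over the parameters
    (∀ (n s C : ℕ) (D : TwoDel.Ingredients n s C), ∃ p : D.Params,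
      ((TwoDel.CT2 n s).ncard : ℝ) /
          (7 ^ 6 * (TwoDel.q₁ D.h s : ℝ) ^ (3 * D.r₁) *
            (TwoDel.q₂ D.HR : ℝ) ^ (1 + TwoDel.N₂ n D.HR) * (s + 1))
        ≤ ((D.code p).ncard : ℝ)) ∧
    -- the resulting bound for `s = ⌈1065 log₂ n⌉`
    (∀ C : ℕ, ∃ K : ℝ, ∀ n : ℕ, 4 ≤ n → ∀ D : TwoDel.Ingredients n (TwoDel.sOf n) C,
      ∃ p : D.Params, (D.code p).Nonempty ∧
        Real.logb 2 (TwoDel.CT2 n (TwoDel.sOf n)).ncard - 8 * Real.logb 2 n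
            - K * Real.logb 2 (Real.logb 2 n)
          ≤ Real.logb 2 (D.code p).ncard) ∧
    -- the constrained set costs only a constant number of bits
    (∃ K : ℝ, ∀ n s : ℕ, 2 ≤ n → 1065 * Real.logb 2 n ≤ s →
      (TwoDel.CT2 n s).Nonempty ∧ (n : ℝ) - K ≤ Real.logb 2 (TwoDel.CT2 n s).ncard) ∧
    -- two-deletion codes of this form with `8 log₂ n + O(log₂ log₂ n)` bits of redundancy exist
    (∃ (C : ℕ) (K : ℝ), ∀ n : ℕ, 4 ≤ n →
      ∃ (D : TwoDel.Ingredients n (TwoDel.sOf n) C) (p : D.Params),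
        D.HR = TwoDel.runMatrix (TwoDel.sOf n) ∧
        TwoDel.CorrectsTwoDeletions (D.code p) ∧ (D.code p).Nonempty ∧
        (n : ℝ) - 8 * Real.logb 2 n - K * Real.logb 2 (Real.logb 2 n)
          ≤ Real.logb 2 (D.code p).ncard) := by
  refine ⟨TwoDel.runMatrix_isParityCheck, fun n s C D hR p => D.correctsTwoDeletions hR p,
    fun n s C D => D.exists_code_ncard_ge, TwoDel.Ingredients.exists_large_code,
    TwoDel.CT2_large, ?_⟩
  obtain ⟨K₁, h₁⟩ := TwoDel.Ingredients.exists_large_code 5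
  obtain ⟨K₂, h₂⟩ := TwoDel.CT2_large
  -- The constant `K₂` lost by the constrained set is absorbed since `log₂ log₂ n ≥ 1`; the absolute
  -- value covers a negative `K₂`.
  refine ⟨5, K₁ + |K₂|, fun n hn => ?_⟩
  obtain ⟨D, hR⟩ := TwoDel.exists_ingredients (by omega : 1 ≤ n) (TwoDel.sOf n)
  obtain ⟨p, hne, hp⟩ := h₁ n hn D
  refine ⟨D, p, hR, D.correctsTwoDeletions hR p, hne, ?_⟩
  have h3 := (h₂ n (TwoDel.sOf n) (by omega) (Nat.le_ceil _)).2
  have h4 := (TwoDel.logb_sOf_le hn).2.1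
  have h5 := le_abs_self K₂
  have h6 := le_mul_of_one_le_right (abs_nonneg K₂) h4
  linarith
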